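/- **Setting.** Let $R$ be a Noetherian unique factorization domain with $\tfrac12\in R$, let $p\ge 1$, $q\ge 3$ be integers, put $n=p+2$, and let $B_0,B_1,H$ be free $R$-modules of ranks $q-2$, $p+q$, $n$. Write $(-)^*=\operatorname{Hom}_R(-,R)$. Equip $H\oplus H^*$ with the quadratic form $Q(f,f')=f'(f)$ and with its pairing $\langle (f,f'),(g,g')\rangle=f'(g)+g'(f)$, which identifies $(H\oplus H^*)^*$ with $H\oplus H^*$. For an ideal $I$ let $\operatorname{grade} I=\inf\{i:\operatorname{Ext}^i_R(R/I,R)\ne 0\}$ (so $\operatorname{grade}(1)=\infty$). Let $$\mathbb B\colon\ 0\to B_0^*\xrightarrow{\delta_4=\delta_1^*}B_1^*\xrightarrow{\delta_3=\delta_2^*}H\oplus H^*\xrightarrow{\delta_2}B_1\xrightarrow{\delta_1}B_0$$ be acyclic (exact except possibly at $B_0$). Over $K=\operatorname{Frac}(R)$ the image of $\delta_3$ is a maximal isotropic subspace of $(H\oplus H^*)_K$; assume that it does not lie in the same component of the variety of maximal isotropic subspaces as $H^*_K$, i.e. $\dim_K(\operatorname{im}(\delta_3)_K\cap H^*_K)\not\equiv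 n \pmod 2$. **Spinor coordinates.** Let $V_{\mathrm{even}}=\bigwedge^{\mathrm{even}}H$ and $V_{\mathrm{odd}}=\bigwedge^{\mathrm{odd}}H$. Let $x=(f,f')\in H\oplus H^*$ act on $\bigwedge H$ by $x\cdot s=f\wedge s+f'\lrcorner s$, where $f'\lrcorner(e_1\wedge\dots\wedge e_j)=\sum_i(-1)^{i-1}f'(e_i)\,e_1\wedge\dots\wedge\hat e_i\wedge\dots\wedge e_j$; this extends to an action of the Clifford algebra of $Q$. Let $\beta(s,t)$ be the coefficient of $s^{\mathrm{t}}\wedge t$ in $\bigwedge^nH\cong R$, where $s^{\mathrm t}$ is the reversal of $s$, and let $\mathbf P\colon S_2(V_{\mathrm{odd}})\to\bigwedge^n(H\oplus H^*)$ be the map with $\langle \mathbf P(st),v_1\wedge\dots\wedge v_n\rangle=\beta(s,[v_1\cdots v_n]\cdot t)$, where $[v_1\cdots v_n]$ is the antisymmetrized Clifford product. Let $\mathbf a_3\in\bigwedge^n(H\oplus H^*)$ be the Buchsbaum–Eisenbud multiplier: with $\mathbf a_4\in\bigwedge^{q-2}B_1^*$ the image of a generator of $\bigwedge^{q-2}B_0^*$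 under $\bigwedge^{q-2}\delta_4$, one has $\bigwedge^n\delta_3(\xi)=(\xi\wedge\mathbf a_4)\,\mathbf a_3$ for all $\xi\in\bigwedge^nB_1^*$, where $\bigwedge^{p+q}B_1^*\cong R$. *Spinor coordinates* of $\mathbb B$ are an element $\tilde{\mathbf a}_3\in V_{\mathrm{odd}}$ such that $\mathbf P(\tilde{\mathbf a}_3^{\,2})=\mathbf a_3$ up to a unit of $R$. **Theorem.** Spinor coordinates of $\mathbb B$ exist. Let $\tilde{\mathbf a}_3$ be any choice of them. Then the dual $V_{\mathrm{even}}^*\to(H\oplus H^*)^*\cong H\oplus H^*$ of the map $x\mapsto x\cdot\tilde{\mathbf a}_3$ lifts along $\delta_3$ to a map $w\colon V_{\mathrm{even}}^*\to B_1^*$. For every such lift $w$, the maps $d_3=[\,\delta_4,\ w|_R\,]$ (with $R=\bigwedge^0H^*\subset V_{\mathrm{even}}^*$), $d_2=(\delta_2|_H)^*$ and $d_1=\tilde{\mathbf a}_3^*|_{H^*}$ (with $H^*\subset V_{\mathrm{odd}}^*$) form a complex $$\mathbb A\colon\ 0\to B_0^*\oplus R\xrightarrow{d_3}B_1^*\xrightarrow{d_2}H^*\xrightarrow{d_1}R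 .$$ Let $I$ be the ideal generated by the entries of $d_1$. If $\operatorname{grade} I\ge 3$, then $\mathbb A$ is acyclic (exact except possibly at the last term $R$), and either $\operatorname{grade} I=3$ or $I=(1)$. -/

import Mathlib

open scoped TensorProduct

noncomputable section

namespace SpinorRes

universe u

/-- The grade of an ideal: the least `i` with `Ext^i(R/I, R) ≠ 0`, and `⊤` if there is none. -/
def grade {R : Type u} [CommRing R] (I : Ideal R) : ℕ∞ :=
  sInf {g : ℕ∞ | ∃ i : ℕ, g = i ∧
    Nontrivial (CategoryTheory.Abelian.Ext.{u} (ModuleCat.of R (R ⧸ I)) (ModuleCat.of R R) i)}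

section Hyperbolic

variable (R H : Type*) [CommRing R] [AddCommGroup H] [Module R H]

/-- The module `H ⊕ H^*`, in the order `H^* × H` in which Mathlib defines the evaluation form:
its quadratic form is `QuadraticForm.dualProd R H : (f', f) ↦ f' f`, and the associated pairing
is `LinearMap.dualProd R H`. -/
abbrev Hyp : Type _ := Module.Dual R H × H

/-- The half-spinor module `⋀^even H`. -/
abbrev VEven : Submodule R (ExteriorAlgebra R H) :=
  CliffordAlgebra.evenOdd (0 : QuadraticForm R H) 0

/-- The half-spinor module `⋀^odd H`. -/
abbrev VOdd : Submodule R (ExteriorAlgebra R H) :=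
  CliffordAlgebra.evenOdd (0 : QuadraticForm R H) 1

/-- The action of `H ⊕ H^*` on `⋀ H`: the vector `(f', f)` sends `x` to `f ∧ x + f' ⌋ x`, where
`f' ⌋ (e₁ ∧ ⋯ ∧ eⱼ) = ∑ i, (-1)^(i-1) f'(eᵢ) e₁ ∧ ⋯ ∧ êᵢ ∧ ⋯ ∧ eⱼ`. -/
def spinorAct : Hyp R H →ₗ[R] Module.End R (ExteriorAlgebra R H) :=
  (LinearMap.mul R (ExteriorAlgebra R H)).comp
      ((ExteriorAlgebra.ι R).comp (LinearMap.snd R (Module.Dual R H) H)) +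
    (CliffordAlgebra.contractLeft (Q := (0 : QuadraticForm R H))).comp
      (LinearMap.fst R (Module.Dual R H) H)

variable {R H}

theorem spinorAct_apply (x : Hyp R H) (s : ExteriorAlgebra R H) :
    spinorAct R H x s = ExteriorAlgebra.ι R x.2 * s +
      CliffordAlgebra.contractLeft (Q := (0 : QuadraticForm R H)) x.1 s := rfl

theorem spinorAct_sq (x : Hyp R H) :
    spinorAct R H x * spinorAct R H x =
      algebraMap R (Module.End R (ExteriorAlgebra R H)) (QuadraticForm.dualProd R H x) := by
  refine LinearMap.ext fun s => ?_
  have h1 : ExteriorAlgebra.ι R x.2 * (ExteriorAlgebra.ι R x.2 * s) = 0 := by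
    rw [← mul_assoc, ExteriorAlgebra.ι_sq_zero, zero_mul]
  have h2 : CliffordAlgebra.contractLeft (Q := (0 : QuadraticForm R H)) x.1
      (ExteriorAlgebra.ι R x.2 * s) = x.1 x.2 • s - ExteriorAlgebra.ι R x.2 *
        CliffordAlgebra.contractLeft (Q := (0 : QuadraticForm R H)) x.1 s :=
    CliffordAlgebra.contractLeft_ι_mul x.1 x.2 s
  rw [Module.End.mul_apply, spinorAct_apply, spinorAct_apply, mul_add, map_add, h1, h2,
    CliffordAlgebra.contractLeft_contractLeft, Module.algebraMap_end_apply,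
    QuadraticForm.dualProd_apply]
  abel

theorem contractLeft_mem (d : Module.Dual R H) (i : ZMod 2) (s : ExteriorAlgebra R H)
    (hs : s ∈ CliffordAlgebra.evenOdd (0 : QuadraticForm R H) i) :
    CliffordAlgebra.contractLeft (Q := (0 : QuadraticForm R H)) d s ∈
      CliffordAlgebra.evenOdd (0 : QuadraticForm R H) (i + 1) := by
  have hodd : ∀ (m : H) (j : ZMod 2) (y : ExteriorAlgebra R H),
      y ∈ CliffordAlgebra.evenOdd (0 : QuadraticForm R H) j →
      CliffordAlgebra.ι (0 : QuadraticForm R H) m * y ∈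
        CliffordAlgebra.evenOdd (0 : QuadraticForm R H) (j + 1) := fun m j y hy => by
    rw [add_comm]
    exact CliffordAlgebra.evenOdd_mul_le _ 1 j
      (Submodule.mul_mem_mul (CliffordAlgebra.ι_mem_evenOdd_one _ m) hy)
  refine CliffordAlgebra.evenOdd_induction (0 : QuadraticForm R H) i
    (motive := fun s _ => CliffordAlgebra.contractLeft (Q := (0 : QuadraticForm R H)) d s ∈
      CliffordAlgebra.evenOdd (0 : QuadraticForm R H) (i + 1)) ?_ ?_ ?_ s hs
  · intro s h
    have hi : i = 0 ∨ i = 1 := by clear h hs; revert i; decide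
    rcases hi with rfl | rfl
    · obtain ⟨r, rfl⟩ := Submodule.mem_one.mp h
      rw [CliffordAlgebra.contractLeft_algebraMap]
      exact Submodule.zero_mem _
    · have h' : s ∈ LinearMap.range (CliffordAlgebra.ι (0 : QuadraticForm R H)) := by
        rw [← pow_one (LinearMap.range (CliffordAlgebra.ι (0 : QuadraticForm R H)))]
        exact h
      obtain ⟨m, rfl⟩ := h'
      rw [CliffordAlgebra.contractLeft_ι]
      exact CliffordAlgebra.one_le_evenOdd_zero _ (Submodule.algebraMap_mem _)
  · intro x y hx hy ihx ihy
    rw [map_add]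
    exact Submodule.add_mem _ ihx ihy
  · intro m₁ m₂ x hx ih
    have hij : i + 1 + 1 = i := by clear hx ih hs; revert i; decide
    rw [mul_assoc, CliffordAlgebra.contractLeft_ι_mul, CliffordAlgebra.contractLeft_ι_mul]
    refine Submodule.sub_mem _ (Submodule.smul_mem _ _ (hodd _ _ _ hx)) (hodd _ _ _ ?_)
    refine Submodule.sub_mem _ (Submodule.smul_mem _ _ hx) ?_
    have h2 := hodd m₂ _ _ ih
    rwa [hij] at h2

theorem spinorAct_mem_even (x : Hyp R H) (s : ExteriorAlgebra R H) (hs : s ∈ VOdd R H) :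
    spinorAct R H x s ∈ VEven R H := by
  rw [spinorAct_apply]
  refine Submodule.add_mem _ ?_ (contractLeft_mem x.1 1 s hs)
  exact CliffordAlgebra.evenOdd_mul_le (0 : QuadraticForm R H) 1 1
    (Submodule.mul_mem_mul (CliffordAlgebra.ι_mem_evenOdd_one _ x.2) hs)

/-- For a spinor `a ∈ ⋀^odd H`, the map `H ⊕ H^* → ⋀^even H`, `x ↦ x · a`. -/
def actOn (a : VOdd R H) : Hyp R H →ₗ[R] VEven R H :=
  LinearMap.codRestrict (VEven R H) ((spinorAct R H).flip (a : ExteriorAlgebra R H))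
    fun x => spinorAct_mem_even x a a.2

variable (R H) in
/-- The spin representation of the Clifford algebra of `H ⊕ H^*` on `⋀ H`. -/
def cliffordAct : CliffordAlgebra (QuadraticForm.dualProd R H) →ₐ[R]
    Module.End R (ExteriorAlgebra R H) :=
  CliffordAlgebra.lift (QuadraticForm.dualProd R H) ⟨spinorAct R H, spinorAct_sq⟩

/-- The coefficient of `e₁ ∧ ⋯ ∧ eₙ` of an element of `⋀ H`. -/
def topCoeff {n : ℕ} (e : Module.Basis (Fin n) R H) : ExteriorAlgebra R H →ₗ[R] R :=
  ExteriorAlgebra.liftAlternating (Pi.single n e.det)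

/-- The invariant bilinear form on spinors: `β(s, t)` is the top coefficient of `sᵗ ∧ t`, where
`sᵗ` is the reversal `(e₁ ∧ ⋯ ∧ eⱼ)ᵗ = eⱼ ∧ ⋯ ∧ e₁`.  One has `β(x · s, t) = β(s, x · t)` for
all `x ∈ H ⊕ H^*`. -/
def spinorForm {n : ℕ} (e : Module.Basis (Fin n) R H) :
    ExteriorAlgebra R H →ₗ[R] ExteriorAlgebra R H →ₗ[R] R :=
  ((LinearMap.mul R (ExteriorAlgebra R H)).compr₂ (topCoeff e)).comp
    (CliffordAlgebra.reverse (Q := (0 : QuadraticForm R H)))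

/-- The identification of `⋀ⁿ (H ⊕ H^*)` with its dual that is induced by the pairing of
`H ⊕ H^*`:  `⟨x₁ ∧ ⋯ ∧ xₙ, v₁ ∧ ⋯ ∧ vₙ⟩ = det ⟨xᵢ, vⱼ⟩`. -/
def wedgePairing (R H : Type*) [CommRing R] [AddCommGroup H] [Module R H] (n : ℕ) :
    ⋀[R]^n (Hyp R H) →ₗ[R] Module.Dual R (⋀[R]^n (Hyp R H)) :=
  (exteriorPower.pairingDual R (Hyp R H) n).comp (exteriorPower.map n (LinearMap.dualProd R H))

/-- The equivariant symmetric map `S₂(⋀^odd H) → ⋀ⁿ (H ⊕ H^*)`, whose value at `s · t` is here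
given as a functional on `⋀ⁿ (H ⊕ H^*)` (see `wedgePairing`):
`v₁ ∧ ⋯ ∧ vₙ ↦ β(s, [v₁ ⋯ vₙ] t)`, where `[v₁ ⋯ vₙ]` is the antisymmetrized Clifford product,
acting on `⋀ H` by the spin representation. -/
def spinorP [Invertible (2 : R)] {n : ℕ} (e : Module.Basis (Fin n) R H)
    (s t : ExteriorAlgebra R H) : Module.Dual R (⋀[R]^n (Hyp R H)) :=
  (spinorForm e s).comp <|
    ((cliffordAct R H).toLinearMap.flip t).comp <|
      (CliffordAlgebra.equivExterior (QuadraticForm.dualProd R H)).symm.toLinearMap.comp <|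
        (⋀[R]^n (Hyp R H)).subtype

end Hyperbolic

/-- Two maximal isotropic subspaces of a split quadratic space of dimension `2n` over a field lie
in different components of the variety of maximal isotropic subspaces: the dimension of their
intersection does not have the parity of `n`. -/
def OppositeComponents {K V : Type*} [Field K] [AddCommGroup V] [Module K V] (n : ℕ)
    (L L' : Submodule K V) : Prop :=
  ¬ Module.finrank K (L ⊓ L' : Submodule K V) ≡ n [MOD 2]

section Resolution

variable {R B₀ B₁ H : Type*} [CommRing R]
  [AddCommGroup B₀] [Module R B₀] [AddCommGroup B₁] [Module R B₁]
  [AddCommGroup H] [Module R H] [Module.Free R H] [Module.Finite R H]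

/-- `δ₄ = δ₁^* : B₀^* → B₁^*`. -/
def delta4 (δ₁ : B₁ →ₗ[R] B₀) : Module.Dual R B₀ →ₗ[R] Module.Dual R B₁ := δ₁.dualMap

/-- `δ₃ = δ₂^* : B₁^* → (H ⊕ H^*)^* ≅ H ⊕ H^*`, so that `⟨δ₃ φ, x⟩ = φ (δ₂ x)`. -/
def delta3 (δ₂ : Hyp R H →ₗ[R] B₁) : Module.Dual R B₁ →ₗ[R] Hyp R H :=
  (δ₂.comp (LinearMap.inr R (Module.Dual R H) H)).dualMap.prod
    ((Module.evalEquiv R H).symm.toLinearMap.comp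
      (δ₂.comp (LinearMap.inl R (Module.Dual R H) H)).dualMap)

/-- The sequence `0 → B₀^* → B₁^* → H ⊕ H^* → B₁ → B₀` with the maps `δ₄ = δ₁^*`, `δ₃ = δ₂^*`,
`δ₂`, `δ₁` is a resolution (of the cokernel of `δ₁`). -/
structure IsSelfDualResolution (δ₁ : B₁ →ₗ[R] B₀) (δ₂ : Hyp R H →ₗ[R] B₁) : Prop where
  injective : Function.Injective (delta4 δ₁)
  exact₃ : Function.Exact (delta4 δ₁) (delta3 δ₂)
  exact₂ : Function.Exact (delta3 δ₂) δ₂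
  exact₁ : Function.Exact δ₂ δ₁

/-- Over the fraction field `K`, the isotropic subspaces `im δ₃` and `H^*` of `H ⊕ H^*` lie in
different components; here `n = rank H`. -/
def DualInOtherComponent (n : ℕ) (δ₂ : Hyp R H →ₗ[R] B₁) [IsDomain R] : Prop :=
  OppositeComponents n
    (LinearMap.range ((delta3 δ₂).baseChange (FractionRing R)))
    (LinearMap.range ((LinearMap.inl R (Module.Dual R H) H).baseChange (FractionRing R)))

/-- `a₃ ∈ ⋀ⁿ (H ⊕ H^*)` is the third Buchsbaum–Eisenbud multiplier of the resolution, for some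
choice of bases of `B₀^*` and `B₁^*` (two choices change `a₃` by a unit only).  With
`a₄ = δ₄ b₁ ∧ ⋯ ∧ δ₄ bᵣ` for a basis `b` of `B₀^*`, the map `⋀ⁿ δ₃` is the composite of
`ξ ↦ ξ ∧ a₄ ∈ ⋀ⁿ⁺ʳ B₁^* ≅ R` and of `1 ↦ a₃`. -/
def IsMultiplier (n r : ℕ) (δ₁ : B₁ →ₗ[R] B₀) (δ₂ : Hyp R H →ₗ[R] B₁)
    (a₃ : ⋀[R]^n (Hyp R H)) : Prop :=
  ∃ (b : Module.Basis (Fin r) R (Module.Dual R B₀))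
    (c : Module.Basis (Fin n ⊕ Fin r) R (Module.Dual R B₁)),
    ∀ v : Fin n → Module.Dual R B₁,
      exteriorPower.ιMulti R n (fun i => delta3 δ₂ (v i)) =
        c.det (Sum.elim v fun j => delta4 δ₁ (b j)) • a₃

/-- `a ∈ ⋀^odd H` gives spinor coordinates of the resolution: up to a unit, the map
`S₂(⋀^odd H) → ⋀ⁿ (H ⊕ H^*)` sends `a²` to the Buchsbaum–Eisenbud multiplier `a₃`. -/
def IsSpinorCoordinates [Invertible (2 : R)] (n r : ℕ) (δ₁ : B₁ →ₗ[R] B₀)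
    (δ₂ : Hyp R H →ₗ[R] B₁) (a : VOdd R H) : Prop :=
  ∃ (e : Module.Basis (Fin n) R H) (a₃ : ⋀[R]^n (Hyp R H)) (ε : Rˣ),
    IsMultiplier n r δ₁ δ₂ a₃ ∧
    spinorP e (a : ExteriorAlgebra R H) a = (ε : R) • wedgePairing R H n a₃

/-- `w : (⋀^even H)^* → B₁^*` lifts along `δ₃` the dual `(⋀^even H)^* → (H ⊕ H^*)^* ≅ H ⊕ H^*` of
`x ↦ x · a`. -/
def IsSpinorLift (δ₂ : Hyp R H →ₗ[R] B₁) (a : VOdd R H)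
    (w : Module.Dual R (VEven R H) →ₗ[R] Module.Dual R B₁) : Prop :=
  LinearMap.comp (LinearMap.dualProd R H) ((delta3 δ₂).comp w) = (actOn a).dualMap

/-- `d₁ : H^* → R`, the restriction of `a^* : (⋀^odd H)^* → R` to `H^*`, where
`H^* ⊆ (⋀^odd H)^*` through the projection of `⋀^odd H` to its component `H`. -/
def d₁ (a : VOdd R H) : Module.Dual R H →ₗ[R] R :=
  (Module.Dual.eval R (VOdd R H) a).comp
    ((ExteriorAlgebra.ιInv (R := R) (M := H)).comp (VOdd R H).subtype).dualMap

/-- `d₂ : B₁^* → H^*`, the dual of the restriction of `δ₂` to `H`. -/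
def d₂ (δ₂ : Hyp R H →ₗ[R] B₁) : Module.Dual R B₁ →ₗ[R] Module.Dual R H :=
  (δ₂.comp (LinearMap.inr R (Module.Dual R H) H)).dualMap

/-- The generator of `R = ⋀⁰ H^* ⊆ (⋀^even H)^*`, i.e. the projection of `⋀^even H` to `⋀⁰ H = R`. -/
def scalarFunctional (R H : Type*) [CommRing R] [AddCommGroup H] [Module R H] :
    Module.Dual R (VEven R H) :=
  (ExteriorAlgebra.algebraMapInv (R := R) (M := H)).toLinearMap.comp (VEven R H).subtype

/-- `d₃ = [δ₄, w|_R] : B₀^* ⊕ R → B₁^*`. -/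
def d₃ (δ₁ : B₁ →ₗ[R] B₀) (w : Module.Dual R (VEven R H) →ₗ[R] Module.Dual R B₁) :
    Module.Dual R B₀ × R →ₗ[R] Module.Dual R B₁ :=
  (delta4 δ₁).coprod (w.comp (LinearMap.toSpanSingleton R _ (scalarFunctional R H)))

/-- The ideal `I` generated by the entries of `d₁`, i.e. the image of `d₁ : H^* → R`. -/
def idealI (a : VOdd R H) : Ideal R := LinearMap.range (d₁ a)

end Resolution

end SpinorRes

end

/-! Write L for the image of δ₃. As ⟨δ₃φ, x⟩ = φ(δ₂x), exactness of 𝔹 makes L its own orthogonal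
complement, so L is isotropic, saturated and of rank n. Choose l₁, …, lₘ in L whose H-components
form a maximal independent family in the projection of L to H. The spinor l₁⋯lₘ·1 is nonzero and
killed by L. Since m = n − rank(L ∩ H^*), the component hypothesis says that it is odd. Removing
common factors gives a primitive pure spinor s (`exists_pure_spinor`).

Existence: P(s²) and the multiplier a₃, seen as alternating n-forms, both vanish as soon as one
argument lies in L, so they are proportional. For every prime π there is a family v, in duality with
vectors of L up to a factor prime to π (`IsSelfDualResolution.exists_frame`), on which neither form
is divisible by π. Both are therefore primitive and differ by a unit (`exists_spinorP_eq_smul`).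

Arbitrary coordinates a: over the fraction field, a is a combination of the spinors v_S·s with |S|
even. Evaluating P(a²) on v gives c_∅ ≠ 0. On vectors of which one lies in L it must vanish, and for
a minimal nonempty J with c_J ≠ 0 a suitable choice of them would give a nonzero multiple of c_∅c_J.
So L kills a (`IsSpinorCoordinates.pure`).

The complex: let a₁ be the component of a in H. Because L kills a, the dual of x ↦ x·a takes values
in L^⊥ = L, so it lifts to w, and δ₃ sends w(1) to (0, a₁). For (f, m) in L, the degree 0 part of
(f, m)·a = 0 says f(a₁) = 0, and the degree 2 part expresses m ∧ a₁ through a contraction with f.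
Grade at least 3 gives Hom(R/I, R/r) = 0 and Ext¹(R/I, R/r) = 0 for r ≠ 0. The first makes m a
multiple of a₁ when f = 0 (`exact_d₃_d₂`). The second makes m a multiple of a₁ modulo r when f is
divisible by r, and saturation of L then allows division by r (`exact_d₂_d₁`). If also Ext³(R/I, R)
= 0, the resolution forces I to be a direct summand of R, hence I = R (`eq_top_of_pi_resolution`).
-/

open scoped TensorProduct

noncomputable section

namespace SpinorRes


/-! ### Clifford relations on spinors and invariance of the form β. -/

section SpinorAlgebra

variable {R H : Type*} [CommRing R] [AddCommGroup H] [Module R H]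

/-- The contraction of the exterior algebra with a functional. -/
abbrev contr (d : Module.Dual R H) : ExteriorAlgebra R H →ₗ[R] ExteriorAlgebra R H :=
  CliffordAlgebra.contractLeft (Q := (0 : QuadraticForm R H)) d

theorem contr_ι_mul (d : Module.Dual R H) (m : H) (s : ExteriorAlgebra R H) :
    contr d (ExteriorAlgebra.ι R m * s) = d m • s - ExteriorAlgebra.ι R m * contr d s :=
  CliffordAlgebra.contractLeft_ι_mul d m s

theorem contr_one (d : Module.Dual R H) : contr d 1 = 0 :=
  CliffordAlgebra.contractLeft_one (Q := (0 : QuadraticForm R H)) d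

theorem dualProd_apply' (x y : Hyp R H) :
    LinearMap.dualProd R H x y = x.1 y.2 + y.1 x.2 := by
  simp [LinearMap.dualProd, add_comm]

theorem dualProd_comm (x y : Hyp R H) :
    LinearMap.dualProd R H x y = LinearMap.dualProd R H y x := by
  rw [dualProd_apply', dualProd_apply', add_comm]

theorem dualProd_self (x : Hyp R H) :
    LinearMap.dualProd R H x x = 2 * QuadraticForm.dualProd R H x := by
  rw [dualProd_apply', QuadraticForm.dualProd_apply, two_mul]

theorem spinorAct_spinorAct_self (x : Hyp R H) (s : ExteriorAlgebra R H) :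
    spinorAct R H x (spinorAct R H x s) = QuadraticForm.dualProd R H x • s := by
  rw [← Module.End.mul_apply, spinorAct_sq, Module.algebraMap_end_apply]

theorem spinorAct_anticomm (x y : Hyp R H) (s : ExteriorAlgebra R H) :
    spinorAct R H x (spinorAct R H y s) + spinorAct R H y (spinorAct R H x s) =
      LinearMap.dualProd R H x y • s := by
  have h := spinorAct_spinorAct_self (x + y) s
  have hq : QuadraticForm.dualProd R H (x + y) = QuadraticForm.dualProd R H x +
      QuadraticForm.dualProd R H y + LinearMap.dualProd R H x y := by
    simp only [QuadraticForm.dualProd_apply, dualProd_apply', Prod.fst_add, Prod.snd_add,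
      LinearMap.add_apply, map_add]
    ring
  rw [hq, add_smul, add_smul, ← spinorAct_spinorAct_self, ← spinorAct_spinorAct_self] at h
  simp only [map_add, LinearMap.add_apply] at h
  rw [← sub_eq_zero] at h ⊢
  rw [← h]
  abel

theorem spinorAct_swap (x y : Hyp R H) (s : ExteriorAlgebra R H) :
    spinorAct R H x (spinorAct R H y s) =
      LinearMap.dualProd R H x y • s - spinorAct R H y (spinorAct R H x s) :=
  eq_sub_of_add_eq (spinorAct_anticomm x y s)

theorem spinorAct_inl (d : Module.Dual R H) (s : ExteriorAlgebra R H) :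
    spinorAct R H (d, 0) s = contr d s := by
  rw [spinorAct_apply, map_zero, zero_mul, zero_add]

theorem spinorAct_inr (h : H) (s : ExteriorAlgebra R H) :
    spinorAct R H (0, h) s = ExteriorAlgebra.ι R h * s := by
  rw [spinorAct_apply, map_zero, LinearMap.zero_apply, add_zero]

theorem quadraticForm_eq_zero_of_dualProd [Invertible (2 : R)] {x : Hyp R H}
    (h : LinearMap.dualProd R H x x = 0) : QuadraticForm.dualProd R H x = 0 := by
  rw [dualProd_self] at h
  exact (isUnit_of_invertible (2 : R)).mul_right_eq_zero.mp h

theorem spinorAct_spinorAct_of_isotropic [Invertible (2 : R)] {x : Hyp R H}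
    (h : LinearMap.dualProd R H x x = 0) (s : ExteriorAlgebra R H) :
    spinorAct R H x (spinorAct R H x s) = 0 := by
  rw [spinorAct_spinorAct_self, quadraticForm_eq_zero_of_dualProd h, zero_smul]

theorem contractLeft_ιMulti_mem (d : Module.Dual R H) :
    ∀ (k : ℕ) (v : Fin (k + 1) → H),
      contr d (ExteriorAlgebra.ιMulti R (k + 1) v) ∈ ⋀[R]^k H
  | 0, v => by
    rw [ExteriorAlgebra.ιMulti_succ_apply, ExteriorAlgebra.ιMulti_zero_apply, mul_one]
    have h := CliffordAlgebra.contractLeft_ι (Q := (0 : QuadraticForm R H)) d (v 0)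
    have h' : contr d (ExteriorAlgebra.ι R (v 0)) = algebraMap R _ (d (v 0)) := h
    rw [h', ExteriorAlgebra.exteriorPower, pow_zero]
    exact Submodule.algebraMap_mem _
  | k + 1, v => by
    rw [ExteriorAlgebra.ιMulti_succ_apply]
    have h : contr d (ExteriorAlgebra.ι R (v 0) *
        ExteriorAlgebra.ιMulti R (k + 1) (Matrix.vecTail v)) = _ :=
      CliffordAlgebra.contractLeft_ι_mul d (v 0) _
    rw [h]
    refine Submodule.sub_mem _ (Submodule.smul_mem _ _ ?_) ?_
    · exact (exteriorPower.ιMulti R (k + 1) (Matrix.vecTail v)).2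
    · rw [ExteriorAlgebra.exteriorPower, pow_succ']
      exact Submodule.mul_mem_mul ⟨v 0, rfl⟩ (contractLeft_ιMulti_mem d k _)

theorem topCoeff_ιMulti {n k : ℕ} (e : Module.Basis (Fin n) R H) (hk : k ≠ n) (v : Fin k → H) :
    topCoeff e (ExteriorAlgebra.ιMulti R k v) = 0 := by
  rw [topCoeff, ExteriorAlgebra.liftAlternating_apply_ιMulti, Pi.single_eq_of_ne hk]
  rfl

theorem topCoeff_ιMulti_self {n : ℕ} (e : Module.Basis (Fin n) R H) (v : Fin n → H) :
    topCoeff e (ExteriorAlgebra.ιMulti R n v) = e.det v := by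
  rw [topCoeff, ExteriorAlgebra.liftAlternating_apply_ιMulti, Pi.single_eq_same]

theorem topCoeff_of_mem {n k : ℕ} (e : Module.Basis (Fin n) R H) (hk : k ≠ n)
    {s : ExteriorAlgebra R H} (hs : s ∈ ⋀[R]^k H) : topCoeff e s = 0 := by
  rw [← ExteriorAlgebra.ιMulti_span_fixedDegree] at hs
  have : Submodule.span R (Set.range (ExteriorAlgebra.ιMulti R (M := H) k)) ≤
      LinearMap.ker (topCoeff e) := by
    rw [Submodule.span_le]
    rintro _ ⟨v, rfl⟩
    exact topCoeff_ιMulti e hk v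
  exact this hs

/-- Contraction lowers the degree by one, and the exterior algebra has nothing above degree n. -/
theorem topCoeff_contractLeft {n : ℕ} (e : Module.Basis (Fin n) R H) (d : Module.Dual R H)
    (s : ExteriorAlgebra R H) : topCoeff e (contr d s) = 0 := by
  have : (topCoeff e).comp (CliffordAlgebra.contractLeft (Q := (0 : QuadraticForm R H)) d) = 0 := by
    refine Module.Basis.ext e.ExteriorAlgebra fun S => ?_
    rw [LinearMap.comp_apply, LinearMap.zero_apply, ExteriorAlgebra.basis_apply]
    have key : ∀ k ≤ n, ∀ v : Fin k → H, topCoeff e (contr d (ExteriorAlgebra.ιMulti R k v)) = 0 := by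
      intro k hk v
      cases k with
      | zero => rw [ExteriorAlgebra.ιMulti_zero_apply, contr_one, map_zero]
      | succ k => exact topCoeff_of_mem e (by omega) (contractLeft_ιMulti_mem d k _)
    exact key _ (by simpa using S.card_le_univ) _
  exact LinearMap.congr_fun this s

/-- Integration by parts: a contraction has no top coefficient, so it can be moved from one factor
of a product to the other. -/
theorem topCoeff_contractRight_mul {n : ℕ} (e : Module.Basis (Fin n) R H) (d : Module.Dual R H)
    (u : ExteriorAlgebra R H) : ∀ t : ExteriorAlgebra R H,
    topCoeff e (CliffordAlgebra.contractRight (Q := (0 : QuadraticForm R H)) u d * t) =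
      topCoeff e (u * contr d t) := by
  refine CliffordAlgebra.right_induction (0 : QuadraticForm R H)
    (P := fun u => ∀ t : ExteriorAlgebra R H,
      topCoeff e (CliffordAlgebra.contractRight (Q := (0 : QuadraticForm R H)) u d * t) =
      topCoeff e (u * contr d t)) ?_ ?_ ?_ u
  · intro r t
    rw [CliffordAlgebra.contractRight_algebraMap, zero_mul, map_zero, ← Algebra.smul_def, map_smul,
      topCoeff_contractLeft, smul_zero]
  · intro x y hx hy t
    simp only [map_add, LinearMap.add_apply, add_mul, hx, hy]
  · intro m x hx t
    have h1 : contr d (CliffordAlgebra.ι (0 : QuadraticForm R H) m * t) = _ :=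
      CliffordAlgebra.contractLeft_ι_mul d m t
    have h2 := hx (CliffordAlgebra.ι (0 : QuadraticForm R H) m * t)
    rw [h1, mul_sub, map_sub, mul_smul_comm, map_smul] at h2
    rw [CliffordAlgebra.contractRight_mul_ι, sub_mul, map_sub, smul_mul_assoc, map_smul, mul_assoc,
      mul_assoc, h2]
    abel

theorem spinorForm_apply {n : ℕ} (e : Module.Basis (Fin n) R H) (s t : ExteriorAlgebra R H) :
    spinorForm e s t = topCoeff e (CliffordAlgebra.reverse (Q := (0 : QuadraticForm R H)) s * t) :=
  rfl

/-- Vectors are self-adjoint for β: reversal fixes elements of H and exchanges left with right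
contraction. -/
theorem spinorForm_spinorAct {n : ℕ} (e : Module.Basis (Fin n) R H) (x : Hyp R H)
    (s t : ExteriorAlgebra R H) :
    spinorForm e (spinorAct R H x s) t = spinorForm e s (spinorAct R H x t) := by
  rw [spinorForm_apply, spinorForm_apply, spinorAct_apply, spinorAct_apply, map_add, add_mul,
    map_add, mul_add, map_add]
  congr 1
  · have : CliffordAlgebra.reverse (Q := (0 : QuadraticForm R H)) (ExteriorAlgebra.ι R x.2 * s) =
      CliffordAlgebra.reverse s * ExteriorAlgebra.ι R x.2 := by
      rw [CliffordAlgebra.reverse.map_mul]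
      congr 1
      exact CliffordAlgebra.reverse_ι x.2
    rw [this, mul_assoc]
  · rw [← topCoeff_contractRight_mul, CliffordAlgebra.contractRight_eq,
      CliffordAlgebra.reverse_reverse]

end SpinorAlgebra

/-! ### Products of lists of vectors, the top form, and frames. -/

section Frames

variable {R H : Type*} [CommRing R] [AddCommGroup H] [Module R H] {n : ℕ}

/-- The exterior product of the members of a list of vectors. -/
def wedgeList (l : List H) : ExteriorAlgebra R H := (l.map (ExteriorAlgebra.ι R)).prod

@[simp]
theorem wedgeList_nil : wedgeList (R := R) ([] : List H) = 1 := rfl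

@[simp]
theorem wedgeList_cons (m : H) (l : List H) :
    wedgeList (R := R) (m :: l) = ExteriorAlgebra.ι R m * wedgeList l := by
  rw [wedgeList, wedgeList, List.map_cons, List.prod_cons]

theorem contr_wedgeList_mul_of_forall {d : Module.Dual R H} {s : ExteriorAlgebra R H}
    (hs : contr d s = 0) :
    ∀ l : List H, (∀ m ∈ l, d m = 0) → contr d (wedgeList (R := R) l * s) = 0
  | [], _ => by simpa using hs
  | m :: l, h => by
    rw [wedgeList_cons, mul_assoc, contr_ι_mul, h m (by simp), zero_smul,
      contr_wedgeList_mul_of_forall hs l fun m' hm' => h m' (by simp [hm']), mul_zero, sub_zero]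

/-- Contracting successively with the coordinates of a basis recovers `w` from `e₁ ∧ ⋯ ∧ eₖ ∧ w`
if `w` is annihilated by the contractions. -/
theorem exists_contr_wedgeList {ι : Type*} (e : Module.Basis ι R H) (l : List ι) (hl : l.Nodup) :
    ∃ C : Module.End R (ExteriorAlgebra R H),
      (∀ N : Submodule R (ExteriorAlgebra R H),
        (∀ i, ∀ s ∈ N, contr (e.coord i) s ∈ N) → ∀ s ∈ N, C s ∈ N) ∧
      ∀ w : ExteriorAlgebra R H, (∀ i, contr (e.coord i) w = 0) →
        C (wedgeList (R := R) (l.map e) * w) = w := by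
  classical
  induction l with
  | nil => exact ⟨1, fun N _ s hs => hs, fun w _ => by simp⟩
  | cons i l ih =>
    obtain ⟨hi, hl⟩ := List.nodup_cons.mp hl
    obtain ⟨C, hC, hw⟩ := ih hl
    refine ⟨C * contr (e.coord i), fun N hN s hs => hC N hN _ (hN i s hs), fun w hw' => ?_⟩
    have h0 : contr (e.coord i) (wedgeList (R := R) (l.map e) * w) = 0 := by
      refine contr_wedgeList_mul_of_forall (hw' i) _ fun m hm => ?_
      obtain ⟨j, hj, rfl⟩ := List.mem_map.mp hm
      have : j ≠ i := fun h => hi (h ▸ hj)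
      simp [Finsupp.single_eq_of_ne this.symm]
    rw [Module.End.mul_apply, List.map_cons, wedgeList_cons, mul_assoc, contr_ι_mul, h0, mul_zero, sub_zero]
    simpa using hw w hw'

theorem ι_mul_wedgeList_of_mem {m : H} :
    ∀ {l : List H}, m ∈ l → ExteriorAlgebra.ι R m * wedgeList (R := R) l = 0
  | m' :: l, h => by
    rw [wedgeList_cons, ← mul_assoc]
    rcases List.mem_cons.mp h with rfl | h
    · rw [ExteriorAlgebra.ι_sq_zero, zero_mul]
    · rw [eq_neg_of_add_eq_zero_left (ExteriorAlgebra.ι_add_mul_swap m m'), neg_mul, mul_assoc,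
        ι_mul_wedgeList_of_mem h, mul_zero, neg_zero]

theorem wedgeList_mul_ι_of_mem {m : H} :
    ∀ {l : List H}, m ∈ l → wedgeList (R := R) l * ExteriorAlgebra.ι R m = 0
  | m' :: l, h => by
    rw [wedgeList_cons, mul_assoc]
    rcases List.mem_cons.mp h with rfl | h
    · have : ∀ l : List H, ExteriorAlgebra.ι R m * (wedgeList (R := R) l * ExteriorAlgebra.ι R m) = 0
      · intro l
        induction l with
        | nil => simp
        | cons a l ih =>
          rw [wedgeList_cons, mul_assoc, ← mul_assoc,
            eq_neg_of_add_eq_zero_left (ExteriorAlgebra.ι_add_mul_swap m a), neg_mul, mul_assoc,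
            ih, mul_zero, neg_zero]
      exact this l
    · rw [wedgeList_mul_ι_of_mem h, mul_zero]

/-- The product of all vectors of a basis. -/
abbrev wedgeTop (e : Module.Basis (Fin n) R H) : ExteriorAlgebra R H :=
  wedgeList (R := R) ((List.finRange n).map e)

theorem wedgeTop_eq (e : Module.Basis (Fin n) R H) :
    wedgeTop e = ExteriorAlgebra.ιMulti R n e := by
  rw [ExteriorAlgebra.ιMulti_apply, wedgeTop, wedgeList, List.map_map, List.ofFn_eq_map]
  rfl

theorem topCoeff_wedgeTop (e : Module.Basis (Fin n) R H) : topCoeff e (wedgeTop e) = 1 := by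
  rw [wedgeTop_eq, topCoeff_ιMulti_self, e.det_self]

theorem ι_mul_wedgeTop (e : Module.Basis (Fin n) R H) (m : H) :
    ExteriorAlgebra.ι R m * wedgeTop e = 0 := by
  rw [← e.sum_repr m, map_sum, Finset.sum_mul]
  refine Finset.sum_eq_zero fun i _ => ?_
  rw [map_smul, smul_mul_assoc, ι_mul_wedgeList_of_mem (by simp), smul_zero]

theorem wedgeTop_mul_ι (e : Module.Basis (Fin n) R H) (m : H) :
    wedgeTop e * ExteriorAlgebra.ι R m = 0 := by
  rw [← e.sum_repr m, map_sum, Finset.mul_sum]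
  refine Finset.sum_eq_zero fun i _ => ?_
  rw [map_smul, mul_smul_comm, wedgeList_mul_ι_of_mem (by simp), smul_zero]

theorem algebraMapInv_ι_mul (m : H) (s : ExteriorAlgebra R H) :
    ExteriorAlgebra.algebraMapInv (ExteriorAlgebra.ι R m * s) = 0 := by
  rw [map_mul, ExteriorAlgebra.algebraMapInv, ExteriorAlgebra.lift_ι_apply]
  simp

theorem mul_wedgeTop (e : Module.Basis (Fin n) R H) (s : ExteriorAlgebra R H) :
    s * wedgeTop e = ExteriorAlgebra.algebraMapInv s • wedgeTop e := by
  refine CliffordAlgebra.right_induction (0 : QuadraticForm R H)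
    (P := fun s : ExteriorAlgebra R H =>
      s * wedgeTop e = ExteriorAlgebra.algebraMapInv s • wedgeTop e) ?_ ?_ ?_ s
  · intro r
    have : ExteriorAlgebra.algebraMapInv (algebraMap R (ExteriorAlgebra R H) r) = r :=
      ExteriorAlgebra.algebraMap_leftInverse H r
    exact (Algebra.smul_def r (wedgeTop e)).symm.trans (by rw [this])
  · intro x y hx hy
    rw [add_mul, hx, hy, map_add, add_smul]
  · intro m x hx
    have h1 : CliffordAlgebra.ι (0 : QuadraticForm R H) m * wedgeTop e = 0 := ι_mul_wedgeTop e m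
    have h2 : ExteriorAlgebra.algebraMapInv
        (R := R) (M := H) (CliffordAlgebra.ι (0 : QuadraticForm R H) m) = 0 := by
      have := algebraMapInv_ι_mul (R := R) m 1
      rwa [mul_one] at this
    rw [mul_assoc, h1, mul_zero, map_mul, h2, mul_zero, zero_smul]

theorem wedgeTop_mul (e : Module.Basis (Fin n) R H) (s : ExteriorAlgebra R H) :
    wedgeTop e * s = ExteriorAlgebra.algebraMapInv s • wedgeTop e := by
  refine CliffordAlgebra.left_induction (0 : QuadraticForm R H)
    (P := fun s : ExteriorAlgebra R H =>
      wedgeTop e * s = ExteriorAlgebra.algebraMapInv s • wedgeTop e) ?_ ?_ ?_ s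
  · intro r
    have : ExteriorAlgebra.algebraMapInv (algebraMap R (ExteriorAlgebra R H) r) = r :=
      ExteriorAlgebra.algebraMap_leftInverse H r
    exact ((Algebra.commutes r (wedgeTop e)).symm.trans
      (Algebra.smul_def r (wedgeTop e)).symm).trans (by rw [this])
  · intro x y hx hy
    rw [mul_add, hx, hy, map_add, add_smul]
  · intro x m hx
    have h1 : wedgeTop e * CliffordAlgebra.ι (0 : QuadraticForm R H) m = 0 := wedgeTop_mul_ι e m
    have h2 : ExteriorAlgebra.algebraMapInv
        (R := R) (M := H) (CliffordAlgebra.ι (0 : QuadraticForm R H) m * x) = 0 :=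
      algebraMapInv_ι_mul (R := R) m x
    rw [← mul_assoc, h1, zero_mul, h2, zero_smul]

/-- An element of the exterior algebra that is annihilated by all contractions is a scalar. -/
theorem eq_algebraMap_of_contr_eq_zero (e : Module.Basis (Fin n) R H) {w : ExteriorAlgebra R H}
    (hw : ∀ i, contr (e.coord i) w = 0) :
    w = ExteriorAlgebra.algebraMapInv w • (1 : ExteriorAlgebra R H) := by
  obtain ⟨C, -, hC⟩ := exists_contr_wedgeList (R := R) e (List.finRange n) (List.nodup_finRange n)
  -- The product with the top form sees only the scalar part of `w`, yet `C` recovers all of `w`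
  -- from it.
  have h1 := hC w hw
  have h2 := hC 1 fun i => contr_one _
  rw [mul_one] at h2
  rw [wedgeTop_mul e w, map_smul, h2] at h1
  exact h1.symm

/-- The operator that takes the top form to 1 is a product of contractions, so it preserves `N`. -/
theorem one_mem_of_wedgeTop_mem (e : Module.Basis (Fin n) R H)
    (N : Submodule R (ExteriorAlgebra R H)) (hN : ∀ i, ∀ s ∈ N, contr (e.coord i) s ∈ N)
    (h : wedgeTop e ∈ N) : (1 : ExteriorAlgebra R H) ∈ N := by
  obtain ⟨C, hC, hC'⟩ := exists_contr_wedgeList (R := R) e (List.finRange n) (List.nodup_finRange n)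
  have h2 := hC' 1 fun i => contr_one _
  rw [mul_one] at h2
  exact h2 ▸ hC N hN _ h

/-- Two families of vectors that span complementary isotropic submodules, in duality up to the
factor `y`. -/
structure IsFrame (l v : Fin n → Hyp R H) (y : R) : Prop where
  left (i j : Fin n) : LinearMap.dualProd R H (l i) (l j) = 0
  right (i j : Fin n) : LinearMap.dualProd R H (v i) (v j) = 0
  pair (i j : Fin n) : LinearMap.dualProd R H (l i) (v j) = if i = j then y else 0

theorem isFrame_basis (e : Module.Basis (Fin n) R H) :
    IsFrame (fun i => ((e.coord i, 0) : Hyp R H)) (fun i => (0, e i)) 1 where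
  left i j := by simp
  right i j := by simp
  pair i j := by
    simp only [dualProd_apply', LinearMap.zero_apply, add_zero, Module.Basis.coord_apply,
      Module.Basis.repr_self, Finsupp.single_apply, eq_comm]

/-- The relation y z = lᵢ(vᵢ z) + vᵢ(lᵢ z) writes y z through spinors killed by one more lᵢ. After n
steps only spinors killed by all lᵢ remain, and the vᵢ preserve `N`. -/
theorem IsFrame.induction [Invertible (2 : R)] {l v : Fin n → Hyp R H} {y : R}
    (hf : IsFrame l v y) (C N : Submodule R (ExteriorAlgebra R H))
    (hCl : ∀ i, ∀ s ∈ C, spinorAct R H (l i) s ∈ C) (hCv : ∀ i, ∀ s ∈ C, spinorAct R H (v i) s ∈ C)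
    (hN : ∀ i, ∀ s ∈ N, spinorAct R H (v i) s ∈ N)
    (h : ∀ z ∈ C, (∀ i, spinorAct R H (l i) z = 0) → z ∈ N) :
    ∀ z ∈ C, y ^ n • z ∈ N := by
  -- Only the last `k` of the `l i` may fail to kill `z`; each of them costs one factor `y`.
  have key : ∀ k ≤ n, ∀ z ∈ C, (∀ i : Fin n, i.val + k < n → spinorAct R H (l i) z = 0) →
      y ^ k • z ∈ N := by
    intro k
    induction k with
    | zero =>
      intro _ z hz hl
      rw [pow_zero, one_smul]
      exact h z hz fun i => hl i i.2
    | succ k ih =>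
      intro hk z hz hl
      have hsplit := spinorAct_anticomm (l ⟨n - k - 1, by omega⟩) (v ⟨n - k - 1, by omega⟩) z
      rw [hf.pair, if_pos rfl] at hsplit
      set i₀ : Fin n := ⟨n - k - 1, by omega⟩ with hi₀
      have hcases : ∀ i : Fin n, i.val + k < n → i = i₀ ∨ i.val + (k + 1) < n := by
        intro i hi
        by_cases hii : i = i₀
        · exact Or.inl hii
        · right
          have : i.val ≠ n - k - 1 := fun h => hii (Fin.ext h)
          omega
      rw [pow_succ, mul_smul, ← hsplit, smul_add]
      refine N.add_mem (ih (by omega) _ (hCl _ _ (hCv _ _ hz)) fun i hi => ?_) ?_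
      · rcases hcases i hi with rfl | hi'
        · exact spinorAct_spinorAct_of_isotropic (hf.left _ _) _
        · have : i ≠ i₀ := by
            rintro rfl
            simp only [hi₀] at hi'
            omega
          rw [spinorAct_swap, hf.left, zero_smul, spinorAct_swap (l i), hf.pair, if_neg this,
            zero_smul, hl i hi']
          simp
      · rw [← map_smul]
        refine hN _ _ (ih (by omega) _ (hCl _ _ hz) fun i hi => ?_)
        rcases hcases i hi with rfl | hi'
        · exact spinorAct_spinorAct_of_isotropic (hf.left _ _) _
        · rw [spinorAct_swap, hf.left, zero_smul, hl i hi']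
          simp
  intro z hz
  exact key n le_rfl z hz fun i hi => by omega

end Frames

/-! ### Primitive vectors and divisibility. -/

section LinearAlgebra

variable {R M : Type*} [CommRing R] [AddCommGroup M] [Module R M]

/-- A vector of a module is primitive if no prime of the ring divides it. -/
def IsPrimitive (s : M) : Prop := ∀ π : R, Prime π → ∀ s' : M, s ≠ π • s'

/-- The value π = 0 is allowed throughout: divisibility by 0 means vanishing, so a single argument
covers both the fraction field and reduction modulo a prime. -/
theorem dvd_or_dvd_of_zero_or_prime [IsDomain R] {π : R} (hπ : π = 0 ∨ Prime π) {a b : R}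
    (h : π ∣ a * b) : π ∣ a ∨ π ∣ b := by
  rcases hπ with rfl | hπ
  · simpa [zero_dvd_iff] using h
  · exact hπ.dvd_or_dvd h

theorem exists_eq_smul_of_dvd {ι : Type*} [Finite ι] (b : Module.Basis ι R M) {π : R} {z : M}
    (h : ∀ i, π ∣ b.repr z i) : ∃ z', z = π • z' := by
  cases nonempty_fintype ι
  choose c hc using h
  refine ⟨∑ i, c i • b i, ?_⟩
  rw [Finset.smul_sum, ← b.sum_repr z]
  exact Finset.sum_congr rfl fun i _ => by rw [smul_smul, ← hc]

theorem exists_eq_smul_of_smul_eq_smul [IsDomain R] [Module.Free R M] [Module.Finite R M] {π : R}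
    (hπ : π = 0 ∨ Prime π) {c : R} (hc : ¬ π ∣ c) {z z' : M} (h : c • z = π • z') :
    ∃ z'', z = π • z'' := by
  refine exists_eq_smul_of_dvd (Module.Free.chooseBasis R M) fun i => ?_
  have h1 := congrArg (fun m => (Module.Free.chooseBasis R M).repr m i) h
  simp only [map_smul, Finsupp.smul_apply, smul_eq_mul] at h1
  exact (dvd_or_dvd_of_zero_or_prime hπ ⟨_, h1⟩).resolve_left hc

/-- A prime factor of `r` cannot divide the primitive vector, so it divides `c` and cancels; this is
repeated over the factorization of `r`. -/
theorem IsPrimitive.exists_eq_smul [IsDomain R] [UniqueFactorizationMonoid R] [Module.Free R M]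
    [Module.Finite R M] {s : M} (hs : IsPrimitive (R := R) s) {r : R} (hr : r ≠ 0) :
    ∀ {c : R} {t : M}, r • t = c • s → ∃ c' : R, t = c' • s := by
  induction r using UniqueFactorizationMonoid.induction_on_prime with
  | h₁ => exact absurd rfl hr
  | h₂ u hu =>
    intro c t h
    obtain ⟨u, rfl⟩ := hu
    refine ⟨↑u⁻¹ * c, ?_⟩
    rw [mul_smul, ← h, smul_smul, Units.inv_mul, one_smul]
  | h₃ a π ha hπ ih =>
    intro c t h
    have hdvd : π ∣ c := by
      by_contra hc
      obtain ⟨s', hs'⟩ := exists_eq_smul_of_smul_eq_smul (Or.inr hπ) hc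
        (h.symm.trans (mul_smul _ _ _))
      exact hs π hπ s' hs'
    obtain ⟨c', rfl⟩ := hdvd
    refine ih ha (c := c') ?_
    rw [mul_smul, mul_smul] at h
    exact smul_right_injective M hπ.ne_zero h

/-- The quotient by `N` has rank zero, so it is torsion. -/
theorem exists_smul_mem_of_finrank_le [IsDomain R] [Module.Finite R M] (N : Submodule R M)
    (h : Module.finrank R M ≤ Module.finrank R N) (x : M) : ∃ r : R, r ≠ 0 ∧ r • x ∈ N := by
  have h1 := Submodule.finrank_quotient_add_finrank N
  have h2 : Module.finrank R (M ⧸ N) = 0 := by omega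
  obtain ⟨r, hr, hx⟩ := Module.finrank_eq_zero_iff.mp h2 (Submodule.Quotient.mk x)
  refine ⟨r, hr, ?_⟩
  rwa [← Submodule.Quotient.mk_smul, Submodule.Quotient.mk_eq_zero] at hx

end LinearAlgebra

/-! ### The Fock model of spinors attached to a frame. -/

section Fock

variable {R H : Type*} [CommRing R] [AddCommGroup H] [Module R H] {n : ℕ}

theorem dualProd_constr_constr (e : Module.Basis (Fin n) R H) {v : Fin n → Hyp R H}
    (hv : ∀ i j, LinearMap.dualProd R H (v i) (v j) = 0) (m : H) :
    LinearMap.dualProd R H (e.constr R v m) (e.constr R v m) = 0 := by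
  rw [e.constr_apply_fintype (S := R)]
  simp only [map_sum, LinearMap.sum_apply, map_smul, LinearMap.smul_apply, hv, smul_zero,
    Finset.sum_const_zero]

variable [Invertible (2 : R)]

/-- The action on spinors of the exterior algebra of an isotropic submodule with generators `v`. -/
def fock (e : Module.Basis (Fin n) R H) {v : Fin n → Hyp R H}
    (hv : ∀ i j, LinearMap.dualProd R H (v i) (v j) = 0) :
    ExteriorAlgebra R H →ₐ[R] Module.End R (ExteriorAlgebra R H) :=
  ExteriorAlgebra.lift R ⟨(spinorAct R H).comp (e.constr R v), fun m => by
    rw [LinearMap.comp_apply, spinorAct_sq,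
      quadraticForm_eq_zero_of_dualProd (dualProd_constr_constr e hv m), map_zero]⟩

variable {l v : Fin n → Hyp R H} {y : R}

theorem fock_ι (e : Module.Basis (Fin n) R H)
    (hv : ∀ i j, LinearMap.dualProd R H (v i) (v j) = 0) (m : H) :
    fock e hv (ExteriorAlgebra.ι R m) = spinorAct R H (e.constr R v m) := by
  rw [fock, ExteriorAlgebra.lift_ι_apply, LinearMap.comp_apply]

theorem fock_ι_basis (e : Module.Basis (Fin n) R H)
    (hv : ∀ i j, LinearMap.dualProd R H (v i) (v j) = 0) (i : Fin n) :
    fock e hv (ExteriorAlgebra.ι R (e i)) = spinorAct R H (v i) := by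
  rw [fock_ι, e.constr_basis]

/-- The vectors vᵢ act as creation operators on the vacuum s. As lᵢ kills s, only its
anticommutators with the vⱼ survive, and they amount to y times a contraction. -/
theorem spinorAct_fock (e : Module.Basis (Fin n) R H)
    (hf : IsFrame l v y) {s : ExteriorAlgebra R H} {i : Fin n}
    (hs : spinorAct R H (l i) s = 0) (x : ExteriorAlgebra R H) :
    spinorAct R H (l i) (fock e hf.right x s) = y • fock e hf.right (contr (e.coord i) x) s := by
  refine CliffordAlgebra.left_induction (0 : QuadraticForm R H)
    (P := fun x : ExteriorAlgebra R H => spinorAct R H (l i) (fock e hf.right x s) =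
      y • fock e hf.right (contr (e.coord i) x) s) ?_ ?_ ?_ x
  · intro r
    have h1 : contr (e.coord i) (algebraMap R (ExteriorAlgebra R H) r) = 0 :=
      CliffordAlgebra.contractLeft_algebraMap (Q := (0 : QuadraticForm R H)) _ r
    have h2 : fock e hf.right (algebraMap R (ExteriorAlgebra R H) r) s = r • s := by
      rw [AlgHom.commutes, Module.algebraMap_end_apply]
    refine (congrArg (spinorAct R H (l i)) h2).trans ?_
    rw [map_smul, hs, smul_zero]
    exact (by rw [h1, map_zero, LinearMap.zero_apply, smul_zero] :
      y • fock e hf.right (contr (e.coord i) (algebraMap R (ExteriorAlgebra R H) r)) s = 0).symm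
  · intro x x' hx hx'
    simp only [map_add, LinearMap.add_apply, hx, hx', smul_add]
  · intro x m hx
    change spinorAct R H (l i) (fock e hf.right (ExteriorAlgebra.ι R m * x) s) =
      y • fock e hf.right (contr (e.coord i) (ExteriorAlgebra.ι R m * x)) s
    have h1 : LinearMap.dualProd R H (l i) (e.constr R v m) = y * e.coord i m := by
      rw [e.constr_apply_fintype (S := R), map_sum, Finset.sum_eq_single i]
      · rw [map_smul, hf.pair, if_pos rfl, smul_eq_mul, mul_comm]
        rfl
      · intro j _ hj
        rw [map_smul, hf.pair, if_neg (Ne.symm hj), smul_zero]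
      · simp
    rw [map_mul, Module.End.mul_apply, fock_ι, spinorAct_swap, hx, h1, contr_ι_mul, map_sub,
      map_smul (fock e hf.right), map_mul, fock_ι, LinearMap.sub_apply, LinearMap.smul_apply, Module.End.mul_apply,
      smul_sub, smul_smul, map_smul]

/-- Each vector is self-adjoint for β, so the adjoint of a product is the product in reverse order.
-/
theorem spinorForm_fock (e : Module.Basis (Fin n) R H)
    (e' : Module.Basis (Fin n) R H)
    (hv : ∀ i j, LinearMap.dualProd R H (v i) (v j) = 0)
    (x : ExteriorAlgebra R H) : ∀ s t : ExteriorAlgebra R H,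
    spinorForm e' (fock e hv x s) t = spinorForm e' s
      (fock e hv (CliffordAlgebra.reverse (Q := (0 : QuadraticForm R H)) x) t) := by
  refine CliffordAlgebra.left_induction (0 : QuadraticForm R H)
    (P := fun x : ExteriorAlgebra R H => ∀ s t : ExteriorAlgebra R H,
      spinorForm e' (fock e hv x s) t = spinorForm e' s
      (fock e hv (CliffordAlgebra.reverse (Q := (0 : QuadraticForm R H)) x) t)) ?_ ?_ ?_ x
  · intro r s t
    have h2 : ∀ s, fock e hv (algebraMap R (ExteriorAlgebra R H) r) s = r • s := fun s => by
      rw [AlgHom.commutes, Module.algebraMap_end_apply]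
    rw [CliffordAlgebra.reverse.commutes]
    refine (congrArg (fun u => spinorForm e' u t) (h2 s)).trans
      (Eq.trans ?_ (congrArg (spinorForm e' s) (h2 t)).symm)
    rw [map_smul, LinearMap.smul_apply, map_smul]
  · intro x x' hx hx' s t
    simp only [map_add, LinearMap.add_apply, hx, hx']
  · intro x m hx s t
    have h1 : ∀ s, fock e hv (CliffordAlgebra.ι (0 : QuadraticForm R H) m) s =
        spinorAct R H (e.constr R v m) s := fun s => LinearMap.congr_fun (fock_ι e hv m) s
    rw [CliffordAlgebra.reverse.map_mul, CliffordAlgebra.reverse_ι, map_mul, map_mul,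
      Module.End.mul_apply, Module.End.mul_apply, h1, h1, spinorForm_spinorAct, hx]

/-- The kernel is stable under wedging and contracting with the basis. Induction along the standard
frame, where y = 1, reduces to scalars, and a nonzero scalar does not kill s. -/
theorem fock_injective [IsDomain R] (e : Module.Basis (Fin n) R H)
    (hf : IsFrame l v y) (hy : y ≠ 0) {s : ExteriorAlgebra R H}
    (hs0 : s ≠ 0) (hs : ∀ i, spinorAct R H (l i) s = 0) :
    Function.Injective ((fock e hf.right).toLinearMap.flip s) := by
  have : Module.Free R (ExteriorAlgebra R H) := Module.Free.of_basis e.ExteriorAlgebra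
  rw [← LinearMap.ker_eq_bot, eq_bot_iff]
  intro x hx
  have h := (isFrame_basis e).induction (LinearMap.ker ((fock e hf.right).toLinearMap.flip s)) ⊥
    ?_ ?_ ?_ ?_ x hx
  · simpa using h
  · intro i z hz
    have hz' : fock e hf.right z s = 0 := hz
    change fock e hf.right (spinorAct R H (e.coord i, 0) z) s = 0
    rw [spinorAct_inl]
    have h1 := spinorAct_fock e hf (hs i) z
    rw [hz', map_zero] at h1
    exact (smul_eq_zero.mp h1.symm).resolve_left hy
  · intro i z hz
    have hz' : fock e hf.right z s = 0 := hz
    change fock e hf.right (spinorAct R H (0, e i) z) s = 0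
    rw [spinorAct_inr, map_mul, Module.End.mul_apply, hz', map_zero]
  · intro i z hz
    rw [Submodule.mem_bot] at hz ⊢
    rw [hz, map_zero]
  · intro z hz hz'
    have h1 := eq_algebraMap_of_contr_eq_zero e (w := z) fun i => by
      rw [← spinorAct_inl, hz']
    have h2 : fock e hf.right z s = 0 := hz
    rw [h1, map_smul, map_one, LinearMap.smul_apply, Module.End.one_apply] at h2
    rw [Submodule.mem_bot, h1, (smul_eq_zero.mp h2).resolve_right hs0, zero_smul]

/-- The Fock map is injective between modules of equal rank, so its cokernel is torsion. -/
theorem exists_smul_eq_fock [IsDomain R] (e : Module.Basis (Fin n) R H)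
    (hf : IsFrame l v y) (hy : y ≠ 0)
    {s : ExteriorAlgebra R H} (hs0 : s ≠ 0) (hs : ∀ i, spinorAct R H (l i) s = 0)
    (z : ExteriorAlgebra R H) : ∃ (r : R) (x : ExteriorAlgebra R H), r ≠ 0 ∧
      r • z = fock e hf.right x s := by
  have : Module.Finite R (ExteriorAlgebra R H) := Module.Finite.of_basis e.ExteriorAlgebra
  obtain ⟨r, hr, x, hx⟩ := exists_smul_mem_of_finrank_le
    (LinearMap.range ((fock e hf.right).toLinearMap.flip s))
    (LinearMap.finrank_range_of_inj (fock_injective e hf hy hs0 hs)).ge z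
  exact ⟨r, x, hr, hx.symm⟩

/-- The spinors annihilated by a maximal isotropic submodule form a module of rank one. -/
theorem exists_smul_eq_smul [IsDomain R] (e : Module.Basis (Fin n) R H)
    (hf : IsFrame l v y) (hy : y ≠ 0)
    {s t : ExteriorAlgebra R H} (hs0 : s ≠ 0) (hs : ∀ i, spinorAct R H (l i) s = 0)
    (ht : ∀ i, spinorAct R H (l i) t = 0) : ∃ r c : R, r ≠ 0 ∧ r • t = c • s := by
  have : Module.Free R (ExteriorAlgebra R H) := Module.Free.of_basis e.ExteriorAlgebra
  obtain ⟨r, x, hr, hx⟩ := exists_smul_eq_fock e hf hy hs0 hs t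
  -- The lᵢ kill `t`, so every contraction kills its Fock coefficient `x`, which is therefore a
  -- scalar.
  have h1 := eq_algebraMap_of_contr_eq_zero e (w := x) fun i => by
    apply fock_injective e hf hy hs0 hs
    rw [map_zero]
    change fock e hf.right (contr (e.coord i) x) s = 0
    have h1 := spinorAct_fock e hf (hs i) x
    rw [← hx, map_smul, ht, smul_zero] at h1
    exact (smul_eq_zero.mp h1.symm).resolve_left hy
  refine ⟨r, ExteriorAlgebra.algebraMapInv x, hr, ?_⟩
  rw [hx, h1, map_smul, map_one, LinearMap.smul_apply, Module.End.one_apply]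
  congr 1
  rw [← h1]

theorem exists_eq_smul_of_primitive [IsDomain R] [UniqueFactorizationMonoid R]
    (e : Module.Basis (Fin n) R H)
    (hf : IsFrame l v y) (hy : y ≠ 0) {s t : ExteriorAlgebra R H} (hs0 : s ≠ 0)
    (hs : ∀ i, spinorAct R H (l i) s = 0) (hp : IsPrimitive (R := R) s)
    (ht : ∀ i, spinorAct R H (l i) t = 0) : ∃ c : R, t = c • s := by
  have : Module.Free R (ExteriorAlgebra R H) := Module.Free.of_basis e.ExteriorAlgebra
  have : Module.Finite R (ExteriorAlgebra R H) := Module.Finite.of_basis e.ExteriorAlgebra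
  obtain ⟨r, c, hr, h⟩ := exists_smul_eq_smul e hf hy hs0 hs ht
  exact hp.exists_eq_smul hr h

/-- The form `β` is perfect modulo a prime element. -/
theorem exists_eq_smul_of_forall_dvd_spinorForm (e : Module.Basis (Fin n) R H)
    {π : R} {u : ExteriorAlgebra R H}
    (hu : ∀ z, π ∣ spinorForm e z u) : ∃ u', u = π • u' := by
  let C : Submodule R (ExteriorAlgebra R H) :=
    { carrier := {u | ∀ z, π ∣ spinorForm e z u}
      add_mem' := fun ha hb z => by rw [map_add]; exact dvd_add (ha z) (hb z)
      zero_mem' := fun z => by rw [map_zero]; exact dvd_zero _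
      smul_mem' := fun c x hx z => by rw [map_smul]; exact Dvd.dvd.mul_left (hx z) c }
  let N : Submodule R (ExteriorAlgebra R H) := LinearMap.range (LinearMap.lsmul R _ π)
  have hC : ∀ x, ∀ s ∈ C, spinorAct R H x s ∈ C := fun x s hs z => by
    rw [← spinorForm_spinorAct]; exact hs _
  -- Frame induction for H^* and H leaves only scalars, and pairing these with the top form detects
  -- divisibility by π.
  have h := (isFrame_basis e).induction C N (fun i => hC _) (fun i => hC _) ?_ ?_ u hu
  · rw [one_pow, one_smul] at h
    obtain ⟨u', hu'⟩ := h
    exact ⟨u', hu'.symm⟩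
  · rintro i _ ⟨z, rfl⟩
    exact ⟨spinorAct R H (0, e i) z, by simp⟩
  · intro z hz hz'
    have h1 := eq_algebraMap_of_contr_eq_zero e (w := z) fun i => by
      rw [← spinorAct_inl, hz']
    have h2 := hz (CliffordAlgebra.reverse (Q := (0 : QuadraticForm R H)) (wedgeTop e))
    rw [spinorForm_apply, CliffordAlgebra.reverse_reverse, wedgeTop_mul, map_smul,
      topCoeff_wedgeTop, smul_eq_mul, mul_one] at h2
    obtain ⟨c, hc⟩ := h2
    refine ⟨c • 1, ?_⟩
    rw [h1, hc, mul_smul]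
    rfl

/-- The pairing of a primitive pure spinor with the opposite pure spinor of a frame. -/
theorem not_dvd_spinorForm_fock_wedgeTop [IsDomain R] [UniqueFactorizationMonoid R]
    (e : Module.Basis (Fin n) R H)
    (hf : IsFrame l v y) {π : R} (hπ : π = 0 ∨ Prime π) (hy : ¬ π ∣ y)
    {s : ExteriorAlgebra R H} (hs0 : s ≠ 0)
    (hs : ∀ i, spinorAct R H (l i) s = 0) (hp : IsPrimitive (R := R) s) :
    ¬ π ∣ spinorForm e s (fock e hf.right (wedgeTop e) s) := by
  have : Module.Free R (ExteriorAlgebra R H) := Module.Free.of_basis e.ExteriorAlgebra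
  have : Module.Finite R (ExteriorAlgebra R H) := Module.Finite.of_basis e.ExteriorAlgebra
  have hy0 : y ≠ 0 := fun h => hy (h ▸ dvd_zero π)
  have hyn : ¬ π ∣ y ^ n := by
    rcases hπ with rfl | hπ
    · rw [zero_dvd_iff]; exact pow_ne_zero _ hy0
    · exact fun h => hy (hπ.dvd_of_dvd_pow h)
  intro hdvd
  set u := fock e hf.right (wedgeTop e) s with hu
  -- By adjunction the reversal of `x` meets the top form, which retains only a scalar.
  have h1 : ∀ x, π ∣ spinorForm e (fock e hf.right x s) u := fun x => by
    rw [spinorForm_fock, hu, ← Module.End.mul_apply, ← map_mul, mul_wedgeTop, map_smul,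
      LinearMap.smul_apply, map_smul]
    exact Dvd.dvd.mul_left hdvd _
  -- Primitivity makes every spinor killed by all lᵢ a multiple of `s`, the base case of frame
  -- induction.
  have h2 : ∀ z, y ^ n • z ∈ LinearMap.range ((fock e hf.right).toLinearMap.flip s) := by
    intro z
    refine hf.induction ⊤ _ (fun _ _ _ => trivial) (fun _ _ _ => trivial) ?_ ?_ z trivial
    · rintro i _ ⟨x, rfl⟩
      refine ⟨ExteriorAlgebra.ι R (e i) * x, ?_⟩
      change fock e hf.right (ExteriorAlgebra.ι R (e i) * x) s =
        spinorAct R H (v i) (fock e hf.right x s)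
      rw [map_mul, fock_ι_basis, Module.End.mul_apply]
    · intro z _ hz
      obtain ⟨c, rfl⟩ := exists_eq_smul_of_primitive e hf hy0 hs0 hs hp hz
      refine ⟨c • 1, ?_⟩
      change fock e hf.right (c • 1) s = c • s
      rw [map_smul, map_one, LinearMap.smul_apply, Module.End.one_apply]
  have h3 : ∀ z, π ∣ spinorForm e z u := fun z => by
    obtain ⟨x, hx⟩ := h2 z
    have h4 := h1 x
    change (fock e hf.right) x s = _ at hx
    rw [hx, map_smul, LinearMap.smul_apply, smul_eq_mul] at h4
    exact (dvd_or_dvd_of_zero_or_prime hπ h4).resolve_left hyn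
  obtain ⟨u', hu'⟩ := exists_eq_smul_of_forall_dvd_spinorForm e h3
  -- The coefficients that send `s` into πΛ are stable under contraction because π does not divide
  -- `y`. They include the top form, hence 1, so π divides `s`.
  let N : Submodule R (ExteriorAlgebra R H) :=
    (LinearMap.range (LinearMap.lsmul R (ExteriorAlgebra R H) π)).comap
      ((fock e hf.right).toLinearMap.flip s)
  have hN : (1 : ExteriorAlgebra R H) ∈ N := by
    refine one_mem_of_wedgeTop_mem e N (fun i z hz => ?_) ⟨u', hu'.symm⟩
    obtain ⟨z', hz'⟩ := hz
    change π • z' = fock e hf.right z s at hz'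
    have h5 := spinorAct_fock e hf (hs i) z
    rw [← hz', map_smul] at h5
    obtain ⟨z'', hz''⟩ := exists_eq_smul_of_smul_eq_smul hπ hy h5.symm
    exact ⟨z'', hz''.symm⟩
  obtain ⟨s', hs'⟩ := hN
  change π • s' = fock e hf.right 1 s at hs'
  rw [map_one, Module.End.one_apply] at hs'
  rcases hπ with rfl | hπ
  · exact hs0 (by rw [← hs', zero_smul])
  · exact hp π hπ s' hs'.symm

end Fock

/-! ### Antisymmetrized products in a Clifford algebra. -/

section Clifford

variable {R M : Type*} [CommRing R] [AddCommGroup M] [Module R M] {Q : QuadraticForm R M}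

/-- The supercommutator with a vector and the contraction obey the same signed Leibniz rule, and
they agree on vectors. -/
theorem ι_mul_sub_involute_mul_ι (m : M) (x : CliffordAlgebra Q) :
    CliffordAlgebra.ι Q m * x - CliffordAlgebra.involute x * CliffordAlgebra.ι Q m =
      CliffordAlgebra.contractLeft (QuadraticMap.polarBilin Q m) x := by
  refine CliffordAlgebra.left_induction Q
    (P := fun x => CliffordAlgebra.ι Q m * x - CliffordAlgebra.involute x * CliffordAlgebra.ι Q m =
      CliffordAlgebra.contractLeft (QuadraticMap.polarBilin Q m) x) ?_ ?_ ?_ x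
  · intro r
    rw [AlgHom.commutes, Algebra.commutes, sub_self, CliffordAlgebra.contractLeft_algebraMap]
  · intro x y hx hy
    rw [map_add, map_add, ← hx, ← hy, mul_add, add_mul]
    abel
  · intro x m' hx
    rw [CliffordAlgebra.contractLeft_ι_mul, ← hx, map_mul, CliffordAlgebra.involute_ι, ← mul_assoc,
      eq_sub_of_add_eq (CliffordAlgebra.ι_mul_ι_add_swap m m'), sub_mul, mul_sub, neg_mul, neg_mul,
      ← Algebra.smul_def, QuadraticMap.polarBilin_apply_apply]
    simp only [mul_assoc]
    abel

/-- Antisymmetrization corrects the product with m by a contraction with half the polar form, that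
is, by half a supercommutator. -/
theorem equivExterior_symm_ι_mul [Invertible (2 : R)] (m : M) (ω : ExteriorAlgebra R M) :
    (2 : R) • (CliffordAlgebra.equivExterior Q).symm (ExteriorAlgebra.ι R m * ω) =
      CliffordAlgebra.ι Q m * (CliffordAlgebra.equivExterior Q).symm ω +
        CliffordAlgebra.involute ((CliffordAlgebra.equivExterior Q).symm ω) *
          CliffordAlgebra.ι Q m := by
  have h1 : (CliffordAlgebra.equivExterior Q).symm (ExteriorAlgebra.ι R m * ω) =
      CliffordAlgebra.ι Q m * (CliffordAlgebra.equivExterior Q).symm ω -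
      CliffordAlgebra.contractLeft ((-(QuadraticMap.associated (-Q))) m)
        ((CliffordAlgebra.equivExterior Q).symm ω) :=
    CliffordAlgebra.changeForm_ι_mul
      (CliffordAlgebra.changeForm.neg_proof CliffordAlgebra.changeForm.associated_neg_proof) m ω
  have h2 : (2 : R) • ((-(QuadraticMap.associated (-Q))) m) = QuadraticMap.polarBilin Q m := by
    have h3 : -(QuadraticMap.associated (-Q)) = QuadraticMap.associated Q := by
      rw [map_neg]
      exact neg_neg (QuadraticMap.associated Q)
    rw [h3, two_smul, ← QuadraticMap.two_nsmul_associated R Q, two_smul, LinearMap.add_apply]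
  rw [h1, smul_sub, ← LinearMap.smul_apply, ← map_smul, h2, ← ι_mul_sub_involute_mul_ι, two_smul]
  abel

/-- A vector supercommutes with an element of the Clifford algebra. -/
def Supercommutes (m : M) (x : CliffordAlgebra Q) : Prop :=
  CliffordAlgebra.ι Q m * x = CliffordAlgebra.involute x * CliffordAlgebra.ι Q m

theorem supercommutes_one (m : M) : Supercommutes (Q := Q) m 1 := by
  rw [Supercommutes, map_one, mul_one, one_mul]

theorem Supercommutes.ι_mul {m m' : M} {x : CliffordAlgebra Q} (h : Supercommutes m x)
    (hm : QuadraticMap.polar Q m m' = 0) : Supercommutes m (CliffordAlgebra.ι Q m' * x) := by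
  have h1 := CliffordAlgebra.ι_mul_ι_add_swap (Q := Q) m m'
  rw [hm, map_zero] at h1
  rw [Supercommutes, ← mul_assoc, eq_neg_of_add_eq_zero_left h1, map_mul,
    CliffordAlgebra.involute_ι, neg_mul, neg_mul, neg_mul, mul_assoc, h, mul_assoc]

theorem Supercommutes.sub {m : M} {x x' : CliffordAlgebra Q} (h : Supercommutes m x)
    (h' : Supercommutes m x') : Supercommutes m (x - x') := by
  rw [Supercommutes, mul_sub, h, h', map_sub, sub_mul]

theorem Supercommutes.smul {m : M} {x : CliffordAlgebra Q} (h : Supercommutes m x) (c : R) :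
    Supercommutes m (c • x) := by
  rw [Supercommutes, mul_smul_comm, h, map_smul, smul_mul_assoc]

theorem equivExterior_symm_ι_mul_of_supercommutes [Invertible (2 : R)] {m : M}
    {ω : ExteriorAlgebra R M}
    (h : Supercommutes m ((CliffordAlgebra.equivExterior Q).symm ω)) :
    (CliffordAlgebra.equivExterior Q).symm (ExteriorAlgebra.ι R m * ω) =
      CliffordAlgebra.ι Q m * (CliffordAlgebra.equivExterior Q).symm ω := by
  have h1 := equivExterior_symm_ι_mul (Q := Q) m ω
  rw [← h, ← two_smul R] at h1
  exact (isUnit_of_invertible (2 : R)).smul_left_cancel.mp h1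

/-- For two vectors that supercommute with the rest, the only correction comes from their mutual
pairing. This is used for the pairs vᵢ, lᵢ of a frame. -/
theorem equivExterior_symm_ι_mul_ι_mul_of_supercommutes [Invertible (2 : R)] {m m' : M}
    {ω : ExteriorAlgebra R M}
    (h : Supercommutes m ((CliffordAlgebra.equivExterior Q).symm ω))
    (h' : Supercommutes m' ((CliffordAlgebra.equivExterior Q).symm ω)) :
    (CliffordAlgebra.equivExterior Q).symm
        (ExteriorAlgebra.ι R m * (ExteriorAlgebra.ι R m' * ω)) =
      CliffordAlgebra.ι Q m * (CliffordAlgebra.ι Q m' * (CliffordAlgebra.equivExterior Q).symm ω) -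
        (⅟2 * QuadraticMap.polar Q m m') • (CliffordAlgebra.equivExterior Q).symm ω := by
  have h1 := equivExterior_symm_ι_mul (Q := Q) m (ExteriorAlgebra.ι R m' * ω)
  rw [equivExterior_symm_ι_mul_of_supercommutes h', map_mul CliffordAlgebra.involute, CliffordAlgebra.involute_ι, neg_mul,
    neg_mul, mul_assoc, ← h, ← mul_assoc (CliffordAlgebra.ι Q m'), ← sub_eq_add_neg,
    eq_sub_of_add_eq' (CliffordAlgebra.ι_mul_ι_add_swap m m'), sub_mul, ← Algebra.smul_def] at h1
  refine (isUnit_of_invertible (2 : R)).smul_left_cancel.mp (h1.trans ?_)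
  rw [smul_sub, smul_smul, mul_invOf_cancel_left, two_smul, mul_assoc]
  abel

end Clifford

/-! ### The square of a spinor as an alternating form. -/

section SpinorP

variable {R H : Type*} [CommRing R] [AddCommGroup H] [Module R H] {n : ℕ}

theorem polar_dualProd (x y : Hyp R H) :
    QuadraticMap.polar (QuadraticForm.dualProd R H) x y = LinearMap.dualProd R H x y := by
  simp only [QuadraticMap.polar, QuadraticForm.dualProd_apply, dualProd_apply', Prod.fst_add,
    Prod.snd_add, LinearMap.add_apply, map_add]
  ring

theorem cliffordAct_ι (x : Hyp R H) :
    cliffordAct R H (CliffordAlgebra.ι (QuadraticForm.dualProd R H) x) = spinorAct R H x := by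
  rw [cliffordAct, CliffordAlgebra.lift_ι_apply]

variable [Invertible (2 : R)]

/-- The antisymmetrized Clifford product, acting on spinors. -/
def wedgeAct (R H : Type*) [CommRing R] [AddCommGroup H] [Module R H] [Invertible (2 : R)] :
    ExteriorAlgebra R (Hyp R H) →ₗ[R] Module.End R (ExteriorAlgebra R H) :=
  (cliffordAct R H).toLinearMap.comp
    (CliffordAlgebra.equivExterior (QuadraticForm.dualProd R H)).symm.toLinearMap

theorem wedgeAct_apply (ω : ExteriorAlgebra R (Hyp R H)) : wedgeAct R H ω = cliffordAct R H
    ((CliffordAlgebra.equivExterior (QuadraticForm.dualProd R H)).symm ω) := rfl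

theorem spinorP_ιMulti (e : Module.Basis (Fin n) R H) (s t : ExteriorAlgebra R H)
    (u : Fin n → Hyp R H) :
    spinorP e s t (exteriorPower.ιMulti R n u) =
      spinorForm e s (wedgeAct R H (ExteriorAlgebra.ιMulti R n u) t) := rfl

/-- Twice the antisymmetrized product is a sum of two terms, with x leftmost and x rightmost. In one
x moves across β to the first s, in the other it acts on the second s. -/
theorem spinorForm_wedgeAct_ι_mul (e : Module.Basis (Fin n) R H) {s : ExteriorAlgebra R H}
    {x : Hyp R H} (hx : spinorAct R H x s = 0) (ω : ExteriorAlgebra R (Hyp R H)) :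
    spinorForm e s (wedgeAct R H (ExteriorAlgebra.ι R x * ω) s) = 0 := by
  have h1 := congrArg (fun c => spinorForm e s (cliffordAct R H c s))
    (equivExterior_symm_ι_mul (Q := QuadraticForm.dualProd R H) x ω)
  simp only [map_smul, map_add, map_mul, LinearMap.smul_apply, LinearMap.add_apply,
    Module.End.mul_apply, cliffordAct_ι, hx, map_zero, add_zero] at h1
  rw [← spinorForm_spinorAct, hx, map_zero, LinearMap.zero_apply, smul_eq_mul] at h1
  exact (isUnit_of_invertible (2 : R)).mul_right_eq_zero.mp h1

theorem spinorP_eq_zero_of_spinorAct_eq_zero (e : Module.Basis (Fin n) R H)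
    {s : ExteriorAlgebra R H} {u : Fin n → Hyp R H} (i : Fin n)
    (hi : spinorAct R H (u i) s = 0) : spinorP e s s (exteriorPower.ιMulti R n u) = 0 := by
  cases n with
  | zero => exact i.elim0
  | succ n =>
    have key : ∀ u' : Fin (n + 1) → Hyp R H, spinorAct R H (u' 0) s = 0 →
        spinorP e s s (exteriorPower.ιMulti R (n + 1) u') = 0 := fun u' hu' => by
      rw [spinorP_ιMulti, ExteriorAlgebra.ιMulti_succ_apply]
      exact spinorForm_wedgeAct_ι_mul e hu' _
    by_cases h0 : i = 0
    · subst h0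
      exact key u hi
    · have h1 := (exteriorPower.ιMulti R (n + 1) (M := Hyp R H)).map_swap u h0
      have h2 := key (u ∘ Equiv.swap i 0) (by simpa using hi)
      rw [h1, map_neg, neg_eq_zero] at h2
      exact h2

end SpinorP

/-! ### Signs, reversal and basis monomials. -/

section WedgeLists

variable {R H : Type*} [CommRing R] [AddCommGroup H] [Module R H] {n : ℕ}

theorem wedgeList_append (l l' : List H) :
    wedgeList (R := R) (l ++ l') = wedgeList l * wedgeList l' := by
  rw [wedgeList, wedgeList, wedgeList, List.map_append, List.prod_append]

theorem wedgeList_mul_ι (l : List H) (m : H) :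
    wedgeList (R := R) l * ExteriorAlgebra.ι R m =
      (-1 : R) ^ l.length • (ExteriorAlgebra.ι R m * wedgeList l) := by
  induction l with
  | nil => simp
  | cons a l ih =>
    rw [wedgeList_cons, mul_assoc, ih, mul_smul_comm, ← mul_assoc, ← mul_assoc,
      eq_neg_of_add_eq_zero_left (ExteriorAlgebra.ι_add_mul_swap a m), List.length_cons, pow_succ,
      mul_neg_one, neg_smul, neg_mul, smul_neg]

theorem reverse_wedgeList (l : List H) :
    CliffordAlgebra.reverse (Q := (0 : QuadraticForm R H)) (wedgeList (R := R) l) =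
      (-1 : R) ^ (l.length.choose 2) • wedgeList (R := R) l := by
  induction l with
  | nil => simp
  | cons a l ih =>
    have h : CliffordAlgebra.reverse (Q := (0 : QuadraticForm R H)) (ExteriorAlgebra.ι R a) =
        ExteriorAlgebra.ι R a := CliffordAlgebra.reverse_ι a
    rw [wedgeList_cons, CliffordAlgebra.reverse.map_mul, ih, h, smul_mul_assoc, wedgeList_mul_ι,
      smul_smul, List.length_cons, Nat.choose_succ_succ' l.length 1, Nat.choose_one_right, pow_add,
      mul_comm]

/-- With n = k + 2m this is the sign that makes the two cross terms in `fock_coeff_eq_zero` add up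
instead of cancelling. -/
theorem neg_one_pow_choose (k m : ℕ) :
    (-1 : R) ^ m * ((-1) ^ k.choose 2 * (-1) ^ (k + 2 * m).choose 2) = 1 := by
  induction m with
  | zero => rw [pow_zero, one_mul, mul_zero, add_zero, ← mul_pow]; simp
  | succ m ih =>
    have h : (k + 2 * (m + 1)).choose 2 = (k + 2 * m).choose 2 + 2 * (k + 2 * m) + 1 := by
      rw [show k + 2 * (m + 1) = (k + 2 * m + 1) + 1 by ring, Nat.choose_succ_succ' _ 1,
        Nat.choose_succ_succ' _ 1, Nat.choose_one_right, Nat.choose_one_right]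
      ring
    rw [h]
    have h2 : (-1 : R) ^ (2 * (k + 2 * m)) = 1 := Even.neg_one_pow (even_two_mul _)
    linear_combination (-1 : R) ^ (2 * (k + 2 * m)) * ih + h2

theorem wedgeList_mul_wedgeList_of_mem {m : H} {l : List H} (h : m ∈ l) :
    ∀ {l' : List H}, m ∈ l' → wedgeList (R := R) l * wedgeList l' = 0
  | a :: l', h' => by
    rw [wedgeList_cons, ← mul_assoc]
    rcases List.mem_cons.mp h' with rfl | h'
    · rw [wedgeList_mul_ι_of_mem h, zero_mul]
    · rw [wedgeList_mul_ι, smul_mul_assoc, mul_assoc, wedgeList_mul_wedgeList_of_mem h h',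
        mul_zero, smul_zero]

theorem ιMulti_get {M : Type*} [AddCommGroup M] [Module R M] (L : List M) (hL : L.length = n) :
    ExteriorAlgebra.ιMulti R n (fun i => L.get (i.cast hL.symm)) = wedgeList (R := R) L := by
  subst hL
  rw [ExteriorAlgebra.ιMulti_apply, wedgeList]
  congr 1
  exact List.ext_getElem (by simp) (by intros; simp)

theorem exists_wedgeList_eq_wedgeTop (e : Module.Basis (Fin n) R H) (L : List (Fin n))
    (hL : L.Nodup) (hn : L.length = n) :
    ∃ c : R, IsUnit c ∧ wedgeList (R := R) (L.map e) = c • wedgeTop e := by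
  let σ : Fin n → Fin n := fun i => L.get (i.cast hn.symm)
  have hσ : Function.Bijective σ :=
    Finite.injective_iff_bijective.mp fun i j h => by
      have := List.nodup_iff_injective_get.mp hL h
      simpa using this
  have h1 := ιMulti_get (R := R) (L.map e) (n := n) (by simpa using hn)
  have h2 : (fun i : Fin n => (L.map e).get (i.cast (by simpa using hn.symm))) =
      e ∘ Equiv.ofBijective σ hσ := by
    funext i
    simp [σ]
  rw [h2, AlternatingMap.map_perm, ← wedgeTop_eq] at h1
  refine ⟨((Equiv.Perm.sign (Equiv.ofBijective σ hσ) : ℤˣ) : ℤ), ?_, ?_⟩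
  · rcases Int.units_eq_one_or (Equiv.Perm.sign (Equiv.ofBijective σ hσ)) with h | h <;>
      rw [h] <;> simp
  · rw [← h1, Int.cast_smul_eq_zsmul]
    rfl

theorem exists_wedgeList_eq_basis (e : Module.Basis (Fin n) R H) (S : Finset (Fin n)) :
    ∃ L : List (Fin n), L.Nodup ∧ L.toFinset = S ∧ e.ExteriorAlgebra S =
      wedgeList (R := R) (L.map e) := by
  classical
  refine ⟨List.ofFn (Set.powersetCard.ofFinEmbEquiv.symm (Set.powersetCard.prodEquiv.symm S).2),
    ?_, ?_, ?_⟩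
  · rw [List.nodup_ofFn]
    exact (Set.powersetCard.ofFinEmbEquiv.symm (Set.powersetCard.prodEquiv.symm S).2).injective
  · ext i
    rw [List.mem_toFinset, List.mem_ofFn]
    exact Set.powersetCard.mem_range_ofFinEmbEquiv_symm_iff_mem _ _
  · rw [ExteriorAlgebra.basis_apply]
    refine (ExteriorAlgebra.ιMulti_apply _).trans ?_
    rw [wedgeList, List.map_map, List.map_ofFn]
    rfl

theorem algebraMapInv_reverse (x : ExteriorAlgebra R H) :
    ExteriorAlgebra.algebraMapInv (CliffordAlgebra.reverse (Q := (0 : QuadraticForm R H)) x) =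
      ExteriorAlgebra.algebraMapInv x := by
  refine CliffordAlgebra.left_induction (0 : QuadraticForm R H)
    (P := fun x : ExteriorAlgebra R H => ExteriorAlgebra.algebraMapInv
      (CliffordAlgebra.reverse (Q := (0 : QuadraticForm R H)) x) =
      ExteriorAlgebra.algebraMapInv x) ?_ ?_ ?_ x
  · intro r
    rw [CliffordAlgebra.reverse.commutes]
  · intro x y hx hy
    simp only [map_add, hx, hy]
  · intro x m hx
    rw [CliffordAlgebra.reverse.map_mul, CliffordAlgebra.reverse_ι, map_mul, map_mul, hx, mul_comm]

end WedgeLists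

/-! ### Action of the test forms in the Fock model. -/

section TestForms

variable {R H : Type*} [CommRing R] [AddCommGroup H] [Module R H] {n : ℕ}

/-- The list of vectors `vᵢ, lᵢ` for `i` in `A`, followed by the `vᵢ` for `i` in `B`. -/
def testList (l v : Fin n → Hyp R H) (A B : List (Fin n)) : List (Hyp R H) :=
  A.flatMap (fun i => [v i, l i]) ++ B.map v

theorem testList_cons (l v : Fin n → Hyp R H) (i : Fin n) (A B : List (Fin n)) :
    testList l v (i :: A) B = v i :: l i :: testList l v A B := by
  simp [testList]

theorem testList_nil_cons (l v : Fin n → Hyp R H) (i : Fin n) (B : List (Fin n)) :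
    testList l v [] (i :: B) = v i :: testList l v [] B := by
  simp [testList]

theorem length_testList (l v : Fin n → Hyp R H) (A B : List (Fin n)) :
    (testList l v A B).length = 2 * A.length + B.length := by
  induction A with
  | nil => simp [testList]
  | cons i A ih => rw [testList_cons, List.length_cons, List.length_cons, ih, List.length_cons]; ring

variable [Invertible (2 : R)] {l v : Fin n → Hyp R H} {y : R}

theorem equivExterior_symm_one {M : Type*} [AddCommGroup M] [Module R M] (Q : QuadraticForm R M) :
    (CliffordAlgebra.equivExterior Q).symm 1 = 1 :=
  CliffordAlgebra.changeForm_one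
    (CliffordAlgebra.changeForm.neg_proof CliffordAlgebra.changeForm.associated_neg_proof)

/-- A vector orthogonal to every member of the list supercommutes with its antisymmetrization. This
licenses pulling the next vector, or the next pair, out of the antisymmetrized product. -/
theorem supercommutes_testList (hf : IsFrame l v y) (A : List (Fin n)) :
    ∀ (B : List (Fin n)), (A ++ B).Nodup → ∀ {x : Hyp R H},
      (∀ i ∈ A, LinearMap.dualProd R H x (l i) = 0) →
      (∀ i ∈ A ++ B, LinearMap.dualProd R H x (v i) = 0) →
    Supercommutes x ((CliffordAlgebra.equivExterior (QuadraticForm.dualProd R H)).symm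
      (wedgeList (R := R) (testList l v A B))) := by
  induction A with
  | nil =>
    intro B
    induction B with
    | nil =>
      intro _ x _ _
      rw [show testList l v [] [] = [] from rfl, wedgeList_nil, equivExterior_symm_one]
      exact supercommutes_one x
    | cons i B ih =>
      intro hB x hx hx'
      have hB' := (List.nodup_cons.mp hB).2
      rw [testList_nil_cons, wedgeList_cons, equivExterior_symm_ι_mul_of_supercommutes
        (ih hB' (by simp) fun j _ => hf.right i j)]
      exact (ih hB' hx fun j hj => hx' j (by simpa using Or.inr hj)).ι_mul
        (by rw [polar_dualProd, hx' i (by simp)])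
  | cons i A ih =>
    intro B hB x hx hx'
    obtain ⟨hi, hB'⟩ := List.nodup_cons.mp hB
    have hne : ∀ j ∈ A ++ B, i ≠ j := fun j hj h => hi (h ▸ hj)
    have hx1 := ih B hB' (x := x) (fun j hj => hx j (by simp [hj]))
      (fun j hj => hx' j (List.mem_cons_of_mem _ hj))
    rw [testList_cons, wedgeList_cons, wedgeList_cons,
      equivExterior_symm_ι_mul_ι_mul_of_supercommutes]
    · exact ((hx1.ι_mul (by rw [polar_dualProd, hx i (by simp)])).ι_mul
        (by rw [polar_dualProd, hx' i (by simp)])).sub (hx1.smul _)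
    · refine ih B hB' (fun j hj => ?_) fun j _ => hf.right i j
      rw [dualProd_comm, hf.pair, if_neg (hne j (by simp [hj])).symm]
    · refine ih B hB' (fun j _ => hf.left i j) fun j hj => ?_
      rw [hf.pair, if_neg (hne j hj)]

/-- The operator by which `[vᵢ ∧ lᵢ]` acts, up to a scalar, in the Fock representation. -/
def halfWeight (e : Module.Basis (Fin n) R H) (i : Fin n) : Module.End R (ExteriorAlgebra R H) :=
  (LinearMap.mulLeft R (ExteriorAlgebra.ι R (e i))).comp (contr (e.coord i)) - (⅟2 : R) • 1

theorem halfWeight_apply (e : Module.Basis (Fin n) R H) (i : Fin n) (x : ExteriorAlgebra R H) :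
    halfWeight e i x = ExteriorAlgebra.ι R (e i) * contr (e.coord i) x - (⅟2 : R) • x := rfl

theorem fock_ι_basis_mul (e : Module.Basis (Fin n) R H)
    (hv : ∀ i j, LinearMap.dualProd R H (v i) (v j) = 0) (i : Fin n)
    (x s : ExteriorAlgebra R H) :
    fock e hv (ExteriorAlgebra.ι R (e i) * x) s = spinorAct R H (v i) (fock e hv x s) := by
  rw [map_mul, fock_ι_basis, Module.End.mul_apply]

/-- The pair vᵢ, lᵢ acts as vᵢlᵢ − y/2, which on Fock coefficients is y times the occupation number
of i minus one half. The remaining vᵢ are mutually orthogonal and act by plain products. -/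
theorem wedgeAct_testList_fock (e : Module.Basis (Fin n) R H) (hf : IsFrame l v y)
    {s : ExteriorAlgebra R H} (hs : ∀ i, spinorAct R H (l i) s = 0) (A : List (Fin n)) :
    ∀ (B : List (Fin n)), (A ++ B).Nodup → ∀ x : ExteriorAlgebra R H,
    wedgeAct R H (wedgeList (testList l v A B)) (fock e hf.right x s) =
      y ^ A.length • fock e hf.right
        ((A.map (halfWeight e)).prod (wedgeList (R := R) (B.map e) * x)) s := by
  induction A with
  | nil =>
    intro B
    induction B with
    | nil =>
      intro _ x
      rw [show testList l v [] [] = [] from rfl, wedgeAct_apply, wedgeList_nil,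
        equivExterior_symm_one]
      simp
    | cons i B ih =>
      intro hB x
      have hB' := (List.nodup_cons.mp hB).2
      have h1 := ih hB' x
      simp only [List.length_nil, pow_zero, one_smul, List.map_nil, List.prod_nil,
        Module.End.one_apply] at h1 ⊢
      rw [testList_nil_cons, wedgeList_cons, wedgeAct_apply,
        equivExterior_symm_ι_mul_of_supercommutes
          (supercommutes_testList hf [] B hB' (by simp) fun j _ => hf.right i j),
        map_mul, cliffordAct_ι, Module.End.mul_apply, ← wedgeAct_apply, h1, List.map_cons,
        wedgeList_cons, mul_assoc, fock_ι_basis_mul]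
  | cons i A ih =>
    intro B hB x
    obtain ⟨hi, hB'⟩ := List.nodup_cons.mp hB
    have hne : ∀ j ∈ A ++ B, i ≠ j := fun j hj h => hi (h ▸ hj)
    rw [testList_cons, wedgeList_cons, wedgeList_cons, wedgeAct_apply,
      equivExterior_symm_ι_mul_ι_mul_of_supercommutes, polar_dualProd, dualProd_comm, hf.pair,
      if_pos rfl]
    · rw [map_sub, map_smul, map_mul, map_mul, cliffordAct_ι, cliffordAct_ι, LinearMap.sub_apply,
        LinearMap.smul_apply, Module.End.mul_apply, Module.End.mul_apply, ← wedgeAct_apply,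
        ih B hB', List.map_cons, List.prod_cons, Module.End.mul_apply, halfWeight_apply]
      generalize (A.map (halfWeight e)).prod (wedgeList (R := R) (B.map e) * x) = z
      rw [map_sub, LinearMap.sub_apply, fock_ι_basis_mul, map_smul (fock e hf.right),
        LinearMap.smul_apply, map_smul, map_smul, spinorAct_fock e hf (hs i), map_smul,
        List.length_cons, smul_sub, smul_smul, smul_smul, smul_smul]
      congr 2 <;> ring
    · refine supercommutes_testList hf A B hB' (fun j hj => ?_) fun j _ => hf.right i j
      rw [dualProd_comm, hf.pair, if_neg (hne j (by simp [hj])).symm]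
    · refine supercommutes_testList hf A B hB' (fun j _ => hf.left i j) fun j hj => ?_
      rw [hf.pair, if_neg (hne j hj)]

theorem spinorP_ιMulti_get (e : Module.Basis (Fin n) R H) (s t : ExteriorAlgebra R H)
    (L : List (Hyp R H)) (hL : L.length = n) :
    spinorP e s t (exteriorPower.ιMulti R n fun i => L.get (i.cast hL.symm)) =
      spinorForm e s (wedgeAct R H (wedgeList L) t) := by
  rw [spinorP_ιMulti, ιMulti_get _ hL]

end TestForms

/-! ### A spinor is pure if its square is, up to a scalar, that of a pure spinor. -/

section Purity

variable {R H : Type*} [CommRing R] [AddCommGroup H] [Module R H] {n : ℕ}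

theorem list_prod_apply_eq_smul {M ι : Type*} [AddCommGroup M] [Module R M]
    (f : ι → Module.End R M) (κ : R) (z : M) :
    ∀ A : List ι, (∀ i ∈ A, f i z = κ • z) → (A.map f).prod z = κ ^ A.length • z
  | [], _ => by simp
  | i :: A, h => by
    rw [List.map_cons, List.prod_cons, Module.End.mul_apply,
      list_prod_apply_eq_smul f κ z A fun j hj => h j (by simp [hj]), map_smul, h i (by simp),
      smul_smul, List.length_cons, pow_succ]

theorem contr_wedgeList_map (e : Module.Basis (Fin n) R H) {i : Fin n} {L : List (Fin n)}
    (h : i ∉ L) : contr (e.coord i) (wedgeList (R := R) (L.map e)) = 0 := by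
  have := contr_wedgeList_mul_of_forall (contr_one (e.coord i)) (L.map e) fun m hm => by
    obtain ⟨j, hj, rfl⟩ := List.mem_map.mp hm
    have : j ≠ i := fun hh => h (hh ▸ hj)
    simp [Finsupp.single_eq_of_ne this.symm]
  rwa [mul_one] at this

theorem basis_empty (e : Module.Basis (Fin n) R H) : e.ExteriorAlgebra ∅ = 1 := by
  obtain ⟨L, -, hL, h⟩ := exists_wedgeList_eq_basis e ∅
  rw [h, List.toFinset_eq_empty_iff _ |>.mp hL]
  simp

theorem algebraMapInv_basis (e : Module.Basis (Fin n) R H) {S : Finset (Fin n)} (hS : S ≠ ∅) :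
    ExteriorAlgebra.algebraMapInv (e.ExteriorAlgebra S) = 0 := by
  obtain ⟨L, -, hL, h⟩ := exists_wedgeList_eq_basis e S
  rw [h]
  cases L with
  | nil => exact absurd hL.symm hS
  | cons i L => rw [List.map_cons, wedgeList_cons, algebraMapInv_ι_mul]

theorem spinorAct_mem_evenOdd (x : Hyp R H) {i : ZMod 2} {s : ExteriorAlgebra R H}
    (hs : s ∈ CliffordAlgebra.evenOdd (0 : QuadraticForm R H) i) :
    spinorAct R H x s ∈ CliffordAlgebra.evenOdd (0 : QuadraticForm R H) (i + 1) := by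
  rw [spinorAct_apply]
  refine Submodule.add_mem _ ?_ (contractLeft_mem x.1 i s hs)
  rw [add_comm]
  exact CliffordAlgebra.evenOdd_mul_le (0 : QuadraticForm R H) 1 i
    (Submodule.mul_mem_mul (CliffordAlgebra.ι_mem_evenOdd_one _ x.2) hs)

theorem eq_zero_of_mem_even_of_mem_odd {s : ExteriorAlgebra R H} (h0 : s ∈ VEven R H)
    (h1 : s ∈ VOdd R H) : s = 0 :=
  Submodule.disjoint_def.mp (CliffordAlgebra.evenOdd_isCompl (0 : QuadraticForm R H)).disjoint s
    h0 h1

variable [Invertible (2 : R)] {l v : Fin n → Hyp R H} {y : R}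

/-- The contraction is, up to y, an action of lᵢ, which moves across β and kills s. -/
theorem spinorForm_fock_contr [IsDomain R] (e : Module.Basis (Fin n) R H) (hf : IsFrame l v y)
    (hy : y ≠ 0) {s : ExteriorAlgebra R H} (hs : ∀ i, spinorAct R H (l i) s = 0) (i : Fin n)
    (z : ExteriorAlgebra R H) :
    spinorForm e s (fock e hf.right (contr (e.coord i) z) s) = 0 := by
  have h := congrArg (spinorForm e s) (spinorAct_fock e hf (hs i) z)
  rw [← spinorForm_spinorAct, hs, map_zero, LinearMap.zero_apply, map_smul, smul_eq_mul] at h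
  exact (mul_eq_zero.mp h.symm).resolve_left hy

/-- A spinor with an even expansion in the Fock representation, whose square has no component
involving the isotropic submodule of the frame, is a multiple of the pure spinor. -/
theorem fock_coeff_eq_zero [IsDomain R] (e : Module.Basis (Fin n) R H) (hf : IsFrame l v y)
    (hy : y ≠ 0) {s : ExteriorAlgebra R H} (hs : ∀ i, spinorAct R H (l i) s = 0)
    (htop : spinorForm e s (fock e hf.right (wedgeTop e) s) ≠ 0)
    (c : Finset (Fin n) → R) (hc : ∀ S, Odd S.card → c S = 0) (hc0 : c ∅ ≠ 0)
    {x : ExteriorAlgebra R H} (hx : x = ∑ S, c S • e.ExteriorAlgebra S)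
    (hP : ∀ L : List (Hyp R H), L.length = n → (∃ i, l i ∈ L) →
      spinorForm e (fock e hf.right x s)
        (wedgeAct R H (wedgeList L) (fock e hf.right x s)) = 0) :
    ∀ J, J ≠ ∅ → c J = 0 := by
  classical
  intro J
  induction J using Finset.strongInduction with
  | H J ih =>
  intro hJ
  rcases Nat.even_or_odd J.card with ⟨m, hm⟩ | hodd
  swap
  · exact hc J hodd
  obtain ⟨LJ, hLJn, hLJ, hbJ⟩ := exists_wedgeList_eq_basis e J
  obtain ⟨B, hBn, hB, -⟩ := exists_wedgeList_eq_basis e Jᶜ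
  have memB : ∀ i, i ∈ B ↔ i ∉ J := fun i => by rw [← List.mem_toFinset, hB, Finset.mem_compl]
  have memJ : ∀ i, i ∈ LJ ↔ i ∈ J := fun i => by rw [← List.mem_toFinset, hLJ]
  have lenJ : LJ.length = J.card := by rw [← hLJ, List.toFinset_card_of_nodup hLJn]
  have lenB : B.length + 2 * m = n := by
    have h1 := Finset.card_compl_add_card J
    rw [← hB, List.toFinset_card_of_nodup hBn, Fintype.card_fin] at h1
    omega
  have hmpos : 0 < m := by
    have := Finset.card_pos.mpr (Finset.nonempty_iff_ne_empty.mpr hJ)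
    omega
  set W := wedgeList (R := R) (B.map e) with hW
  set η := W * wedgeList (R := R) (LJ.map e) with hη
  have hη' : η = wedgeList (R := R) ((B ++ LJ).map e) := by
    rw [List.map_append, wedgeList_append]
  have hBJn : (B ++ LJ).Nodup := by
    refine List.nodup_append'.mpr ⟨hBn, hLJn, fun i h h' => ?_⟩
    exact (memB i).mp h ((memJ i).mp h')
  obtain ⟨u, hu, hηtop⟩ := exists_wedgeList_eq_wedgeTop e (B ++ LJ) hBJn
    (by rw [List.length_append]; omega)
  rw [← hη'] at hηtop
  -- Multiplication by `W` kills the monomials not supported in J, and the induction hypothesis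
  -- removes the proper nonempty subsets.
  have hWx : W * x = c ∅ • W + c J • η := by
    rw [hx, Finset.mul_sum, Fintype.sum_eq_add ∅ J (Ne.symm hJ)]
    · rw [mul_smul_comm, mul_smul_comm, basis_empty, mul_one, hbJ]
    · rintro S ⟨hS0, hSJ⟩
      by_cases hsub : S ⊆ J
      · rw [ih S (Finset.ssubset_iff_subset_ne.mpr ⟨hsub, hSJ⟩) hS0, zero_smul, mul_zero]
      · obtain ⟨i, hiS, hiJ⟩ := Finset.not_subset.mp hsub
        obtain ⟨LS, -, hLS, hbS⟩ := exists_wedgeList_eq_basis e S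
        rw [hbS, mul_smul_comm, hW, wedgeList_mul_wedgeList_of_mem (m := e i), smul_zero]
        · exact List.mem_map_of_mem ((memB i).mpr hiJ)
        · exact List.mem_map_of_mem (by rwa [← List.mem_toFinset, hLS])
  -- Half of J: the test form then has degree 2m + (n − 2m) = n.
  set A := LJ.take m with hA
  have memA : ∀ i ∈ A, i ∈ J := fun i hi => (memJ i).mp (List.mem_of_mem_take hi)
  have lenA : A.length = m := by rw [hA, List.length_take]; omega
  have hABn : (A ++ B).Nodup := by
    refine List.nodup_append'.mpr ⟨hLJn.sublist (List.take_sublist _ _), hBn, fun i h h' => ?_⟩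
    exact (memB i).mp h' (memA i h)
  -- The indices of `A` are absent from `W` and present in `η`, so the half weights act by −1/2 and
  -- by +1/2 respectively.
  have hAW : (A.map (halfWeight e)).prod W = (-⅟2 : R) ^ m • W := by
    rw [list_prod_apply_eq_smul _ (-⅟2 : R), lenA]
    intro i hi
    rw [halfWeight_apply, contr_wedgeList_map e fun h => (memB i).mp h (memA i hi), mul_zero,
      zero_sub, neg_smul]
  have hAη : (A.map (halfWeight e)).prod η = (⅟2 : R) ^ m • η := by
    rw [list_prod_apply_eq_smul _ (⅟2 : R), lenA]
    intro i hi
    have h1 : ExteriorAlgebra.ι R (e i) * η = 0 := by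
      rw [hηtop, mul_smul_comm, ι_mul_wedgeTop, smul_zero]
    have h2 := contr_ι_mul (e.coord i) (e i) η
    rw [h1, map_zero, Module.Basis.coord_apply, Module.Basis.repr_self, Finsupp.single_eq_same,
      one_smul] at h2
    rw [halfWeight_apply, ← sub_eq_zero.mp h2.symm, sub_eq_iff_eq_add, ← add_smul,
      invOf_two_add_invOf_two, one_smul]
  have hmap : ExteriorAlgebra.algebraMapInv x = c ∅ := by
    rw [hx, map_sum, Fintype.sum_eq_single ∅]
    · rw [map_smul, basis_empty, map_one, smul_eq_mul, mul_one]
    · intro S hS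
      rw [map_smul, algebraMapInv_basis e hS, smul_zero]
  set rev := CliffordAlgebra.reverse (Q := (0 : QuadraticForm R H)) with hrev
  have hrevη : rev x * η = c ∅ • η := by
    rw [hηtop, mul_smul_comm, mul_wedgeTop, algebraMapInv_reverse, hmap, smul_comm]
  -- This comes from reversing `hWx`, so no expansion of the reversal of `x` is needed.
  have hrevW : rev x * W = c ∅ • W + ((-1) ^ B.length.choose 2 * (-1) ^ n.choose 2 * c J) • η := by
    have h1 : rev W = (-1 : R) ^ B.length.choose 2 • W := by
      rw [hW, hrev, reverse_wedgeList, List.length_map]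
    have h2 : rev η = (-1 : R) ^ n.choose 2 • η := by
      rw [hη', hrev, reverse_wedgeList, List.length_map, List.length_append]
      congr 3
      omega
    have h3 : (-1 : R) ^ B.length.choose 2 * (-1 : R) ^ B.length.choose 2 = 1 := by
      rw [← mul_pow]; simp
    have h4 : rev (W * x) = rev x * rev W := CliffordAlgebra.reverse.map_mul W x
    rw [hWx, map_add, map_smul, map_smul, h1, h2, mul_smul_comm] at h4
    have h5 := congrArg (fun z => (-1 : R) ^ B.length.choose 2 • z) h4
    simp only [smul_add, smul_smul, h3, one_smul] at h5
    rw [← h5]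
    congr 2
    · linear_combination c ∅ * h3
    · ring
  obtain ⟨j, hj⟩ := Finset.nonempty_iff_ne_empty.mpr hJ
  have hγW : spinorForm e s (fock e hf.right W s) = 0 := by
    have h1 : W = contr (e.coord j) (ExteriorAlgebra.ι R (e j) * W) := by
      rw [contr_ι_mul, contr_wedgeList_map e fun h => (memB j).mp h hj]
      simp
    rw [h1]
    exact spinorForm_fock_contr e hf hy hs j _
  have hγη : spinorForm e s (fock e hf.right η s) ≠ 0 := by
    rw [hηtop, map_smul, LinearMap.smul_apply, map_smul, smul_eq_mul]
    exact mul_ne_zero hu.ne_zero htop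
  have hlen : (testList l v A B).length = n := by rw [length_testList, lenA]; omega
  have hmem : ∃ i, l i ∈ testList l v A B := by
    have h0 : 0 < A.length := by omega
    refine ⟨A[0], ?_⟩
    rw [testList, List.mem_append]
    exact Or.inl (List.mem_flatMap.mpr ⟨A[0], List.getElem_mem h0, by simp⟩)
  have hfin := hP (testList l v A B) hlen hmem
  rw [wedgeAct_testList_fock e hf hs A B hABn, map_smul, spinorForm_fock, ← Module.End.mul_apply,
    ← map_mul, ← hrev, ← hW, hWx, map_add, map_smul (A.map (halfWeight e)).prod,
    map_smul (A.map (halfWeight e)).prod, hAW, hAη, mul_add, mul_smul_comm, mul_smul_comm,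
    mul_smul_comm, mul_smul_comm, hrevη, hrevW] at hfin
  simp only [map_add, map_smul, LinearMap.add_apply, LinearMap.smul_apply, smul_eq_mul, hγW] at hfin
  -- The two contributions of c_∅ c_J agree by this sign, so their sum is twice either one; 2 is
  -- invertible.
  have hsign := neg_one_pow_choose (R := R) B.length m
  rw [lenB] at hsign
  have hpow : (-⅟2 : R) ^ m = (-1) ^ m * (⅟2) ^ m := by rw [← neg_one_mul, mul_pow]
  rw [hpow] at hfin
  have hfin' : y ^ A.length * ((⅟2) ^ m * (c ∅ * (2 * (c J *
      spinorForm e s (fock e hf.right η s))))) = 0 := by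
    rw [← hfin]
    linear_combination (-(y ^ A.length * ((⅟2) ^ m * (c ∅ * (c J *
      spinorForm e s (fock e hf.right η s)))))) * hsign
  have h2 : (2 : R) ≠ 0 := (isUnit_of_invertible (2 : R)).ne_zero
  have h2' : (⅟2 : R) ≠ 0 := (isUnit_of_invertible (⅟2 : R)).ne_zero
  have := (mul_eq_zero.mp hfin').resolve_left (pow_ne_zero _ hy)
  have := (mul_eq_zero.mp this).resolve_left (pow_ne_zero _ h2')
  have := (mul_eq_zero.mp this).resolve_left hc0
  have := (mul_eq_zero.mp this).resolve_left h2
  exact (mul_eq_zero.mp this).resolve_right hγη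

theorem fock_wedgeList_mem_evenOdd (e : Module.Basis (Fin n) R H)
    (hv : ∀ i j, LinearMap.dualProd R H (v i) (v j) = 0) {k : ZMod 2} {s : ExteriorAlgebra R H}
    (hs : s ∈ CliffordAlgebra.evenOdd (0 : QuadraticForm R H) k) (L : List (Fin n)) :
    fock e hv (wedgeList (R := R) (L.map e)) s ∈
      CliffordAlgebra.evenOdd (0 : QuadraticForm R H) (k + L.length) := by
  induction L with
  | nil => simpa using hs
  | cons i L ih =>
    rw [List.map_cons, wedgeList_cons, fock_ι_basis_mul, List.length_cons, Nat.cast_succ,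
      ← add_assoc]
    exact spinorAct_mem_evenOdd _ ih

/-- An odd spinor whose square is the square of a pure spinor up to a scalar is itself pure. -/
theorem spinorAct_eq_zero_of_spinorP [IsDomain R] [UniqueFactorizationMonoid R]
    (e : Module.Basis (Fin n) R H) (hf : IsFrame l v y) (hy : y ≠ 0) {s a : ExteriorAlgebra R H}
    (hs0 : s ≠ 0) (hs : ∀ i, spinorAct R H (l i) s = 0) (hp : IsPrimitive (R := R) s)
    (hsodd : s ∈ VOdd R H) (haodd : a ∈ VOdd R H)
    (hP : ∀ u : Fin n → Hyp R H, (∃ i j, u j = l i) →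
      spinorP e a a (exteriorPower.ιMulti R n u) = 0)
    (hP0 : spinorP e a a (exteriorPower.ιMulti R n v) ≠ 0) (i : Fin n) :
    spinorAct R H (l i) a = 0 := by
  classical
  have : Module.Free R (ExteriorAlgebra R H) := Module.Free.of_basis e.ExteriorAlgebra
  obtain ⟨r, x₀, hr, hx₀⟩ := exists_smul_eq_fock e hf hy hs0 hs a
  -- Both `s` and `a` are odd, so the odd monomials contribute nothing to `r • a` and their
  -- coefficients may be replaced by zero.
  set c : Finset (Fin n) → R := fun S => if Odd S.card then 0 else e.ExteriorAlgebra.repr x₀ S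
    with hc
  set x := ∑ S, c S • e.ExteriorAlgebra S with hx
  have hxa : r • a = fock e hf.right x s := by
    have hsplit : x₀ - x = ∑ S ∈ Finset.univ.filter (fun S : Finset (Fin n) => Odd S.card),
        e.ExteriorAlgebra.repr x₀ S • e.ExteriorAlgebra S := by
      conv_lhs => rw [← e.ExteriorAlgebra.sum_repr x₀, hx, ← Finset.sum_sub_distrib]
      rw [Finset.sum_filter]
      refine Finset.sum_congr rfl fun S _ => ?_
      by_cases h : Odd S.card <;> simp [hc, h]
    have hone : ∀ k : ℕ, Odd k → (1 + (k : ZMod 2)) = 0 := fun k hk => by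
      rw [(ZMod.natCast_eq_one_iff_odd).mpr hk]; decide
    have heven : ∀ k : ℕ, ¬ Odd k → (1 + (k : ZMod 2)) = 1 := fun k hk => by
      rw [(ZMod.natCast_eq_zero_iff_even).mpr (Nat.not_odd_iff_even.mp hk), add_zero]
    have h0 : fock e hf.right (x₀ - x) s ∈ VEven R H := by
      rw [hsplit, map_sum, LinearMap.sum_apply]
      refine Submodule.sum_mem _ fun S hS => ?_
      obtain ⟨L, hLn, hL, hb⟩ := exists_wedgeList_eq_basis e S
      rw [map_smul, LinearMap.smul_apply, hb]
      refine Submodule.smul_mem _ _ ?_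
      have h1 := fock_wedgeList_mem_evenOdd e hf.right hsodd L
      rwa [hone _ (by rw [← List.toFinset_card_of_nodup hLn, hL]; exact (Finset.mem_filter.mp hS).2)]
        at h1
    have h1 : fock e hf.right (x₀ - x) s ∈ VOdd R H := by
      rw [map_sub, LinearMap.sub_apply, ← hx₀]
      refine Submodule.sub_mem _ (Submodule.smul_mem _ _ haodd) ?_
      rw [hx, map_sum, LinearMap.sum_apply]
      refine Submodule.sum_mem _ fun S _ => ?_
      by_cases hS : Odd S.card
      · simp [hc, hS]
      obtain ⟨L, hLn, hL, hb⟩ := exists_wedgeList_eq_basis e S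
      rw [map_smul, LinearMap.smul_apply, hb]
      refine Submodule.smul_mem _ _ ?_
      have h1 := fock_wedgeList_mem_evenOdd e hf.right hsodd L
      rwa [heven _ (by rwa [← List.toFinset_card_of_nodup hLn, hL])] at h1
    have h2 := eq_zero_of_mem_even_of_mem_odd h0 h1
    rw [map_sub, LinearMap.sub_apply, ← hx₀] at h2
    exact sub_eq_zero.mp h2
  have htop : spinorForm e s (fock e hf.right (wedgeTop e) s) ≠ 0 := fun h =>
    not_dvd_spinorForm_fock_wedgeTop e hf (π := 0) (Or.inl rfl) (by rwa [zero_dvd_iff]) hs0 hs hp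
      (by rw [h])
  have hPL : ∀ L : List (Hyp R H), (hL : L.length = n) →
      spinorForm e (fock e hf.right x s) (wedgeAct R H (wedgeList L) (fock e hf.right x s)) =
        r * (r * spinorP e a a (exteriorPower.ιMulti R n fun i => L.get (i.cast hL.symm))) := by
    intro L hL
    rw [spinorP_ιMulti_get e a a L hL, ← hxa]
    simp only [map_smul, LinearMap.smul_apply, smul_eq_mul]
  have hmap : ExteriorAlgebra.algebraMapInv x = c ∅ := by
    rw [hx, map_sum, Fintype.sum_eq_single ∅]
    · rw [map_smul, basis_empty, map_one, smul_eq_mul, mul_one]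
    · intro S hS
      rw [map_smul, algebraMapInv_basis e hS, smul_zero]
  -- On the form v₁ ∧ ⋯ ∧ vₙ only the scalar part of `x` survives, and `hP0` says that this value is
  -- nonzero.
  have hc0 : c ∅ ≠ 0 := by
    intro h0
    have hlen : (testList l v [] (List.finRange n)).length = n := by simp [length_testList]
    have h1 := hPL _ hlen
    have h2 : (fun i : Fin n => (testList l v [] (List.finRange n)).get (i.cast hlen.symm)) = v := by
      funext i
      simp [testList]
      rfl
    rw [h2, wedgeAct_testList_fock e hf hs [] (List.finRange n) (by simpa using List.nodup_finRange n)]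
      at h1
    have h3 : wedgeList (R := R) ((List.finRange n).map e) * x = 0 := by
      rw [wedgeTop_mul e x, hmap, h0, zero_smul]
    rw [h3] at h1
    simp only [map_zero, LinearMap.zero_apply, smul_zero] at h1
    exact mul_ne_zero hr (mul_ne_zero hr hP0) h1.symm
  have hcoef := fock_coeff_eq_zero e hf hy hs htop c (fun S hS => by simp [hc, hS]) hc0 hx
    (fun L hL ⟨i, hi⟩ => by
      rw [hPL L hL, hP _ ?_, mul_zero, mul_zero]
      obtain ⟨j, hj⟩ := List.get_of_mem hi
      exact ⟨i, j.cast hL, by simpa using hj⟩)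
  have hx1 : x = c ∅ • 1 := by
    rw [hx, Fintype.sum_eq_single ∅, basis_empty]
    intro S hS
    rw [hcoef S hS, zero_smul]
  rw [hx1, map_smul, map_one, LinearMap.smul_apply, Module.End.one_apply] at hxa
  have h := congrArg (spinorAct R H (l i)) hxa
  rw [map_smul, map_smul, hs, smul_zero] at h
  exact (smul_eq_zero.mp h).resolve_left hr

end Purity

/-! ### Linear algebra modulo an element that is zero or prime. -/

section ModularRank

variable {R M N P : Type*} [CommRing R] [AddCommGroup M] [Module R M] [AddCommGroup N] [Module R N]
  [AddCommGroup P] [Module R P]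

theorem finrank_range_add_finrank_ker_of_isDomain [IsDomain R] [Module.Finite R M]
    (f : M →ₗ[R] N) :
    Module.finrank R (LinearMap.range f) + Module.finrank R (LinearMap.ker f) =
      Module.finrank R M := by
  rw [← Submodule.finrank_quotient_add_finrank (LinearMap.ker f), f.quotKerEquivRange.finrank_eq]

/-- A family of vectors is linearly independent modulo the element `π` of the ring. -/
def LinIndepMod {ι : Type*} [Fintype ι] (π : R) (x : ι → M) : Prop :=
  ∀ (c : ι → R) (z : M), ∑ i, c i • x i = π • z → ∀ i, π ∣ c i

theorem isPrime_span_of_zero_or_prime [IsDomain R] {π : R} (hπ : π = 0 ∨ Prime π) :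
    (Ideal.span {π}).IsPrime := by
  rcases hπ with rfl | hπ
  · rw [Ideal.span_singleton_eq_bot.mpr rfl]
    exact Ideal.isPrime_bot
  · exact (Ideal.span_singleton_prime hπ.ne_zero).mpr hπ

theorem mk_eq_zero_iff_dvd {π x : R} : Ideal.Quotient.mk (Ideal.span {π}) x = 0 ↔ π ∣ x := by
  rw [Ideal.Quotient.eq_zero_iff_mem, Ideal.mem_span_singleton]

/-- The coordinates of a vector modulo `π`. -/
def redCoord {ι : Type*} (b : Module.Basis ι R M) (π : R) (x : M) (i : ι) :
    R ⧸ Ideal.span {π} := Ideal.Quotient.mk _ (b.repr x i)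

theorem redCoord_sum {ι κ : Type*} [Fintype κ] (b : Module.Basis ι R M) (π : R) (c : κ → R)
    (x : κ → M) : redCoord b π (∑ k, c k • x k) =
      ∑ k, Ideal.Quotient.mk (Ideal.span {π}) (c k) • redCoord b π (x k) := by
  funext i
  simp [redCoord, Finsupp.finsetSum_apply]

theorem redCoord_smul {ι : Type*} (b : Module.Basis ι R M) (π : R) (x : M) :
    redCoord b π (π • x) = 0 := by
  funext i
  simp [redCoord]

theorem redCoord_eq_zero {ι : Type*} [Finite ι] (b : Module.Basis ι R M) {π : R} {x : M}
    (h : redCoord b π x = 0) : ∃ z, x = π • z :=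
  exists_eq_smul_of_dvd b fun i => mk_eq_zero_iff_dvd.mp (congrFun h i)

theorem redCoord_surjective {ι : Type*} [Fintype ι] (b : Module.Basis ι R M) (π : R) :
    Function.Surjective (redCoord b π) := by
  intro x
  choose c hc using fun i => Ideal.Quotient.mk_surjective (x i)
  refine ⟨∑ i, c i • b i, ?_⟩
  funext i
  rw [redCoord, b.repr_sum_self, hc]

/-- The reduction of a linear map modulo `π`, in coordinates. -/
def redMap {ι κ : Type*} [Fintype ι] (b : Module.Basis ι R M) (b' : Module.Basis κ R N) (π : R)
    (f : M →ₗ[R] N) :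
    (ι → R ⧸ Ideal.span {π}) →ₗ[R ⧸ Ideal.span {π}] (κ → R ⧸ Ideal.span {π}) :=
  Fintype.linearCombination _ fun i => redCoord b' π (f (b i))

theorem redMap_redCoord {ι κ : Type*} [Fintype ι] (b : Module.Basis ι R M)
    (b' : Module.Basis κ R N) (π : R) (f : M →ₗ[R] N) (x : M) :
    redMap b b' π f (redCoord b π x) = redCoord b' π (f x) := by
  conv_rhs => rw [← b.sum_repr x, map_sum]
  simp only [map_smul]
  rw [redCoord_sum, redMap, Fintype.linearCombination_apply]
  rfl

/-- The hypothesis `h` is the exactness in the middle, in a form that descends to the reduction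
modulo π. -/
theorem ker_redMap_le {α β γ : Type*} [Fintype α] [Fintype β] [Finite γ]
    (bP : Module.Basis α R P) (bM : Module.Basis β R M) (bN : Module.Basis γ R N)
    {π : R} (f : P →ₗ[R] M) (g : M →ₗ[R] N)
    (h : ∀ x z, g x = π • z → ∃ b x', x = f b + π • x') :
    LinearMap.ker (redMap bM bN π g) ≤ LinearMap.range (redMap bP bM π f) := by
  intro x hx
  obtain ⟨x, rfl⟩ := redCoord_surjective bM π x
  rw [LinearMap.mem_ker, redMap_redCoord] at hx
  obtain ⟨z, hz⟩ := redCoord_eq_zero bN hx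
  obtain ⟨p, x', rfl⟩ := h x z hz
  refine ⟨redCoord bP π p, ?_⟩
  rw [redMap_redCoord]
  funext i
  simp [redCoord]

theorem exists_linIndepMod_of_le_finrank {β γ : Type*} [Fintype β]
    (bM : Module.Basis β R M) (bN : Module.Basis γ R N) {π : R} (g : M →ₗ[R] N) {n : ℕ}
    (hn : n ≤ Module.finrank (R ⧸ Ideal.span {π}) (LinearMap.range (redMap bM bN π g))) :
    ∃ ψ : Fin n → M, LinIndepMod π (g ∘ ψ) := by
  obtain ⟨y, hy⟩ := exists_linearIndependent_of_le_finrank hn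
  have hy' := hy.map' (Submodule.subtype _) (Submodule.ker_subtype _)
  choose x hx using fun i => (y i).2
  choose ψ hψ using fun i => redCoord_surjective bM π (x i)
  refine ⟨ψ, fun c z hcz i => ?_⟩
  have h4 := congrArg (redCoord bN π) hcz
  rw [redCoord_sum, redCoord_smul] at h4
  refine mk_eq_zero_iff_dvd.mp (Fintype.linearIndependent_iff.mp hy'
    (fun i => Ideal.Quotient.mk _ (c i)) ?_ i)
  rw [← h4]
  refine Finset.sum_congr rfl fun i _ => ?_
  rw [Function.comp_apply, Function.comp_apply, ← redMap_redCoord bM, hψ, hx, Submodule.subtype_apply]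

/-- Over the domain R/π the kernel of the reduced `g` has rank at most that of `P`, so its image has
rank at least `n`; independent vectors of the image are lifted. -/
theorem exists_linIndepMod_of_basis [IsDomain R] {α β γ : Type*} [Fintype α] [Fintype β] [Finite γ]
    (bP : Module.Basis α R P) (bM : Module.Basis β R M) (bN : Module.Basis γ R N)
    {π : R} (hπ : π = 0 ∨ Prime π) (f : P →ₗ[R] M) (g : M →ₗ[R] N)
    (h : ∀ x z, g x = π • z → ∃ b x', x = f b + π • x') {n : ℕ}
    (hn : n + Fintype.card α ≤ Fintype.card β) :
    ∃ ψ : Fin n → M, LinIndepMod π (g ∘ ψ) := by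
  have : (Ideal.span {π}).IsPrime := isPrime_span_of_zero_or_prime hπ
  have h1 := finrank_range_add_finrank_ker_of_isDomain (redMap bM bN π g)
  have h2 := Submodule.finrank_mono (ker_redMap_le bP bM bN f g h)
  have h3 := LinearMap.finrank_range_le (redMap bP bM π f)
  rw [Module.finrank_pi] at h1 h3
  refine exists_linIndepMod_of_le_finrank bM bN g ?_
  omega

theorem exists_linIndepMod [IsDomain R] [Module.Free R M] [Module.Finite R M] [Module.Free R N]
    [Module.Finite R N] [Module.Free R P] [Module.Finite R P] {π : R} (hπ : π = 0 ∨ Prime π)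
    (f : P →ₗ[R] M) (g : M →ₗ[R] N)
    (h : ∀ x z, g x = π • z → ∃ b x', x = f b + π • x') {n : ℕ}
    (hn : n + Module.finrank R P ≤ Module.finrank R M) :
    ∃ ψ : Fin n → M, LinIndepMod π (g ∘ ψ) := by
  refine exists_linIndepMod_of_basis (Module.Free.chooseBasis R P) (Module.Free.chooseBasis R M)
    (Module.Free.chooseBasis R N) hπ f g h ?_
  rwa [← Module.finrank_eq_card_basis (Module.Free.chooseBasis R M),
    ← Module.finrank_eq_card_basis (Module.Free.chooseBasis R P)]

/-- A determinant that vanishes in the domain R/π yields a nontrivial relation modulo π. -/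
theorem LinIndepMod.not_dvd_det [IsDomain R] {ι : Type*} [Fintype ι] [DecidableEq ι] {π : R}
    (hπ : π = 0 ∨ Prime π) {x : ι → M} (hx : LinIndepMod π x) (b : Module.Basis ι R M) :
    ¬ π ∣ b.det x := by
  have : (Ideal.span {π}).IsPrime := isPrime_span_of_zero_or_prime hπ
  intro h
  rw [← mk_eq_zero_iff_dvd, Module.Basis.det_apply, RingHom.map_det,
    ← Matrix.exists_mulVec_eq_zero_iff] at h
  obtain ⟨w, hw, hw'⟩ := h
  choose c hc using fun i => Ideal.Quotient.mk_surjective (w i)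
  obtain ⟨z, hz⟩ := redCoord_eq_zero b (π := π) (x := ∑ i, c i • x i) (by
    rw [redCoord_sum, ← hw']
    funext i
    simp [Matrix.mulVec, dotProduct, redCoord, hc, Module.Basis.toMatrix_apply, mul_comm])
  refine hw (funext fun i => ?_)
  rw [← hc, Pi.zero_apply, mk_eq_zero_iff_dvd]
  exact hx c z hz i

/-- These are the rows of a left inverse over the fraction field; `d` clears the denominators. -/
theorem exists_functionals_of_linearIndependent [IsDomain R] {ι : Type*} [Fintype ι] {n : ℕ}
    {x : Fin n → ι → R} (hx : LinearIndependent R x) :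
    ∃ (t : Fin n → ι → R) (d : R), d ≠ 0 ∧
      ∀ i j, ∑ k, t j k * x i k = if i = j then d else 0 := by
  classical
  let K := FractionRing R
  let x' : Fin n → ι → K := fun i k => algebraMap R K (x i k)
  have hx' : LinearIndependent K x' := by
    rw [← LinearIndependent.iff_fractionRing R K]
    exact hx.map' (LinearMap.compLeft (Algebra.linearMap R K) ι) (by
      rw [LinearMap.ker_eq_bot]
      exact Function.Injective.comp_left (IsFractionRing.injective R K))
  obtain ⟨g, hg⟩ := LinearMap.exists_leftInverse_of_injective (Fintype.linearCombination K x')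
    (LinearMap.ker_eq_bot.mpr (linearIndependent_iff_injective_fintypeLinearCombination.mp hx'))
  obtain ⟨d, hd⟩ := IsLocalization.exist_integer_multiples_of_finite (nonZeroDivisors R)
    (fun p : Fin n × ι => g (Pi.single p.2 1) p.1)
  choose t ht using hd
  refine ⟨fun j k => t (j, k), d, nonZeroDivisors.ne_zero d.2, fun i j => ?_⟩
  apply IsFractionRing.injective R K
  have h1 : g (x' i) = Pi.single i 1 := by
    have := LinearMap.congr_fun hg (Pi.single i 1)
    simpa using this
  have h2 : x' i = ∑ k, x' i k • (Pi.single k 1 : ι → K) := by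
    funext k
    simp [Finset.sum_apply, Pi.single_apply]
  rw [h2, map_sum] at h1
  have h3 := congrFun h1 j
  simp only [map_smul, Finset.sum_apply, Pi.smul_apply, smul_eq_mul] at h3
  rw [map_sum]
  simp only [map_mul, ht, Algebra.smul_def]
  calc ∑ k, algebraMap R K d * g (Pi.single k 1) j * algebraMap R K (x i k)
      = algebraMap R K d * ∑ k, x' i k * g (Pi.single k 1) j := by
        rw [Finset.mul_sum]
        exact Finset.sum_congr rfl fun k _ => by simp only [x']; ring
    _ = _ := by
        rw [h3]
        by_cases hij : i = j
        · subst hij; simp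
        · simp [hij, Ne.symm hij]

theorem LinIndepMod.exists_functionals [IsDomain R] [Module.Free R M] [Module.Finite R M] {π : R}
    (hπ : π = 0 ∨ Prime π) {n : ℕ} {x : Fin n → M} (hx : LinIndepMod π x) :
    ∃ (φ : Fin n → Module.Dual R M) (y : R), ¬ π ∣ y ∧
      ∀ i j, φ j (x i) = if i = j then y else 0 := by
  classical
  have : (Ideal.span {π}).IsPrime := isPrime_span_of_zero_or_prime hπ
  let b := Module.Free.chooseBasis R M
  have hlin : LinearIndependent (R ⧸ Ideal.span {π}) fun i => redCoord b π (x i) := by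
    rw [Fintype.linearIndependent_iff]
    intro w hw i
    choose c hc using fun i => Ideal.Quotient.mk_surjective (w i)
    obtain ⟨z, hz⟩ := redCoord_eq_zero b (π := π) (x := ∑ i, c i • x i) (by
      rw [redCoord_sum, ← hw]
      simp only [hc])
    rw [← hc, mk_eq_zero_iff_dvd]
    exact hx c z hz i
  obtain ⟨t, d, hd, htd⟩ := exists_functionals_of_linearIndependent hlin
  choose T hT using fun j => fun k => Ideal.Quotient.mk_surjective (t j k)
  let φ : Fin n → Module.Dual R M := fun j => b.constr R (T j)
  let X : Matrix (Fin n) (Fin n) R := Matrix.of fun i j => φ j (x i)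
  have hX : X.map (Ideal.Quotient.mk (Ideal.span {π})) = d • (1 : Matrix (Fin n) (Fin n) _) := by
    ext i j
    have h1 : φ j (x i) = ∑ k, T j k * b.repr (x i) k := by
      simp only [φ, Module.Basis.constr_apply_fintype, smul_eq_mul]
      exact Finset.sum_congr rfl fun k _ => by rw [mul_comm]; rfl
    have h2 := htd i j
    simp only [← hT] at h2
    have h3 : X i j = φ j (x i) := rfl
    rw [Matrix.map_apply, h3, h1, map_sum, Matrix.smul_apply, Matrix.one_apply]
    simp only [map_mul]
    refine h2.trans ?_
    by_cases hij : i = j <;> simp [hij]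
  -- The lifted functionals are dual to `x` only modulo π. The adjugate makes the pairing exactly
  -- scalar, with factor congruent to dⁿ modulo π.
  refine ⟨fun j => ∑ k, X.adjugate k j • φ k, X.det, ?_, fun i j => ?_⟩
  · rw [← mk_eq_zero_iff_dvd, RingHom.map_det, RingHom.mapMatrix_apply, hX, Matrix.det_smul,
      Matrix.det_one, mul_one]
    exact pow_ne_zero _ hd
  · have h1 := congrFun (congrFun (Matrix.mul_adjugate X) i) j
    rw [Matrix.mul_apply, Matrix.smul_apply, Matrix.one_apply, smul_eq_mul, mul_ite, mul_one,
      mul_zero] at h1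
    rw [← h1, LinearMap.sum_apply]
    exact Finset.sum_congr rfl fun k _ => by
      rw [LinearMap.smul_apply, smul_eq_mul, mul_comm]; rfl

end ModularRank

/-! ### Alternating forms that vanish along a submodule. -/

section Alternating

variable {R M N : Type*} [CommRing R] [IsDomain R] [AddCommGroup M] [Module R M] [AddCommGroup N]
  [Module R N] [Module.IsTorsionFree R N] {n : ℕ}

/-- Up to torsion the form lives on the quotient by `S`, which the n vectors `w` span, so its value
at `w` determines it. -/
theorem alternatingMap_eq_zero (Δ : M [⋀^Fin n]→ₗ[R] N) (S : Submodule R M)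
    (hS : ∀ u : Fin n → M, (∃ i, u i ∈ S) → Δ u = 0) (w : Fin n → M) (hw : Δ w = 0)
    (hM : ∀ x, ∃ r : R, r ≠ 0 ∧ ∃ c : Fin n → R, ∃ z ∈ S, r • x = ∑ j, c j • w j + z) :
    Δ = 0 := by
  classical
  have hspan : Δ.compLinearMap (Fintype.linearCombination R w) = 0 := by
    refine Module.Basis.ext_alternating (Pi.basisFun R (Fin n)) fun σ hσ => ?_
    have h1 : (fun i => Fintype.linearCombination R w (Pi.basisFun R (Fin n) (σ i))) =
        w ∘ Equiv.ofBijective σ (Finite.injective_iff_bijective.mp hσ) := by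
      funext i
      simp
    rw [AlternatingMap.compLinearMap_apply, AlternatingMap.zero_apply]
    refine (congrArg Δ h1).trans ?_
    rw [AlternatingMap.map_perm, hw, smul_zero]
  ext u
  choose r hr c z hz hu using fun i => hM (u i)
  have h1 := Δ.toMultilinearMap.map_smul_univ r u
  have h2 : (fun i => r i • u i) = (fun i => ∑ j, c i j • w j) + z := funext fun i => hu i
  rw [h2, MultilinearMap.map_add_univ, Finset.sum_eq_single Finset.univ, Finset.piecewise_univ]
    at h1
  · have h3 := congrArg (fun f : (Fin n → R) [⋀^Fin n]→ₗ[R] N => f c) hspan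
    have h4 : Δ (fun i => ∑ j, c i j • w j) = 0 := h3
    have h5 : (∏ i, r i) • Δ u = 0 := h1.symm.trans h4
    exact (smul_eq_zero.mp h5).resolve_left (Finset.prod_ne_zero_iff.mpr fun i _ => hr i)
  · intro s _ hs
    obtain ⟨i, hi⟩ : ∃ i, i ∉ s := by
      by_contra! h
      exact hs (Finset.eq_univ_of_forall h)
    refine hS _ ⟨i, ?_⟩
    rw [Finset.piecewise_eq_of_notMem _ _ _ hi]
    exact hz i
  · simp

end Alternating

/-! ### Expansion of a vector along a frame. -/

section FrameExpansion

variable {R H : Type*} [CommRing R] [AddCommGroup H] [Module R H] {n : ℕ}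
  {l v : Fin n → Hyp R H} {y : R}

theorem IsFrame.pair' (hf : IsFrame l v y) (i j : Fin n) :
    LinearMap.dualProd R H (v i) (l j) = if i = j then y else 0 := by
  rw [dualProd_comm, hf.pair]
  simp only [eq_comm]

theorem IsFrame.linearIndependent [IsDomain R] (hf : IsFrame l v y) (hy : y ≠ 0) :
    LinearIndependent R (Sum.elim l v) := by
  rw [Fintype.linearIndependent_iff]
  intro g hg
  rw [Fintype.sum_sum_type] at hg
  simp only [Sum.elim_inl, Sum.elim_inr] at hg
  rintro (i | i)
  · have := congrArg (LinearMap.dualProd R H (v i)) hg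
    simp only [map_add, map_sum, map_smul, map_zero, smul_eq_mul, hf.right, hf.pair', mul_ite, mul_zero,
      Finset.sum_const_zero, Finset.sum_ite_eq, Finset.mem_univ, if_true, add_zero] at this
    exact (mul_eq_zero.mp this).resolve_right hy
  · have := congrArg (LinearMap.dualProd R H (l i)) hg
    simp only [map_add, map_sum, map_smul, map_zero, smul_eq_mul, hf.left, hf.pair, mul_ite, mul_zero,
      Finset.sum_const_zero, Finset.sum_ite_eq, Finset.mem_univ, if_true, zero_add] at this
    exact (mul_eq_zero.mp this).resolve_right hy

theorem finrank_hyp [StrongRankCondition R] [Module.Free R H] [Module.Finite R H] :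
    Module.finrank R (Hyp R H) = Module.finrank R H + Module.finrank R H := by
  rw [Module.finrank_prod, Module.finrank_linearMap, Module.finrank_self, mul_one]

/-- Both sides agree on the 2n frame vectors. These are independent and span a submodule of full
rank, and the module is torsion-free. -/
theorem IsFrame.smul_eq [IsDomain R] [Module.Free R H] [Module.Finite R H] (hf : IsFrame l v y)
    (hy : y ≠ 0) (hn : Module.finrank R H = n) (x : Hyp R H) :
    y • x = ∑ j, LinearMap.dualProd R H (l j) x • v j +
      ∑ j, LinearMap.dualProd R H (v j) x • l j := by
  classical
  let T : Hyp R H →ₗ[R] Hyp R H := ∑ j, (LinearMap.dualProd R H (l j)).smulRight (v j) +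
      ∑ j, (LinearMap.dualProd R H (v j)).smulRight (l j)
  have hT : ∀ x, T x = ∑ j, LinearMap.dualProd R H (l j) x • v j +
      ∑ j, LinearMap.dualProd R H (v j) x • l j := fun x => by
    simp [T, LinearMap.sum_apply]
  have hN : Submodule.span R (Set.range (Sum.elim l v)) ≤
      LinearMap.ker (y • LinearMap.id - T) := by
    rw [Submodule.span_le]
    rintro _ ⟨i | i, rfl⟩
    · simp [hT, hf.left, hf.pair']
    · simp [hT, hf.right, hf.pair]
  have hrank : Module.finrank R (Hyp R H) ≤
      Module.finrank R (Submodule.span R (Set.range (Sum.elim l v))) := by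
    rw [finrank_span_eq_card (hf.linearIndependent hy), finrank_hyp, hn]
    simp
  obtain ⟨r, hr, hx⟩ := exists_smul_mem_of_finrank_le _ hrank x
  have h := hN hx
  rw [LinearMap.mem_ker, map_smul] at h
  have h' := (smul_eq_zero.mp h).resolve_left hr
  rw [← hT]
  simpa [sub_eq_zero] using h'

theorem IsFrame.spinorAct_eq_zero [IsDomain R] [Module.Free R H] [Module.Finite R H]
    (hf : IsFrame l v y) (hy : y ≠ 0) (hn : Module.finrank R H = n) {s : ExteriorAlgebra R H}
    (hs : ∀ i, spinorAct R H (l i) s = 0) {x : Hyp R H}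
    (hx : ∀ i, LinearMap.dualProd R H (l i) x = 0) : spinorAct R H x s = 0 := by
  have h := congrArg (fun z => spinorAct R H z s) (hf.smul_eq hy hn x)
  simp only [hx, zero_smul, Finset.sum_const_zero, zero_add, map_smul, map_sum,
    LinearMap.smul_apply, LinearMap.sum_apply, hs, smul_zero] at h
  have := Module.Free.of_basis (Module.finBasis R H).ExteriorAlgebra
  exact (smul_eq_zero.mp h).resolve_left hy

end FrameExpansion

/-! ### The image of δ₃ as a saturated isotropic submodule, and its frames. -/

section Resolution

variable {R B₀ B₁ H : Type*} [CommRing R]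
  [AddCommGroup B₀] [Module R B₀] [AddCommGroup B₁] [Module R B₁]
  [AddCommGroup H] [Module R H] [Module.Free R H] [Module.Finite R H]
  {δ₁ : B₁ →ₗ[R] B₀} {δ₂ : Hyp R H →ₗ[R] B₁}

theorem dualProd_delta3 (δ₂ : Hyp R H →ₗ[R] B₁) (φ : Module.Dual R B₁) (x : Hyp R H) :
    LinearMap.dualProd R H (delta3 δ₂ φ) x = φ (δ₂ x) := by
  rw [dualProd_apply']
  have h2 : x.1 (delta3 δ₂ φ).2 = φ (δ₂ (x.1, 0)) :=
    Module.apply_evalEquiv_symm_apply R H x.1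
      ((δ₂.comp (LinearMap.inl R (Module.Dual R H) H)).dualMap φ)
  have h1 : (delta3 δ₂ φ).1 x.2 = φ (δ₂ (0, x.2)) := rfl
  rw [h1, h2, ← map_add, ← map_add]
  simp

theorem exists_dualProd_eq (φ : Module.Dual R (Hyp R H)) :
    ∃ v : Hyp R H, LinearMap.dualProd R H v = φ := by
  refine ⟨(φ ∘ₗ LinearMap.inr R _ H, (Module.evalEquiv R H).symm (φ ∘ₗ LinearMap.inl R _ H)), ?_⟩
  refine LinearMap.ext fun x => ?_
  rw [dualProd_apply', Module.apply_evalEquiv_symm_apply]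
  simp only [LinearMap.comp_apply, LinearMap.inr_apply, LinearMap.inl_apply]
  rw [← map_add]
  simp

/-- The orthogonal complement of im δ₃ is ker δ₂, which is im δ₃ by exactness. -/
theorem IsSelfDualResolution.mem_range_iff [Module.Free R B₁] [Module.Finite R B₁]
    (hB : IsSelfDualResolution δ₁ δ₂) {x : Hyp R H} :
    x ∈ LinearMap.range (delta3 δ₂) ↔ ∀ φ, LinearMap.dualProd R H (delta3 δ₂ φ) x = 0 := by
  simp only [dualProd_delta3]
  rw [Module.forall_dual_apply_eq_zero_iff]
  exact (hB.exact₂ x).symm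

theorem IsSelfDualResolution.isotropic [Module.Free R B₁] [Module.Finite R B₁]
    (hB : IsSelfDualResolution δ₁ δ₂) {x z : Hyp R H}
    (hx : x ∈ LinearMap.range (delta3 δ₂)) (hz : z ∈ LinearMap.range (delta3 δ₂)) :
    LinearMap.dualProd R H x z = 0 := by
  obtain ⟨φ, rfl⟩ := hx
  exact hB.mem_range_iff.mp hz φ

theorem IsSelfDualResolution.mem_range_of_smul [IsDomain R] [Module.Free R B₁] [Module.Finite R B₁]
    (hB : IsSelfDualResolution δ₁ δ₂) {x : Hyp R H} {r : R} (hr : r ≠ 0)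
    (h : r • x ∈ LinearMap.range (delta3 δ₂)) : x ∈ LinearMap.range (delta3 δ₂) := by
  rw [hB.mem_range_iff] at h ⊢
  intro φ
  have := h φ
  rw [map_smul] at this
  exact (smul_eq_zero.mp this).resolve_left hr

theorem delta3_delta4 (hB : IsSelfDualResolution δ₁ δ₂) (x : Module.Dual R B₀) :
    delta3 δ₂ (delta4 δ₁ x) = 0 := (hB.exact₃ _).mpr ⟨x, rfl⟩

/-- Exactness survives reduction modulo π: as δ₂ takes values in a torsion-free module, `z` itself
lies in im δ₃. -/
theorem IsSelfDualResolution.exists_of_delta3_eq_smul [IsDomain R]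
    (hB : IsSelfDualResolution δ₁ δ₂) [Module.Free R B₁]
    {π : R} (x : Module.Dual R B₁) (z : Hyp R H) (h : delta3 δ₂ x = π • z) :
    ∃ b x', x = delta4 δ₁ b + π • x' := by
  rcases eq_or_ne π 0 with rfl | hπ
  · rw [zero_smul] at h
    obtain ⟨b, hb⟩ := (hB.exact₃ x).mp h
    exact ⟨b, 0, by rw [hb, smul_zero, add_zero]⟩
  · have h2 : π • δ₂ z = 0 := by
      rw [← map_smul, ← h]
      exact (hB.exact₂ _).mpr ⟨x, rfl⟩
    obtain ⟨z', rfl⟩ := (hB.exact₂ z).mp ((smul_eq_zero.mp h2).resolve_left hπ)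
    rw [← map_smul, ← sub_eq_zero, ← map_sub] at h
    obtain ⟨b, hb⟩ := (hB.exact₃ _).mp h
    exact ⟨b, z', by rw [hb, sub_add_cancel]⟩

theorem IsSelfDualResolution.exists_of_delta4_eq_smul [IsDomain R]
    (hB : IsSelfDualResolution δ₁ δ₂) {π : R} (x : Module.Dual R B₀)
    (z : Module.Dual R B₁) (h : delta4 δ₁ x = π • z) : ∃ x', x = π • x' := by
  rcases eq_or_ne π 0 with rfl | hπ
  · rw [zero_smul] at h
    exact ⟨0, by rw [smul_zero]; exact hB.injective (by rw [h, map_zero])⟩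
  · have h2 : π • delta3 δ₂ z = 0 := by rw [← map_smul, ← h, delta3_delta4 hB]
    obtain ⟨b, rfl⟩ := (hB.exact₃ z).mp ((smul_eq_zero.mp h2).resolve_left hπ)
    exact ⟨b, hB.injective (by rw [h, map_smul])⟩

theorem IsSelfDualResolution.linIndepMod_sumElim [IsDomain R] {n r : ℕ} [Module.Free R B₁]
    (hB : IsSelfDualResolution δ₁ δ₂) {π : R} {ψ : Fin n → Module.Dual R B₁}
    (hψ : LinIndepMod π (delta3 δ₂ ∘ ψ)) (b : Module.Basis (Fin r) R (Module.Dual R B₀)) :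
    LinIndepMod π (Sum.elim ψ fun j => delta4 δ₁ (b j)) := by
  intro c z h
  rw [Fintype.sum_sum_type] at h
  simp only [Sum.elim_inl, Sum.elim_inr] at h
  have hl : ∀ i, π ∣ c (Sum.inl i) := by
    refine hψ (fun i => c (Sum.inl i)) (delta3 δ₂ z) ?_
    have := congrArg (delta3 δ₂) h
    simpa [delta3_delta4 hB] using this
  choose c' hc' using hl
  have h4 : delta4 δ₁ (∑ j, c (Sum.inr j) • b j) = π • (z - ∑ i, c' i • ψ i) := by
    rw [smul_sub, ← h, map_sum, Finset.smul_sum]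
    simp only [map_smul, smul_smul, ← hc']
    abel
  obtain ⟨x', hx'⟩ := hB.exists_of_delta4_eq_smul _ _ h4
  rintro (i | j)
  · exact ⟨c' i, hc' i⟩
  · have := congrArg (fun z => b.repr z j) hx'
    simp only [b.repr_sum_self, map_smul, Finsupp.smul_apply, smul_eq_mul] at this
    exact ⟨_, this⟩

theorem IsSelfDualResolution.exists_frame [IsDomain R] [UniqueFactorizationMonoid R]
    [Invertible (2 : R)] [Module.Free R B₀] [Module.Finite R B₀] [Module.Free R B₁]
    [Module.Finite R B₁] (hB : IsSelfDualResolution δ₁ δ₂) {n : ℕ}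
    (hn : n + Module.finrank R B₀ ≤ Module.finrank R B₁) {π : R} (hπ : π = 0 ∨ Prime π) :
    ∃ (ψ : Fin n → Module.Dual R B₁) (v : Fin n → Hyp R H) (y : R),
      IsFrame (delta3 δ₂ ∘ ψ) v y ∧ ¬ π ∣ y ∧ LinIndepMod π (delta3 δ₂ ∘ ψ) := by
  obtain ⟨ψ, hψ⟩ := exists_linIndepMod hπ (delta4 δ₁) (delta3 δ₂)
    (fun x z h => hB.exists_of_delta3_eq_smul x z h) (n := n)
    (by simpa [Module.finrank_linearMap] using hn)
  obtain ⟨φ, y, hy, hφ⟩ := hψ.exists_functionals hπ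
  choose v hv using fun j => exists_dualProd_eq (φ j)
  have hleft : ∀ i j, LinearMap.dualProd R H (delta3 δ₂ (ψ i)) (delta3 δ₂ (ψ j)) = 0 :=
    fun i j => hB.isotropic ⟨_, rfl⟩ ⟨_, rfl⟩
  have hpair : ∀ i j, LinearMap.dualProd R H (v j) (delta3 δ₂ (ψ i)) = if i = j then y else 0 :=
    fun i j => by rw [hv]; exact hφ i j
  have hpair' : ∀ i j, LinearMap.dualProd R H (delta3 δ₂ (ψ i)) (v j) = if i = j then y else 0 :=
    fun i j => by rw [dualProd_comm]; exact hpair i j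
  -- The dual vectors are made isotropic by subtracting half their Gram matrix along im δ₃; the
  -- factor 2y avoids denominators and turns the pairing into 2y².
  refine ⟨ψ, fun j => (2 * y) • v j -
    ∑ k, LinearMap.dualProd R H (v k) (v j) • delta3 δ₂ (ψ k), 2 * y * y, ⟨?_, ?_, ?_⟩, ?_, hψ⟩
  · exact hleft
  · intro i j
    simp only [map_sub, map_smul, map_sum, LinearMap.sub_apply, LinearMap.smul_apply,
      LinearMap.sum_apply, hleft, hpair, hpair', smul_eq_mul, mul_ite, mul_zero,
      Finset.mem_univ, if_true, Finset.sum_const_zero, sub_zero, Finset.sum_ite_eq']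
    rw [dualProd_comm (v j) (v i)]
    ring
  · intro i j
    simp only [Function.comp_apply, map_sub, map_smul, map_sum, hleft, hpair', smul_eq_mul,
      mul_ite, mul_zero, Finset.sum_const_zero, sub_zero]
  · intro h
    have h2 : ¬ π ∣ 2 := fun h2 => hy (h2.trans ((isUnit_of_invertible (2 : R)).dvd))
    rcases dvd_or_dvd_of_zero_or_prime hπ h with h | h
    · exact (dvd_or_dvd_of_zero_or_prime hπ h).elim h2 hy
    · exact hy h

end Resolution

/-! ### Division by a common factor. -/

section Divisibility

variable {R M ι : Type*} [CommRing R] [IsDomain R] [UniqueFactorizationMonoid R]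
  [AddCommGroup M] [Module R M] [Module.Free R M] [Module.Finite R M]

/-- For each prime factor of `d`, some `D i` is prime to it, so that factor divides `g` and can be
cancelled. -/
theorem exists_eq_smul_of_forall_smul (D : ι → R) (hD : ∀ π, Prime π → ∃ i, ¬ π ∣ D i) {d : R}
    (hd : d ≠ 0) : ∀ {g : M}, (∀ i, ∃ m, D i • g = d • m) → ∃ m, g = d • m := by
  induction d using UniqueFactorizationMonoid.induction_on_prime with
  | h₁ => exact absurd rfl hd
  | h₂ u hu =>
    intro g _
    obtain ⟨u, rfl⟩ := hu
    exact ⟨(↑u⁻¹ : R) • g, by rw [smul_smul, Units.mul_inv, one_smul]⟩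
  | h₃ d π hd' hπ ih =>
    intro g hg
    obtain ⟨i, hi⟩ := hD π hπ
    obtain ⟨m, hm⟩ := hg i
    rw [mul_smul] at hm
    obtain ⟨g', rfl⟩ := exists_eq_smul_of_smul_eq_smul (Or.inr hπ) hi hm
    obtain ⟨m', rfl⟩ := ih hd' (g := g') fun j => by
      obtain ⟨m, hm⟩ := hg j
      rw [smul_comm, mul_smul] at hm
      exact ⟨m, (smul_right_injective M hπ.ne_zero) hm⟩
    exact ⟨m', by rw [mul_smul]⟩

end Divisibility

/-! ### Determinants and values on frames. -/

section DetAlternating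

variable {R M : Type*} [CommRing R] [AddCommGroup M] [Module R M] {n r : ℕ}

/-- The determinant as an alternating function of the first vectors, the other ones being fixed. -/
def detLeft (c : Module.Basis (Fin n ⊕ Fin r) R M) (x : Fin r → M) : M [⋀^Fin n]→ₗ[R] R where
  toFun u := c.det (Sum.elim u x)
  map_update_add' u i z z' := by
    simp only [Sum.elim_update_left, AlternatingMap.map_update_add]
  map_update_smul' u i a z := by
    simp only [Sum.elim_update_left, AlternatingMap.map_update_smul]
  map_eq_zero_of_eq' u i j h hij :=
    c.det.map_eq_zero_of_eq (Sum.elim u x) (i := Sum.inl i) (j := Sum.inl j) (by simpa using h)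
      (by simpa using hij)

theorem detLeft_eq_zero [IsDomain R] (c : Module.Basis (Fin n ⊕ Fin r) R M) (x : Fin r → M)
    {u : Fin n → M} {i : Fin n} (hi : u i ∈ Submodule.span R (Set.range x)) :
    detLeft c x u = 0 := by
  classical
  refine c.det.map_linearDependent _ ?_
  obtain ⟨a, ha⟩ := (Submodule.mem_span_range_iff_exists_fun R).mp hi
  rw [Fintype.not_linearIndependent_iff]
  refine ⟨Sum.elim (Pi.single i (-1)) a, ?_, Sum.inl i, by simp⟩
  rw [Fintype.sum_sum_type]
  simp only [Sum.elim_inl, Sum.elim_inr, ha]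
  rw [Fintype.sum_eq_single i fun j hj => by rw [Pi.single_eq_of_ne hj, zero_smul]]
  simp

end DetAlternating

section TopValues

variable {R H : Type*} [CommRing R] [AddCommGroup H] [Module R H] {n : ℕ}

theorem wedgePairing_ιMulti (x u : Fin n → Hyp R H) :
    wedgePairing R H n (exteriorPower.ιMulti R n x) (exteriorPower.ιMulti R n u) =
      Matrix.det (Matrix.of fun i j => LinearMap.dualProd R H (x j) (u i)) := by
  rw [wedgePairing, LinearMap.comp_apply, exteriorPower.map_apply_ιMulti,
    exteriorPower.pairingDual_ιMulti_ιMulti]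
  rfl

theorem spinorP_right [Invertible (2 : R)] (e : Module.Basis (Fin n) R H) {l v : Fin n → Hyp R H} {y : R}
    (hf : IsFrame l v y) {s : ExteriorAlgebra R H} (hs : ∀ i, spinorAct R H (l i) s = 0) :
    spinorP e s s (exteriorPower.ιMulti R n v) =
      spinorForm e s (fock e hf.right (wedgeTop e) s) := by
  have hlen : (testList l v [] (List.finRange n)).length = n := by simp [length_testList]
  have h2 : (fun i : Fin n => (testList l v [] (List.finRange n)).get (i.cast hlen.symm)) = v := by
    funext i
    simp [testList]
    rfl
  have h1 := spinorP_ιMulti_get e s s _ hlen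
  have h3 := wedgeAct_testList_fock e hf hs [] (List.finRange n)
    (by simpa using List.nodup_finRange n) 1
  rw [map_one, Module.End.one_apply] at h3
  rw [h2, h3] at h1
  rw [h1]
  simp

end TopValues

/-! ### The Buchsbaum–Eisenbud multiplier and the square of the pure spinor. -/

section Multiplier

variable {R B₀ B₁ H : Type*} [CommRing R] [IsDomain R]
  [AddCommGroup B₀] [Module R B₀]
  [AddCommGroup B₁] [Module R B₁]
  [AddCommGroup H] [Module R H] [Module.Free R H] [Module.Finite R H]
  {δ₁ : B₁ →ₗ[R] B₀} {δ₂ : Hyp R H →ₗ[R] B₁} {n r : ℕ}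

variable {a₃ : ⋀[R]^n (Hyp R H)}

/-- The pairing of ⋀ⁿδ₃(ψ) with v is yⁿ, and the value of a₃ on v divides it. -/
theorem IsMultiplier.not_dvd_wedgePairing (ha : IsMultiplier n r δ₁ δ₂ a₃)
    {ψ : Fin n → Module.Dual R B₁} {v : Fin n → Hyp R H} {y : R}
    (hf : IsFrame (delta3 δ₂ ∘ ψ) v y) {π : R} (hπ : π = 0 ∨ Prime π) (hy : ¬ π ∣ y) :
    ¬ π ∣ wedgePairing R H n a₃ (exteriorPower.ιMulti R n v) := by
  obtain ⟨b, c, h⟩ := ha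
  have h1 := congrArg (fun z => wedgePairing R H n z (exteriorPower.ιMulti R n v)) (h ψ)
  simp only [map_smul, LinearMap.smul_apply, wedgePairing_ιMulti] at h1
  have h2 : (Matrix.of fun i j => LinearMap.dualProd R H (delta3 δ₂ (ψ j)) (v i)) =
      Matrix.diagonal fun _ => y := by
    ext i j
    rw [Matrix.of_apply, Matrix.diagonal_apply]
    have := hf.pair j i
    simp only [Function.comp_apply] at this
    rw [this]
    simp only [eq_comm]
  rw [h2, Matrix.det_diagonal, Finset.prod_const, smul_eq_mul] at h1
  intro hdvd
  have h3 : π ∣ y ^ (Finset.univ : Finset (Fin n)).card := h1 ▸ hdvd.mul_left _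
  rcases hπ with rfl | hπ
  · rw [zero_dvd_iff] at h3 hy
    exact pow_ne_zero _ hy h3
  · exact hy (hπ.dvd_of_dvd_pow h3)

variable [Module.Free R B₁] [Module.Finite R B₁]

theorem IsFrame.smul_eq_of_mem_range {ψ : Fin n → Module.Dual R B₁} {v : Fin n → Hyp R H} {y : R}
    (hB : IsSelfDualResolution δ₁ δ₂) (hf : IsFrame (delta3 δ₂ ∘ ψ) v y) (hy : y ≠ 0)
    (hn : Module.finrank R H = n) (x : Module.Dual R B₁) :
    ∃ z, y • x = ∑ j, LinearMap.dualProd R H (v j) (delta3 δ₂ x) • ψ j + delta4 δ₁ z := by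
  have h := hf.smul_eq hy hn (delta3 δ₂ x)
  have h0 : ∀ j, LinearMap.dualProd R H ((delta3 δ₂ ∘ ψ) j) (delta3 δ₂ x) = 0 :=
    fun j => hB.isotropic ⟨_, rfl⟩ ⟨_, rfl⟩
  simp only [h0, zero_smul, Finset.sum_const_zero, zero_add] at h
  obtain ⟨z, hz⟩ := (hB.exact₃
    (y • x - ∑ j, LinearMap.dualProd R H (v j) (delta3 δ₂ x) • ψ j)).mp (by
      rw [map_sub, map_smul, h, map_sum]
      simp)
  exact ⟨z, by rw [hz]; abel⟩

variable [Module.Free R B₀] [Module.Finite R B₀]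

/-- The maps ⋀ⁿδ₃ and u ↦ u ∧ a₄ vanish along im δ₄, hence are proportional. No prime divides all
values of the second, so the quotient is defined over R. -/
theorem IsSelfDualResolution.exists_isMultiplier [UniqueFactorizationMonoid R]
    [Invertible (2 : R)] (hB : IsSelfDualResolution δ₁ δ₂)
    (hn : Module.finrank R H = n) (hr : Module.finrank R B₀ = r)
    (hnr : Module.finrank R B₁ = n + r) : ∃ a₃, IsMultiplier n r δ₁ δ₂ a₃ := by
  classical
  let b : Module.Basis (Fin r) R (Module.Dual R B₀) :=
    Module.finBasisOfFinrankEq R _ (by simpa [Module.finrank_linearMap] using hr)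
  let c : Module.Basis (Fin n ⊕ Fin r) R (Module.Dual R B₁) :=
    (Module.finBasisOfFinrankEq R _ (by simpa [Module.finrank_linearMap] using hnr)).reindex
      finSumFinEquiv.symm
  let D := detLeft c fun j => delta4 δ₁ (b j)
  let G := (exteriorPower.ιMulti R n (M := Hyp R H)).compLinearMap (delta3 δ₂)
  have hframe : ∀ π : R, (π = 0 ∨ Prime π) → ∃ (ψ : Fin n → Module.Dual R B₁) (v : Fin n → Hyp R H)
      (y : R), IsFrame (delta3 δ₂ ∘ ψ) v y ∧ ¬ π ∣ y ∧ ¬ π ∣ D ψ := by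
    intro π hπ
    obtain ⟨ψ, v, y, hf, hy, hψ⟩ := hB.exists_frame (n := n) (by omega) hπ
    exact ⟨ψ, v, y, hf, hy, (hB.linIndepMod_sumElim hψ b).not_dvd_det hπ c⟩
  obtain ⟨ψ, v, y, hf, hy, hψ⟩ := hframe 0 (Or.inl rfl)
  rw [zero_dvd_iff] at hy hψ
  have hΔ : ∀ u, D ψ • G u = D u • G ψ := by
    intro u
    have h0 : D ψ • G - (LinearMap.toSpanSingleton R _ (G ψ)).compAlternatingMap D = 0 := by
      refine alternatingMap_eq_zero _ (LinearMap.range (delta4 δ₁)) ?_ ψ ?_ ?_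
      · rintro u ⟨i, z, hz⟩
        have h1 : D u = 0 := by
          refine detLeft_eq_zero c _ (i := i) ?_
          rw [← hz, ← b.sum_repr z, map_sum]
          refine Submodule.sum_mem _ fun j _ => ?_
          rw [map_smul]
          exact Submodule.smul_mem _ _ (Submodule.subset_span ⟨j, rfl⟩)
        have h2 : G u = 0 := by
          refine (exteriorPower.ιMulti R n).map_coord_zero (i := i) ?_
          rw [← hz, delta3_delta4 hB]
        simp [h1, h2]
      · simp
      · intro x
        obtain ⟨z, hz⟩ := hf.smul_eq_of_mem_range hB hy hn x
        exact ⟨y, hy, _, _, ⟨z, rfl⟩, hz⟩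
    have h := congrArg (fun Δ => Δ u) h0
    simpa [sub_eq_zero] using h
  obtain ⟨a₃, ha₃⟩ := exists_eq_smul_of_forall_smul (M := ⋀[R]^n (Hyp R H)) (fun u => D u)
    (fun π hπ => by
      obtain ⟨ψ', _, _, _, _, h⟩ := hframe π (Or.inr hπ)
      exact ⟨ψ', h⟩) hψ (g := G ψ) fun u => ⟨G u, (hΔ u).symm⟩
  refine ⟨a₃, b, c, fun u => ?_⟩
  have h := hΔ u
  rw [ha₃, smul_comm] at h
  exact smul_right_injective _ hψ h

/-- A nonzero multiple of a₃ is a product of vectors of the isotropic module im δ₃, so the pairing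
matrix has a zero row. -/
theorem IsMultiplier.wedgePairing_eq_zero [UniqueFactorizationMonoid R] [Invertible (2 : R)]
    (ha : IsMultiplier n r δ₁ δ₂ a₃) (hB : IsSelfDualResolution δ₁ δ₂)
    (hnr : n + Module.finrank R B₀ ≤ Module.finrank R B₁) {u : Fin n → Hyp R H} {i : Fin n}
    (hi : u i ∈ LinearMap.range (delta3 δ₂)) :
    wedgePairing R H n a₃ (exteriorPower.ιMulti R n u) = 0 := by
  obtain ⟨b, c, h⟩ := ha
  obtain ⟨ψ, v, y, hf, hy, hψ⟩ := hB.exists_frame hnr (Or.inl rfl)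
  have hD := (hB.linIndepMod_sumElim hψ b).not_dvd_det (Or.inl rfl) c
  rw [zero_dvd_iff] at hD
  have h1 := congrArg (fun z => wedgePairing R H n z (exteriorPower.ιMulti R n u)) (h ψ)
  simp only [map_smul, LinearMap.smul_apply, wedgePairing_ιMulti] at h1
  rw [Matrix.det_eq_zero_of_row_eq_zero i fun j => hB.isotropic ⟨_, rfl⟩ hi] at h1
  exact (smul_eq_zero.mp h1.symm).resolve_left hD

variable [UniqueFactorizationMonoid R] [Invertible (2 : R)]

/-- A primitive pure spinor of the isotropic submodule `im δ₃` gives spinor coordinates. -/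
theorem exists_spinorP_eq_smul (hB : IsSelfDualResolution δ₁ δ₂)
    (hn : Module.finrank R H = n) (hnr : n + Module.finrank R B₀ ≤ Module.finrank R B₁)
    (ha : IsMultiplier n r δ₁ δ₂ a₃) (e : Module.Basis (Fin n) R H)
    {s : ExteriorAlgebra R H} (hs0 : s ≠ 0) (hp : IsPrimitive (R := R) s)
    (hs : ∀ x ∈ LinearMap.range (delta3 δ₂), spinorAct R H x s = 0) :
    ∃ ε : Rˣ, spinorP e s s = (ε : R) • wedgePairing R H n a₃ := by
  have key : ∀ π : R, (π = 0 ∨ Prime π) → ∃ v y, ∃ ψ : Fin n → Module.Dual R B₁,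
      IsFrame (delta3 δ₂ ∘ ψ) v y ∧ ¬ π ∣ y ∧
      ¬ π ∣ spinorP e s s (exteriorPower.ιMulti R n v) ∧
      ¬ π ∣ wedgePairing R H n a₃ (exteriorPower.ιMulti R n v) := by
    intro π hπ
    obtain ⟨ψ, v, y, hf, hy, hψ⟩ := hB.exists_frame (n := n) hnr hπ
    have hs' : ∀ i, spinorAct R H ((delta3 δ₂ ∘ ψ) i) s = 0 := fun i => hs _ ⟨_, rfl⟩
    refine ⟨v, y, ψ, hf, hy, ?_, ha.not_dvd_wedgePairing hf hπ hy⟩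
    rw [spinorP_right e hf hs']
    exact not_dvd_spinorForm_fock_wedgeTop e hf hπ hy hs0 hs' hp
  have hP1 : IsPrimitive (R := R) (spinorP e s s) := by
    intro π hπ F h
    obtain ⟨v, _, _, _, _, h1, _⟩ := key π (Or.inr hπ)
    exact h1 (by rw [h]; exact ⟨_, rfl⟩)
  have hP2 : IsPrimitive (R := R) (wedgePairing R H n a₃) := by
    intro π hπ F h
    obtain ⟨v, _, _, _, _, _, h1⟩ := key π (Or.inr hπ)
    exact h1 (by rw [h]; exact ⟨_, rfl⟩)
  obtain ⟨v, y, ψ, hf, hy, h1, h2⟩ := key 0 (Or.inl rfl)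
  rw [zero_dvd_iff] at hy h1 h2
  set F := spinorP e s s with hF
  set G := wedgePairing R H n a₃ with hG
  set c := F (exteriorPower.ιMulti R n v) with hc
  set d := G (exteriorPower.ιMulti R n v) with hd
  have hFG : c • G = d • F := by
    rw [← sub_eq_zero]
    refine exteriorPower.linearMap_ext ?_
    rw [LinearMap.zero_compAlternatingMap]
    refine alternatingMap_eq_zero _ (LinearMap.range (delta3 δ₂)) ?_ v ?_ ?_
    · rintro u ⟨i, hi⟩
      have hu1 : F (exteriorPower.ιMulti R n u) = 0 :=
        spinorP_eq_zero_of_spinorAct_eq_zero e i (hs _ hi)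
      have hu2 : G (exteriorPower.ιMulti R n u) = 0 := ha.wedgePairing_eq_zero hB hnr hi
      rw [LinearMap.compAlternatingMap_apply, LinearMap.sub_apply, LinearMap.smul_apply,
        LinearMap.smul_apply, hu1, hu2, smul_zero, smul_zero, sub_zero]
    · rw [LinearMap.compAlternatingMap_apply, LinearMap.sub_apply, LinearMap.smul_apply,
        LinearMap.smul_apply, ← hc, ← hd, smul_eq_mul, smul_eq_mul, mul_comm, sub_self]
    · intro x
      refine ⟨y, hy, _, _, ?_, hf.smul_eq hy hn x⟩
      exact Submodule.sum_mem _ fun j _ => Submodule.smul_mem _ _ ⟨_, rfl⟩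
  -- Two proportional primitive forms are multiples of each other, hence differ by a unit.
  obtain ⟨c', hc'⟩ := hP1.exists_eq_smul h1 hFG
  obtain ⟨d', hd'⟩ := hP2.exists_eq_smul h2 hFG.symm
  have hF0 : F ≠ 0 := fun h => h1 (by rw [hc, h]; rfl)
  have hu : d' * c' = 1 := by
    have : (d' * c') • F = (1 : R) • F := by rw [mul_smul, ← hc', ← hd', one_smul]
    exact smul_left_injective R hF0 this
  exact ⟨⟨d', c', hu, by rw [mul_comm, hu]⟩, hd'⟩

end Multiplier

/-! ### Ranks over the fraction field. -/

section BaseChangeRank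

variable {R M N : Type*} [CommRing R] [IsDomain R] [AddCommGroup M] [Module R M]
  [AddCommGroup N] [Module R N]

theorem finrank_range_baseChange (f : M →ₗ[R] N) :
    Module.finrank (FractionRing R) (LinearMap.range (f.baseChange (FractionRing R))) =
      Module.finrank R (LinearMap.range f) := by
  let K := FractionRing R
  have h1 : LinearMap.range (f.baseChange K) =
      LinearMap.range ((LinearMap.range f).subtype.baseChange K) := by
    conv_lhs => rw [← LinearMap.subtype_comp_codRestrict f (LinearMap.range f) fun x => ⟨x, rfl⟩,
      LinearMap.baseChange_comp]
    refine LinearMap.range_comp_of_range_eq_top _ (LinearMap.range_eq_top.mpr ?_)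
    exact LinearMap.lTensor_surjective K (g := f.rangeRestrict) f.surjective_rangeRestrict
  have h2 : Function.Injective ((LinearMap.range f).subtype.baseChange K) :=
    Module.Flat.lTensor_preserves_injective_linearMap (M := K) (LinearMap.range f).subtype
      (LinearMap.range f).injective_subtype
  rw [h1, LinearMap.finrank_range_of_inj h2]
  exact (TensorProduct.isBaseChange R (LinearMap.range f) K).finrank_eq

theorem finrank_range_inf_ker_add {K V V' W : Type*} [Field K] [AddCommGroup V] [Module K V]
    [AddCommGroup V'] [Module K V'] [AddCommGroup W] [Module K W] [Module.Finite K V']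
    (f : V' →ₗ[K] V) (g : V →ₗ[K] W) :
    Module.finrank K (LinearMap.range f ⊓ LinearMap.ker g : Submodule K V) +
      Module.finrank K (LinearMap.range (g ∘ₗ f)) = Module.finrank K (LinearMap.range f) := by
  have h := LinearMap.finrank_range_add_finrank_ker (g.domRestrict (LinearMap.range f))
  rw [LinearMap.range_domRestrict, ← LinearMap.range_comp] at h
  rw [← h, add_comm, LinearMap.ker_domRestrict, ← Submodule.map_comap_subtype,
    Submodule.finrank_map_subtype_eq]

end BaseChangeRank

/-! ### Spinors generated from 1 by vectors, and primitive representatives. -/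

section ActList

variable {R H : Type*} [CommRing R] [AddCommGroup H] [Module R H]

/-- The spinor obtained by letting a list of vectors act on `1`. -/
def actList (I : List (Hyp R H)) : ExteriorAlgebra R H := I.foldr (fun x s => spinorAct R H x s) 1

theorem actList_cons (x : Hyp R H) (I : List (Hyp R H)) :
    actList (x :: I) = spinorAct R H x (actList I) := rfl

theorem spinorAct_actList_inl (d : Module.Dual R H) :
    ∀ I : List (Hyp R H), (∀ z ∈ I, LinearMap.dualProd R H (d, 0) z = 0) →
      spinorAct R H (d, 0) (actList I) = 0
  | [], _ => by rw [spinorAct_inl]; exact contr_one d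
  | z :: I, h => by
    rw [actList_cons, spinorAct_swap, h z (by simp), zero_smul,
      spinorAct_actList_inl d I fun w hw => h w (by simp [hw]), map_zero, sub_zero]

theorem spinorAct_actList_of_mem [Invertible (2 : R)] {x : Hyp R H} :
    ∀ I : List (Hyp R H), x ∈ I → (∀ z ∈ I, LinearMap.dualProd R H x z = 0) →
      spinorAct R H x (actList I) = 0
  | z :: I, hx, h => by
    rw [actList_cons]
    rcases List.mem_cons.mp hx with rfl | hx
    · exact spinorAct_spinorAct_of_isotropic (h x (by simp)) _
    · rw [spinorAct_swap, h z (by simp), zero_smul,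
        spinorAct_actList_of_mem I hx fun w hw => h w (by simp [hw]), map_zero, sub_zero]

theorem actList_mem_evenOdd :
    ∀ I : List (Hyp R H), actList I ∈ CliffordAlgebra.evenOdd (0 : QuadraticForm R H) I.length
  | [] => by
    rw [List.length_nil, Nat.cast_zero]
    exact CliffordAlgebra.one_le_evenOdd_zero _ (Submodule.one_le.mp le_rfl)
  | x :: I => by
    rw [actList_cons, List.length_cons, Nat.cast_succ]
    exact spinorAct_mem_evenOdd x (actList_mem_evenOdd I)

/-- Contraction with the functional dual to the first vector peels it off, leaving `d` times the
rest. -/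
theorem actList_ne_zero [IsDomain R] [Module.Free R H] [Module.Finite R H] {m : ℕ}
    {l : Fin m → Hyp R H} {φ : Fin m → Module.Dual R H} {d : R} (hd : d ≠ 0)
    (h : ∀ i j, φ j (l i).2 = if i = j then d else 0) :
    ∀ J : List (Fin m), J.Nodup → actList (J.map l) ≠ 0
  | [], _ => by
    have := Module.Free.of_basis (Module.finBasis R H).ExteriorAlgebra
    exact one_ne_zero
  | j :: J, hJ => by
    have := Module.Free.of_basis (Module.finBasis R H).ExteriorAlgebra
    rw [List.nodup_cons] at hJ
    intro h0
    rw [List.map_cons, actList_cons] at h0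
    have h1 := congrArg (spinorAct R H (φ j, 0)) h0
    have hpair : ∀ i, LinearMap.dualProd R H (φ j, 0) (l i) = if i = j then d else 0 := fun i => by
      rw [dualProd_apply', h]
      simp
    rw [spinorAct_swap, spinorAct_actList_inl (φ j) (J.map l), map_zero, map_zero, sub_zero, hpair,
      if_pos rfl] at h1
    · exact actList_ne_zero hd h J hJ.2 ((smul_eq_zero.mp h1).resolve_left hd)
    · intro z hz
      obtain ⟨i, hi, rfl⟩ := List.mem_map.mp hz
      rw [hpair, if_neg]
      rintro rfl
      exact hJ.1 hi

theorem mem_odd_of_smul_mem [IsDomain R] [Module.Free R H] [Module.Finite R H] {r : R}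
    (hr : r ≠ 0) {s : ExteriorAlgebra R H} (h : r • s ∈ VOdd R H) : s ∈ VOdd R H := by
  have := Module.Free.of_basis (Module.finBasis R H).ExteriorAlgebra
  have htop : s ∈ VEven R H ⊔ VOdd R H := by
    rw [(CliffordAlgebra.evenOdd_isCompl (0 : QuadraticForm R H)).sup_eq_top]
    exact Submodule.mem_top
  obtain ⟨a, ha, b, hb, rfl⟩ := Submodule.mem_sup.mp htop
  have h0 : r • a = 0 := by
    refine eq_zero_of_mem_even_of_mem_odd (Submodule.smul_mem _ _ ha) ?_
    have := Submodule.sub_mem _ h (Submodule.smul_mem _ r hb)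
    rwa [smul_add, add_sub_cancel_right] at this
  rw [(smul_eq_zero.mp h0).resolve_left hr, zero_add]
  exact hb

/-- A nonzero odd spinor killed by a set of vectors can be made primitive. -/
theorem exists_isPrimitive [IsDomain R] [IsNoetherianRing R] [Module.Free R H] [Module.Finite R H]
    (L : Set (Hyp R H)) {s₀ : ExteriorAlgebra R H} (h0 : s₀ ≠ 0) (hodd : s₀ ∈ VOdd R H)
    (hL : ∀ x ∈ L, spinorAct R H x s₀ = 0) :
    ∃ s ∈ VOdd R H, s ≠ 0 ∧ IsPrimitive (R := R) s ∧ ∀ x ∈ L, spinorAct R H x s = 0 := by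
  have := Module.Free.of_basis (Module.finBasis R H).ExteriorAlgebra
  have := Module.Finite.of_basis (Module.finBasis R H).ExteriorAlgebra
  have hN : IsNoetherian R (ExteriorAlgebra R H) := inferInstance
  -- A generator of a maximal cyclic span is primitive: dividing it by a prime would enlarge the
  -- span strictly.
  obtain ⟨_, ⟨s, hs, hs0, hsL, rfl⟩, hmax⟩ := set_has_maximal_iff_noetherian.mpr hN
    {N | ∃ s ∈ VOdd R H, s ≠ 0 ∧ (∀ x ∈ L, spinorAct R H x s = 0) ∧ N = Submodule.span R {s}}
    ⟨_, s₀, hodd, h0, hL, rfl⟩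
  refine ⟨s, hs, hs0, ?_, hsL⟩
  rintro π hπ s' rfl
  have hs'0 : s' ≠ 0 := fun h => hs0 (by rw [h, smul_zero])
  have hmem : Submodule.span R {s'} ∈ {N | ∃ s ∈ VOdd R H, s ≠ 0 ∧
      (∀ x ∈ L, spinorAct R H x s = 0) ∧ N = Submodule.span R {s}} := by
    refine ⟨s', mem_odd_of_smul_mem hπ.ne_zero hs, hs'0, fun x hx => ?_, rfl⟩
    have := hsL x hx
    rw [map_smul] at this
    exact (smul_eq_zero.mp this).resolve_left hπ.ne_zero
  have hle : Submodule.span R {π • s'} ≤ Submodule.span R {s'} := by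
    rw [Submodule.span_singleton_le_iff_mem]
    exact Submodule.smul_mem _ _ (Submodule.mem_span_singleton_self _)
  have hge : s' ∈ Submodule.span R {π • s'} := by
    by_contra hge
    refine hmax _ hmem (lt_of_le_of_ne hle fun heq => hge ?_)
    rw [heq]
    exact Submodule.mem_span_singleton_self _
  obtain ⟨c, hc⟩ := Submodule.mem_span_singleton.mp hge
  have : (c * π) • s' = (1 : R) • s' := by rw [mul_smul, hc, one_smul]
  exact hπ.not_isUnit (IsUnit.of_mul_eq_one_right c (smul_left_injective R hs'0 this))

end ActList

/-! ### Construction of the pure spinor. -/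

section PureSpinor

variable {R B₀ B₁ H : Type*} [CommRing R] [IsDomain R]
  [AddCommGroup B₀] [Module R B₀] [Module.Free R B₀] [Module.Finite R B₀]
  [AddCommGroup B₁] [Module R B₁] [Module.Free R B₁] [Module.Finite R B₁]
  [AddCommGroup H] [Module R H] [Module.Free R H] [Module.Finite R H]
  {δ₁ : B₁ →ₗ[R] B₀} {δ₂ : Hyp R H →ₗ[R] B₁} {n : ℕ}

theorem IsSelfDualResolution.finrank_range (hB : IsSelfDualResolution δ₁ δ₂)
    (hn : Module.finrank R B₁ = n + Module.finrank R B₀) :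
    Module.finrank R (LinearMap.range (delta3 δ₂)) = n := by
  have h := finrank_range_add_finrank_ker_of_isDomain (delta3 δ₂)
  rw [hB.exact₃.linearMap_ker_eq, LinearMap.finrank_range_of_inj hB.injective,
    Module.finrank_linearMap, Module.finrank_linearMap, Module.finrank_self, mul_one, mul_one] at h
  omega

/-- The projection of im δ₃ to H has kernel im δ₃ ∩ H^*, so its rank is n minus the dimension whose
parity the hypothesis prescribes. -/
theorem odd_finrank_range_snd (hB : IsSelfDualResolution δ₁ δ₂)
    (hn : Module.finrank R B₁ = n + Module.finrank R B₀) (hcomp : DualInOtherComponent n δ₂) :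
    Odd (Module.finrank R (LinearMap.range (LinearMap.snd R (Module.Dual R H) H ∘ₗ delta3 δ₂))) := by
  have hex : Function.Exact ((LinearMap.inl R (Module.Dual R H) H).baseChange (FractionRing R))
      ((LinearMap.snd R (Module.Dual R H) H).baseChange (FractionRing R)) :=
    lTensor_exact (FractionRing R)
      (LinearMap.exact_iff.mpr (LinearMap.range_inl R (Module.Dual R H) H).symm)
      LinearMap.snd_surjective
  have h := finrank_range_inf_ker_add ((delta3 δ₂).baseChange (FractionRing R))
    ((LinearMap.snd R (Module.Dual R H) H).baseChange (FractionRing R))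
  rw [← LinearMap.baseChange_comp, finrank_range_baseChange, finrank_range_baseChange,
    hB.finrank_range hn, hex.linearMap_ker_eq] at h
  rw [DualInOtherComponent, OppositeComponents, Nat.ModEq] at hcomp
  rw [Nat.odd_iff]
  omega

/-- The pure spinor of the isotropic submodule `im δ₃`. -/
theorem exists_pure_spinor [Invertible (2 : R)] [IsNoetherianRing R]
    (hB : IsSelfDualResolution δ₁ δ₂)
    (hn : Module.finrank R B₁ = n + Module.finrank R B₀) (hcomp : DualInOtherComponent n δ₂) :
    ∃ s ∈ VOdd R H, s ≠ 0 ∧ IsPrimitive (R := R) s ∧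
      ∀ x ∈ LinearMap.range (delta3 δ₂), spinorAct R H x s = 0 := by
  classical
  set P := LinearMap.range (LinearMap.snd R (Module.Dual R H) H ∘ₗ delta3 δ₂) with hP
  set m := Module.finrank R P with hm
  have hodd : Odd m := odd_finrank_range_snd hB hn hcomp
  obtain ⟨z, hz⟩ := exists_linearIndependent_of_le_finrank (R := R) (M := P) (n := m) le_rfl
  choose x hx using fun i => (z i).2
  set l : Fin m → Hyp R H := fun i => delta3 δ₂ (x i) with hl
  have hlz : ∀ i, (l i).2 = (z i : H) := hx
  have hz' := hz.map' P.subtype (Submodule.ker_subtype P)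
  have hmod : LinIndepMod (R := R) 0 (fun i => (l i).2) := by
    intro c w h i
    rw [zero_smul] at h
    simp only [hlz] at h
    rw [zero_dvd_iff]
    exact Fintype.linearIndependent_iff.mp hz' c h i
  obtain ⟨φ, d, hd, hφ⟩ := hmod.exists_functionals (Or.inl rfl)
  rw [zero_dvd_iff] at hd
  set I := (List.finRange m).map l with hI
  have hIl : ∀ w ∈ I, w ∈ LinearMap.range (delta3 δ₂) := by
    intro w hw
    obtain ⟨i, _, rfl⟩ := List.mem_map.mp hw
    exact ⟨_, rfl⟩
  refine exists_isPrimitive (R := R) (LinearMap.range (delta3 δ₂) : Set (Hyp R H))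
    (s₀ := actList I) (actList_ne_zero hd hφ _ (List.nodup_finRange m)) ?_ ?_
  · have h := actList_mem_evenOdd I
    rwa [hI, List.length_map, List.length_finRange,
      (ZMod.natCast_eq_one_iff_odd).mpr hodd] at h
  · intro w hw
    have := Module.Free.of_basis (Module.finBasis R H).ExteriorAlgebra
    have hw2 : w.2 ∈ P := by
      obtain ⟨ψ, rfl⟩ := hw
      exact ⟨ψ, rfl⟩
    have hspan : Module.finrank R P ≤ Module.finrank R (Submodule.span R (Set.range z)) := by
      rw [finrank_span_eq_card hz, Fintype.card_fin]
    obtain ⟨r, hr, hrw⟩ := exists_smul_mem_of_finrank_le _ hspan ⟨w.2, hw2⟩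
    obtain ⟨c, hc⟩ := (Submodule.mem_span_range_iff_exists_fun R).mp hrw
    have hc2 : ∑ i, c i • (l i).2 = r • w.2 := by
      simpa [hlz] using congrArg (Submodule.subtype P) hc
    -- This combination lies in H^* and is orthogonal to the `l i`, so it contracts the product to
    -- zero; the `l i` kill the product as well.
    set w' := r • w - ∑ i, c i • l i with hw'
    have hw'L : w' ∈ LinearMap.range (delta3 δ₂) :=
      Submodule.sub_mem _ (Submodule.smul_mem _ _ hw)
        (Submodule.sum_mem _ fun i _ => Submodule.smul_mem _ _ ⟨_, rfl⟩)
    have hw'2 : w'.2 = 0 := by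
      rw [hw', Prod.snd_sub, Prod.snd_sum, Prod.smul_snd]
      simp only [Prod.smul_snd]
      rw [hc2, sub_self]
    have h1 : spinorAct R H w' (actList I) = 0 := by
      have hw'eq : w' = (w'.1, 0) := Prod.ext rfl hw'2
      rw [hw'eq]
      refine spinorAct_actList_inl _ _ fun v hv => ?_
      rw [← hw'eq]
      exact hB.isotropic hw'L (hIl v hv)
    have h2 : ∀ i, spinorAct R H (l i) (actList I) = 0 := fun i =>
      spinorAct_actList_of_mem I (List.mem_map.mpr ⟨i, List.mem_finRange i, rfl⟩) fun v hv =>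
        hB.isotropic ⟨_, rfl⟩ (hIl v hv)
    rw [hw', map_sub, LinearMap.sub_apply, map_sum, LinearMap.sum_apply] at h1
    simp only [map_smul, LinearMap.smul_apply, h2, smul_zero, Finset.sum_const_zero, sub_zero] at h1
    exact (smul_eq_zero.mp h1).resolve_left hr

end PureSpinor

/-! ### Components of a spinor in degrees 0, 1 and 2. -/

section Components

variable {R H : Type*} [CommRing R] [AddCommGroup H] [Module R H]

theorem ιInv_algebraMap (r : R) :
    ExteriorAlgebra.ιInv (algebraMap R (ExteriorAlgebra R H) r) = 0 := by
  let : Module Rᵐᵒᵖ H := Module.compHom _ ((RingHom.id R).fromOpposite mul_comm)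
  have : IsCentralScalar R H := ⟨fun r m => rfl⟩
  change (ExteriorAlgebra.toTrivSqZeroExt (algebraMap R (ExteriorAlgebra R H) r)).snd = 0
  rw [AlgHom.commutes]
  rfl

theorem fst_toTrivSqZeroExt [Module Rᵐᵒᵖ H] [IsCentralScalar R H] (s : ExteriorAlgebra R H) :
    (ExteriorAlgebra.toTrivSqZeroExt s).fst = ExteriorAlgebra.algebraMapInv s := by
  have : (TrivSqZeroExt.fstHom R R H).comp ExteriorAlgebra.toTrivSqZeroExt =
      ExteriorAlgebra.algebraMapInv := by
    refine ExteriorAlgebra.hom_ext (LinearMap.ext fun m => ?_)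
    simp [ExteriorAlgebra.algebraMapInv, ExteriorAlgebra.toTrivSqZeroExt_ι]
  exact congrArg (fun f => f s) this

theorem ιInv_ι_mul (m : H) (s : ExteriorAlgebra R H) :
    ExteriorAlgebra.ιInv (ExteriorAlgebra.ι R m * s) = ExteriorAlgebra.algebraMapInv s • m := by
  let : Module Rᵐᵒᵖ H := Module.compHom _ ((RingHom.id R).fromOpposite mul_comm)
  have : IsCentralScalar R H := ⟨fun r m => rfl⟩
  change (ExteriorAlgebra.toTrivSqZeroExt (ExteriorAlgebra.ι R m * s)).snd = _
  rw [map_mul, ExteriorAlgebra.toTrivSqZeroExt_ι, TrivSqZeroExt.snd_mul, TrivSqZeroExt.fst_inr,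
    TrivSqZeroExt.snd_inr, zero_smul, zero_add, fst_toTrivSqZeroExt, op_smul_eq_smul]

theorem algebraMapInv_contr (d : Module.Dual R H) (s : ExteriorAlgebra R H) :
    ExteriorAlgebra.algebraMapInv (contr d s) = d (ExteriorAlgebra.ιInv s) := by
  refine CliffordAlgebra.left_induction (0 : QuadraticForm R H)
    (P := fun s : ExteriorAlgebra R H =>
      ExteriorAlgebra.algebraMapInv (contr d s) = d (ExteriorAlgebra.ιInv s)) ?_ ?_ ?_ s
  · intro r
    have h := ιInv_algebraMap (H := H) r
    have h' := CliffordAlgebra.contractLeft_algebraMap (Q := (0 : QuadraticForm R H)) d r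
    exact (congrArg _ h').trans ((map_zero _).trans ((congrArg d h).trans (map_zero d)).symm)
  · intro x y hx hy
    simp only [map_add, hx, hy]
  · intro x m _
    have h : contr d (ExteriorAlgebra.ι R m * x) = d m • x - ExteriorAlgebra.ι R m * contr d x :=
      contr_ι_mul d m x
    have h' := ιInv_ι_mul m x
    refine (congrArg ExteriorAlgebra.algebraMapInv h).trans (Eq.trans ?_ (congrArg d h').symm)
    rw [map_sub, map_smul, algebraMapInv_ι_mul, sub_zero, map_smul, smul_eq_mul, smul_eq_mul,
      mul_comm]

/-- The degree 2 part of m ∧ s is m ∧ s₁, and two contractions read off its 2 × 2 minors. -/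
theorem algebraMapInv_contr_contr_ι_mul (d d' : Module.Dual R H) (m : H)
    (s : ExteriorAlgebra R H) :
    ExteriorAlgebra.algebraMapInv (contr d' (contr d (ExteriorAlgebra.ι R m * s))) =
      d m * d' (ExteriorAlgebra.ιInv s) - d' m * d (ExteriorAlgebra.ιInv s) := by
  rw [contr_ι_mul, map_sub, map_smul, contr_ι_mul, map_sub, map_sub, map_smul, map_smul,
    algebraMapInv_ι_mul, algebraMapInv_contr, algebraMapInv_contr, sub_zero, smul_eq_mul,
    smul_eq_mul]

end Components

/-! ### The lift w and its value on the scalar functional. -/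

section Lift

variable {R B₀ B₁ H : Type*} [CommRing R] [AddCommGroup B₀] [Module R B₀] [AddCommGroup B₁]
  [Module R B₁] [AddCommGroup H] [Module R H]

theorem d₁_apply (a : VOdd R H) (f : Module.Dual R H) :
    d₁ a f = f (ExteriorAlgebra.ιInv (a : ExteriorAlgebra R H)) := rfl

theorem d₃_apply (δ₁ : B₁ →ₗ[R] B₀)
    (w : Module.Dual R (VEven R H) →ₗ[R] Module.Dual R B₁) (x : Module.Dual R B₀) (t : R) :
    d₃ δ₁ w (x, t) = delta4 δ₁ x + t • w (scalarFunctional R H) := by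
  simp [d₃]

variable [Module.Free R H] [Module.Finite R H] {δ₂ : Hyp R H →ₗ[R] B₁} {a : VOdd R H}
  {w : Module.Dual R (VEven R H) →ₗ[R] Module.Dual R B₁}

theorem d₂_apply (φ : Module.Dual R B₁) : d₂ δ₂ φ = (delta3 δ₂ φ).1 := rfl

/-- By nondegeneracy of the pairing, the identification with the dual can be removed; the map to be
lifted is then `delta3` formed with `actOn a` in place of δ₂. -/
theorem isSpinorLift_iff :
    IsSpinorLift δ₂ a w ↔ ∀ g, delta3 δ₂ (w g) = delta3 (actOn a) g := by
  have hinj : Function.Injective (LinearMap.dualProd R H) := by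
    intro x z h
    rw [← sub_eq_zero, ← map_sub] at h
    have h' : ∀ t, LinearMap.dualProd R H (x - z) t = 0 := fun t => by rw [h]; rfl
    rw [← sub_eq_zero]
    refine Prod.ext (LinearMap.ext fun m => ?_) ?_
    · simpa [dualProd_apply'] using h' (0, m)
    · refine (Module.forall_dual_apply_eq_zero_iff R _).mp fun d => ?_
      simpa [dualProd_apply'] using h' (d, 0)
  constructor
  · intro h g
    refine hinj (LinearMap.ext fun x => ?_)
    rw [dualProd_delta3 (actOn a)]
    exact congrArg (fun F => F g x) h
  · intro h
    refine LinearMap.ext fun g => LinearMap.ext fun x => ?_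
    rw [LinearMap.comp_apply, LinearMap.comp_apply, h, dualProd_delta3]
    rfl

/-- In degree 0, x·a involves only the contraction of the component of a in H. -/
theorem delta3_actOn_scalarFunctional (a : VOdd R H) :
    delta3 (actOn a) (scalarFunctional R H) = (0, ExteriorAlgebra.ιInv (a : ExteriorAlgebra R H)) := by
  have hs : ∀ x, scalarFunctional R H (actOn a x) =
      ExteriorAlgebra.algebraMapInv (spinorAct R H x a) := fun x => rfl
  refine Prod.ext (LinearMap.ext fun m => ?_) ?_
  · change scalarFunctional R H (actOn a (0, m)) = 0
    rw [hs, spinorAct_inr, algebraMapInv_ι_mul]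
  · rw [← sub_eq_zero]
    refine (Module.forall_dual_apply_eq_zero_iff R _).mp fun d => ?_
    have h := dualProd_delta3 (actOn a) (scalarFunctional R H) (d, 0)
    rw [dualProd_apply', hs, spinorAct_inl, algebraMapInv_contr, map_zero, zero_add] at h
    rw [map_sub, h, sub_self]

theorem IsSpinorLift.delta3_scalarFunctional (hw : IsSpinorLift δ₂ a w) :
    delta3 δ₂ (w (scalarFunctional R H)) =
      (0, ExteriorAlgebra.ιInv (a : ExteriorAlgebra R H)) := by
  rw [isSpinorLift_iff.mp hw, delta3_actOn_scalarFunctional]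

end Lift

/-! ### Purity of arbitrary spinor coordinates and existence of the lift. -/

section Coordinates

variable {R B₀ B₁ H : Type*} [CommRing R] [IsDomain R]
  [AddCommGroup B₀] [Module R B₀]
  [AddCommGroup B₁] [Module R B₁] [Module.Free R B₁] [Module.Finite R B₁]
  [AddCommGroup H] [Module R H] [Module.Free R H] [Module.Finite R H]
  {δ₁ : B₁ →ₗ[R] B₀} {δ₂ : Hyp R H →ₗ[R] B₁} {n r : ℕ}

/-- Spinor coordinates are killed by the isotropic submodule `im δ₃`. -/
theorem IsSpinorCoordinates.pure [UniqueFactorizationMonoid R] [IsNoetherianRing R]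
    [Invertible (2 : R)] [Module.Free R B₀] [Module.Finite R B₀] {a : VOdd R H}
    (ha : IsSpinorCoordinates n r δ₁ δ₂ a) (hB : IsSelfDualResolution δ₁ δ₂)
    (hH : Module.finrank R H = n) (hn : Module.finrank R B₁ = n + Module.finrank R B₀)
    (hcomp : DualInOtherComponent n δ₂) :
    (a : ExteriorAlgebra R H) ≠ 0 ∧
      ∀ x ∈ LinearMap.range (delta3 δ₂), spinorAct R H x a = 0 := by
  obtain ⟨e, a₃, ε, ha₃, hP⟩ := ha
  obtain ⟨s, hsodd, hs0, hp, hs⟩ := exists_pure_spinor hB hn hcomp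
  obtain ⟨ψ, v, y, hf, hy, -⟩ := hB.exists_frame (n := n) hn.ge (Or.inl rfl)
  have hv := ha₃.not_dvd_wedgePairing hf (Or.inl rfl) hy
  rw [zero_dvd_iff] at hv hy
  have hP0 : spinorP e (a : ExteriorAlgebra R H) a (exteriorPower.ιMulti R n v) ≠ 0 := by
    rw [hP, LinearMap.smul_apply, smul_eq_mul]
    exact mul_ne_zero ε.ne_zero hv
  refine ⟨fun h0 => hP0 ?_, fun x hx => ?_⟩
  · rw [h0, spinorP_ιMulti, map_zero, map_zero, LinearMap.zero_apply]
  -- As im δ₃ is isotropic, it suffices that the frame vectors in it kill `a`.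
  · refine hf.spinorAct_eq_zero hy hH (fun i => ?_) fun i => hB.isotropic ⟨_, rfl⟩ hx
    refine spinorAct_eq_zero_of_spinorP e hf hy hs0 (fun i => hs _ ⟨_, rfl⟩) hp hsodd a.2 ?_ hP0 i
    rintro u ⟨i, j, hij⟩
    rw [hP, LinearMap.smul_apply, ha₃.wedgePairing_eq_zero hB hn.ge (i := j), smul_zero]
    rw [hij]
    exact ⟨_, rfl⟩

/-- The map to be lifted takes values orthogonal to im δ₃, because im δ₃ kills a, hence values in im
δ₃. The dual of the even spinors is projective, as these are a summand of a free module. -/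
theorem exists_isSpinorLift (hB : IsSelfDualResolution δ₁ δ₂) {a : VOdd R H}
    (ha : ∀ x ∈ LinearMap.range (delta3 δ₂), spinorAct R H x a = 0) :
    ∃ w, IsSpinorLift δ₂ a w := by
  have := Module.Free.of_basis (Module.finBasis R H).ExteriorAlgebra
  have := Module.Finite.of_basis (Module.finBasis R H).ExteriorAlgebra
  have hcompl := CliffordAlgebra.evenOdd_isCompl (0 : QuadraticForm R H)
  have hproj : (Submodule.projectionOnto _ _ hcompl).comp (VEven R H).subtype =
      LinearMap.id := Submodule.projectionOnto_comp_subtype hcompl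
  have : Module.Projective R (VEven R H) := Module.Projective.of_split _ _ hproj
  have : Module.Finite R (VEven R H) := Module.Finite.of_surjective
    (Submodule.projectionOnto _ _ hcompl) (Submodule.projectionOnto_surjective hcompl)
  have hmem : ∀ g, delta3 (actOn a) g ∈ LinearMap.range (delta3 δ₂) := by
    intro g
    rw [hB.mem_range_iff]
    intro φ
    rw [dualProd_comm, dualProd_delta3]
    have h0 : actOn a (delta3 δ₂ φ) = 0 := Subtype.ext (ha _ ⟨φ, rfl⟩)
    rw [h0, map_zero]
  obtain ⟨w, hw⟩ := Module.projective_lifting_property (delta3 δ₂).rangeRestrict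
    ((delta3 (actOn a)).codRestrict _ hmem) (delta3 δ₂).surjective_rangeRestrict
  refine ⟨w, isSpinorLift_iff.mpr fun g => ?_⟩
  exact congrArg (fun F => (F g : Hyp R H)) hw

end Coordinates

/-! ### The compositions in 𝔸 and injectivity of d₃. -/

section Composition

variable {R B₀ B₁ H : Type*} [CommRing R] [AddCommGroup B₀] [Module R B₀] [AddCommGroup B₁]
  [Module R B₁] [AddCommGroup H] [Module R H] [Module.Free R H] [Module.Finite R H]
  {δ₁ : B₁ →ₗ[R] B₀} {δ₂ : Hyp R H →ₗ[R] B₁} {a : VOdd R H}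
  {w : Module.Dual R (VEven R H) →ₗ[R] Module.Dual R B₁}

theorem d₂_comp_d₃ (hB : IsSelfDualResolution δ₁ δ₂) (hw : IsSpinorLift δ₂ a w) :
    d₂ δ₂ ∘ₗ d₃ δ₁ w = 0 := by
  refine LinearMap.ext fun ⟨x, t⟩ => ?_
  rw [LinearMap.comp_apply, d₃_apply, d₂_apply, map_add, delta3_delta4 hB, map_smul,
    hw.delta3_scalarFunctional]
  simp

/-- This is the degree 0 part of (f, m)·a = 0 for (f, m) in im δ₃. -/
theorem d₁_comp_d₂ (ha : ∀ x ∈ LinearMap.range (delta3 δ₂), spinorAct R H x a = 0) :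
    d₁ a ∘ₗ d₂ δ₂ = 0 := by
  refine LinearMap.ext fun φ => ?_
  have h := congrArg ExteriorAlgebra.algebraMapInv (ha _ ⟨φ, rfl⟩)
  rw [spinorAct_apply, map_add, algebraMapInv_ι_mul, map_zero, zero_add] at h
  rw [LinearMap.comp_apply, d₁_apply, d₂_apply, ← algebraMapInv_contr]
  exact h

theorem d₃_injective [IsDomain R] (hB : IsSelfDualResolution δ₁ δ₂) (hw : IsSpinorLift δ₂ a w)
    (hI : idealI a ≠ ⊥) : Function.Injective (d₃ δ₁ w) := by
  rw [← LinearMap.ker_eq_bot, LinearMap.ker_eq_bot']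
  rintro ⟨x, t⟩ h
  rw [d₃_apply] at h
  have h1 := congrArg (delta3 δ₂) h
  rw [map_add, delta3_delta4 hB, map_smul, hw.delta3_scalarFunctional, zero_add, map_zero] at h1
  have ha1 : ExteriorAlgebra.ιInv (a : ExteriorAlgebra R H) ≠ 0 := by
    intro h0
    refine hI ((Submodule.eq_bot_iff _).mpr ?_)
    rintro _ ⟨f, rfl⟩
    rw [d₁_apply, h0, map_zero]
  have ht : t = 0 := (smul_eq_zero.mp (congrArg Prod.snd h1)).resolve_right ha1
  rw [ht, zero_smul, add_zero] at h
  have hx : x = 0 := hB.injective (by rw [h, map_zero])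
  rw [ht, hx]
  rfl

end Composition

/-! ### Exactness of 𝔸. -/

section Complex

variable {R B₀ B₁ H : Type*} [CommRing R] [IsDomain R]
  [AddCommGroup B₀] [Module R B₀]
  [AddCommGroup B₁] [Module R B₁]
  [AddCommGroup H] [Module R H] [Module.Free R H] [Module.Finite R H]
  {δ₁ : B₁ →ₗ[R] B₀} {δ₂ : Hyp R H →ₗ[R] B₁} {a : VOdd R H}
  {w : Module.Dual R (VEven R H) →ₗ[R] Module.Dual R B₁}

/-- The condition `Hom(R/I, R/r) = 0` for all `r ≠ 0`. -/
def CancelsDvd (I : Ideal R) : Prop := ∀ r x : R, r ≠ 0 → (∀ i ∈ I, r ∣ i * x) → r ∣ x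

/-- Every homomorphism from the ideal to `R/r`, for `r ≠ 0`, is a multiplication. -/
def ExtendsHom (I : Ideal R) : Prop :=
  ∀ r : R, r ≠ 0 → ∀ φ : I →ₗ[R] R ⧸ Ideal.span {r}, ∃ ρ, ∀ i : I, φ i = (i : R) • ρ

theorem exact_d₃_d₂ (hB : IsSelfDualResolution δ₁ δ₂) (hw : IsSpinorLift δ₂ a w)
    (ha : ∀ x ∈ LinearMap.range (delta3 δ₂), spinorAct R H x a = 0)
    (hI : idealI a ≠ ⊥) (h1 : CancelsDvd (idealI a)) :
    Function.Exact (d₃ δ₁ w) (d₂ δ₂) := by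
  rw [LinearMap.exact_iff]
  refine le_antisymm ?_ (LinearMap.range_le_ker_iff.mpr (d₂_comp_d₃ hB hw))
  intro φ hφ
  rw [LinearMap.mem_ker, d₂_apply] at hφ
  set a₁ := ExteriorAlgebra.ιInv (a : ExteriorAlgebra R H) with ha₁
  set m := (delta3 δ₂ φ).2 with hm
  have hm' : delta3 δ₂ φ = (0, m) := Prod.ext hφ rfl
  -- The relation m ∧ a = 0 in degree 2: m and a₁ are proportional, and `h1` makes the ratio an
  -- element of R.
  have hcross : ∀ d d' : Module.Dual R H, d m * d' a₁ = d' m * d a₁ := by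
    intro d d'
    have h := ha _ ⟨φ, rfl⟩
    rw [hm', spinorAct_inr] at h
    rw [← sub_eq_zero, ← algebraMapInv_contr_contr_ι_mul, h, map_zero, map_zero, map_zero]
  obtain ⟨_, ⟨d, rfl⟩, hd⟩ := Submodule.exists_mem_ne_zero_of_ne_bot hI
  rw [d₁_apply, ← ha₁] at hd
  obtain ⟨t, ht⟩ := h1 (d a₁) (d m) hd (by
    rintro _ ⟨d', rfl⟩
    rw [d₁_apply, mul_comm, hcross d d']
    exact ⟨_, mul_comm _ _⟩)
  have hmt : m = t • a₁ := by
    rw [← sub_eq_zero]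
    refine (Module.forall_dual_apply_eq_zero_iff R _).mp fun d' => ?_
    rw [map_sub, map_smul, smul_eq_mul, sub_eq_zero]
    refine mul_right_cancel₀ hd ?_
    rw [← hcross d d', ht]
    ring
  obtain ⟨x, hx⟩ := (hB.exact₃ (φ - t • w (scalarFunctional R H))).mp (by
    rw [map_sub, map_smul, hm', hw.delta3_scalarFunctional, hmt]
    simp [ha₁])
  exact ⟨(x, t), by rw [d₃_apply, hx]; abel⟩

variable [Module.Free R B₀] [Module.Finite R B₀] [Module.Free R B₁] [Module.Finite R B₁]

/-- Rank count: im d₂ has rank n − 1, and ker d₁ is no larger because d₁ ≠ 0. -/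
theorem exists_smul_mem_range_d₂ [IsNoetherianRing R] (hB : IsSelfDualResolution δ₁ δ₂) (hw : IsSpinorLift δ₂ a w)
    (ha : ∀ x ∈ LinearMap.range (delta3 δ₂), spinorAct R H x a = 0)
    (hI : idealI a ≠ ⊥) (h1 : CancelsDvd (idealI a))
    (hn : Module.finrank R B₁ = Module.finrank R H + Module.finrank R B₀)
    {f : Module.Dual R H} (hf : d₁ a f = 0) : ∃ r : R, r ≠ 0 ∧ r • f ∈ LinearMap.range (d₂ δ₂) := by
  have h3 := finrank_range_add_finrank_ker_of_isDomain (d₂ δ₂)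
  rw [(exact_d₃_d₂ hB hw ha hI h1).linearMap_ker_eq,
    LinearMap.finrank_range_of_inj (d₃_injective hB hw hI), Module.finrank_prod,
    Module.finrank_linearMap, Module.finrank_linearMap, Module.finrank_self, mul_one, mul_one] at h3
  have h4 := finrank_range_add_finrank_ker_of_isDomain (d₁ a)
  have h5 : 1 ≤ Module.finrank R (LinearMap.range (d₁ a)) := by
    have : Nontrivial (LinearMap.range (d₁ a)) := Submodule.nontrivial_iff_ne_bot.mpr hI
    exact Module.finrank_pos
  rw [Module.finrank_linearMap, Module.finrank_self, mul_one] at h4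
  have hle : LinearMap.range (d₂ δ₂) ≤ LinearMap.ker (d₁ a) :=
    LinearMap.range_le_ker_iff.mpr (d₁_comp_d₂ ha)
  let N := (LinearMap.range (d₂ δ₂)).comap (LinearMap.ker (d₁ a)).subtype
  have hN : Module.finrank R N = Module.finrank R (LinearMap.range (d₂ δ₂)) :=
    (Submodule.comapSubtypeEquivOfLe hle).finrank_eq
  have hrank : Module.finrank R (LinearMap.ker (d₁ a)) ≤ Module.finrank R N := by omega
  obtain ⟨r, hr, h⟩ := exists_smul_mem_of_finrank_le (M := LinearMap.ker (d₁ a)) N hrank ⟨f, hf⟩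
  exact ⟨r, hr, h⟩

theorem exact_d₂_d₁ [IsNoetherianRing R] (hB : IsSelfDualResolution δ₁ δ₂) (hw : IsSpinorLift δ₂ a w)
    (ha : ∀ x ∈ LinearMap.range (delta3 δ₂), spinorAct R H x a = 0)
    (hI : idealI a ≠ ⊥) (h1 : CancelsDvd (idealI a)) (h2 : ExtendsHom (idealI a))
    (hn : Module.finrank R B₁ = Module.finrank R H + Module.finrank R B₀) :
    Function.Exact (d₂ δ₂) (d₁ a) := by
  rw [LinearMap.exact_iff]
  refine le_antisymm ?_ (LinearMap.range_le_ker_iff.mpr (d₁_comp_d₂ ha))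
  intro f hf
  obtain ⟨r, hr, φ, hφ⟩ := exists_smul_mem_range_d₂ hB hw ha hI h1 hn hf
  rw [d₂_apply] at hφ
  set a₁ := ExteriorAlgebra.ιInv (a : ExteriorAlgebra R H) with ha₁
  set m := (delta3 δ₂ φ).2 with hm
  have hm' : delta3 δ₂ φ = (r • f, m) := Prod.ext hφ rfl
  -- In degree 2, m ∧ a₁ equals −r times a contraction of a, so m and a₁ are proportional modulo
  -- `r`.
  have hcross : ∀ d d' : Module.Dual R H, r ∣ d m * d' a₁ - d' m * d a₁ := by
    intro d d'
    have h := ha _ ⟨φ, rfl⟩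
    rw [hm', spinorAct_apply] at h
    have h' : ExteriorAlgebra.ι R m * (a : ExteriorAlgebra R H) = -(r • contr f a) := by
      rw [eq_neg_iff_add_eq_zero, ← h, map_smul]
      rfl
    rw [← algebraMapInv_contr_contr_ι_mul, h', map_neg, map_neg, map_neg, map_smul, map_smul,
      map_smul, dvd_neg]
    exact ⟨_, rfl⟩
  -- The rule d(a₁) ↦ d(m) is a well defined map from I to R/r, by `h1`; `h2` makes it a
  -- multiplication by some `ρ`.
  let ev : Module.Dual R H →ₗ[R] R ⧸ Ideal.span {r} :=
    (Ideal.span {r}).mkQ ∘ₗ Module.Dual.eval R H m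
  have hev : LinearMap.ker (d₁ a) ≤ LinearMap.ker ev := by
    intro d hd
    rw [LinearMap.mem_ker, d₁_apply, ← ha₁] at hd
    change (Ideal.span {r}).mkQ (d m) = 0
    rw [Submodule.mkQ_apply, Submodule.Quotient.mk_eq_zero, Ideal.mem_span_singleton]
    refine h1 r (d m) hr ?_
    rintro _ ⟨d', rfl⟩
    have := hcross d d'
    rwa [hd, mul_zero, sub_zero, mul_comm] at this
  obtain ⟨ρ, hρ⟩ := h2 r hr
    ((LinearMap.ker (d₁ a)).liftQ ev hev ∘ₗ (d₁ a).quotKerEquivRange.symm.toLinearMap)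
  obtain ⟨ρ, rfl⟩ := Ideal.Quotient.mk_surjective ρ
  have hdvd : ∀ d : Module.Dual R H, r ∣ d (m - ρ • a₁) := by
    intro d
    have h : (LinearMap.ker (d₁ a)).liftQ ev hev ((d₁ a).quotKerEquivRange.symm ⟨d₁ a d, d, rfl⟩) =
        d₁ a d • Ideal.Quotient.mk (Ideal.span {r}) ρ := hρ ⟨d₁ a d, d, rfl⟩
    have h' : (d₁ a).quotKerEquivRange.symm ⟨d₁ a d, d, rfl⟩ = Submodule.Quotient.mk d := by
      rw [LinearEquiv.symm_apply_eq]
      rfl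
    rw [h', Submodule.liftQ_apply] at h
    have h'' : Ideal.Quotient.mk (Ideal.span {r}) (d m - d a₁ * ρ) = 0 := by
      rw [map_sub, sub_eq_zero]
      exact h
    rw [Ideal.Quotient.eq_zero_iff_mem, Ideal.mem_span_singleton] at h''
    rwa [map_sub, map_smul, smul_eq_mul, mul_comm ρ]
  obtain ⟨m', hmm⟩ := exists_eq_smul_of_dvd (Module.finBasis R H) (z := m - ρ • a₁) (π := r)
    fun i => hdvd ((Module.finBasis R H).coord i)
  -- Subtracting ρ(0, a₁) makes both components divisible by `r`, and im δ₃ is saturated.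
  have hmem : r • ((f, m') : Hyp R H) ∈ LinearMap.range (delta3 δ₂) := by
    refine ⟨φ - ρ • w (scalarFunctional R H), ?_⟩
    rw [map_sub, map_smul, hm', hw.delta3_scalarFunctional, ← ha₁]
    refine Prod.ext ?_ ?_
    · simp
    · simpa using hmm
  obtain ⟨ψ, hψ⟩ := hB.mem_range_of_smul hr hmem
  exact ⟨ψ, by rw [d₂_apply, hψ]⟩

end Complex

/-! ### Consequences of the vanishing of Ext. -/

section Ext

universe u

open CategoryTheory CategoryTheory.Abelian

variable {R : Type u} [CommRing R] {A B C X Y : Type u} [AddCommGroup A] [Module R A]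
  [AddCommGroup B] [Module R B] [AddCommGroup C] [Module R C] [AddCommGroup X] [Module R X]
  [AddCommGroup Y] [Module R Y] {f : A →ₗ[R] B} {g : B →ₗ[R] C}

variable (R X Y) in
/-- The vanishing of `Ext^i(X, Y)`. -/
def ExtVanishes (i : ℕ) : Prop :=
  Subsingleton (Ext.{u} (ModuleCat.of R X) (ModuleCat.of R Y) i)

/-- The short complex of module objects given by an exact pair of linear maps. -/
abbrev shortComplexOf (hfg : Function.Exact f g) : ShortComplex (ModuleCat.{u} R) :=
  ShortComplex.mk (ModuleCat.ofHom f) (ModuleCat.ofHom g) (by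
    rw [← ModuleCat.ofHom_comp, hfg.linearMap_comp_eq_zero]
    rfl)

theorem shortExact_shortComplexOf (hf : Function.Injective f) (hg : Function.Surjective g)
    (hfg : Function.Exact f g) : (shortComplexOf hfg).ShortExact :=
  ModuleCat.shortComplex_shortExact _ hfg hf hg

theorem ExtVanishes.right (hf : Function.Injective f) (hg : Function.Surjective g)
    (hfg : Function.Exact f g) {i : ℕ} (hB : ExtVanishes R X B i)
    (hA : ExtVanishes R X A (i + 1)) : ExtVanishes R X C i := by
  have hS := shortExact_shortComplexOf hf hg hfg
  refine subsingleton_of_forall_eq 0 fun x => ?_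
  obtain ⟨y, rfl⟩ := Ext.covariant_sequence_exact₃ (ModuleCat.of R X) hS x rfl (hA.elim _ _)
  rw [hB.elim y 0, Ext.zero_comp]

theorem ExtVanishes.left [Module.Projective R B] (hf : Function.Injective f)
    (hg : Function.Surjective g) (hfg : Function.Exact f g) {i : ℕ}
    (hC : ExtVanishes R C Y (i + 2)) : ExtVanishes R A Y (i + 1) := by
  have hS := shortExact_shortComplexOf hf hg hfg
  refine subsingleton_of_forall_eq 0 fun x => ?_
  obtain ⟨y, rfl⟩ := Ext.contravariant_sequence_exact₁ hS (ModuleCat.of R Y) x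
    (show 1 + (i + 1) = i + 2 by omega) (hC.elim _ _)
  have : Projective (ModuleCat.of R B) := ModuleCat.projective_of_categoryTheory_projective _
  rw [Ext.eq_zero_of_projective y, Ext.comp_zero]

theorem ExtVanishes.exists_extension (hf : Function.Injective f) (hg : Function.Surjective g)
    (hfg : Function.Exact f g) (hC : ExtVanishes R C Y 1) (φ : A →ₗ[R] Y) :
    ∃ ψ : B →ₗ[R] Y, ψ ∘ₗ f = φ := by
  have hS := shortExact_shortComplexOf hf hg hfg
  obtain ⟨y, hy⟩ := Ext.contravariant_sequence_exact₁ hS (ModuleCat.of R Y)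
    (Ext.mk₀ (ModuleCat.ofHom φ)) (show 1 + 0 = 1 from rfl) (hC.elim _ _)
  obtain ⟨ψ, rfl⟩ := Ext.mk₀_bijective _ _ |>.surjective y
  rw [Ext.mk₀_comp_mk₀] at hy
  have h := (Ext.mk₀_bijective _ _).injective hy
  exact ⟨ψ.hom, congrArg ModuleCat.Hom.hom h⟩

theorem ExtVanishes.eq_zero (h : ExtVanishes R X Y 0) (φ : X →ₗ[R] Y) : φ = 0 := by
  have h0 : Ext.mk₀ (ModuleCat.ofHom φ) = 0 := h.elim _ _
  rw [Ext.mk₀_eq_zero_iff] at h0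
  exact congrArg ModuleCat.Hom.hom h0

theorem extVanishes_of_lt_grade {I : Ideal R} {i : ℕ} (h : (i : ℕ∞) < grade I) :
    ExtVanishes R (R ⧸ I) R i := by
  rw [ExtVanishes, ← not_nontrivial_iff_subsingleton]
  intro hi
  exact h.not_ge (sInf_le (show (i : ℕ∞) ∈ {g : ℕ∞ | _} from ⟨i, rfl, hi⟩))

theorem ne_bot_of_extVanishes [Nontrivial R] {I : Ideal R} (h : ExtVanishes R (R ⧸ I) R 0) :
    I ≠ ⊥ := by
  intro hI
  have h0 := h.eq_zero (I.liftQ LinearMap.id (by rw [hI]; exact bot_le))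
  have h1 : (1 : R) = 0 := congrArg (fun φ => φ (Submodule.Quotient.mk 1)) h0
  exact one_ne_zero h1

theorem ExtVanishes.quotient_span [IsDomain R] {i : ℕ} {r : R} (hr : r ≠ 0) (h : ExtVanishes R X R i)
    (h' : ExtVanishes R X R (i + 1)) : ExtVanishes R X (R ⧸ Ideal.span {r}) i := by
  refine ExtVanishes.right (f := LinearMap.mulLeft R r) (g := (Ideal.span {r}).mkQ)
    (mul_right_injective₀ hr) (Submodule.mkQ_surjective _) ?_ h h'
  intro x
  rw [Submodule.mkQ_apply, Submodule.Quotient.mk_eq_zero, Ideal.mem_span_singleton]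
  exact ⟨fun ⟨y, hy⟩ => ⟨y, hy.symm⟩, fun ⟨y, hy⟩ => ⟨y, hy.symm⟩⟩

/-- The element x defines a map R/I → R/r, and Hom(R/I, R/r) = 0. -/
theorem cancelsDvd_of_extVanishes [IsDomain R] {I : Ideal R} (h0 : ExtVanishes R (R ⧸ I) R 0)
    (h1 : ExtVanishes R (R ⧸ I) R 1) : CancelsDvd I := by
  intro r x hr hx
  have h := (h0.quotient_span hr h1).eq_zero
    (I.liftQ (LinearMap.toSpanSingleton R _ (Ideal.Quotient.mk (Ideal.span {r}) x)) (by
      intro i hi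
      rw [LinearMap.mem_ker, LinearMap.toSpanSingleton_apply]
      exact (Ideal.Quotient.eq_zero_iff_mem.mpr (Ideal.mem_span_singleton.mpr (hx i hi)))))
  have h' := congrArg (fun φ => φ (Submodule.Quotient.mk 1)) h
  simp only [Submodule.liftQ_apply, LinearMap.toSpanSingleton_apply, one_smul,
    LinearMap.zero_apply] at h'
  rwa [Ideal.Quotient.eq_zero_iff_mem, Ideal.mem_span_singleton] at h'

theorem exact_subtype_mkQ (I : Ideal R) : Function.Exact I.subtype I.mkQ := by
  rw [LinearMap.exact_iff, Submodule.ker_mkQ, Submodule.range_subtype]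

/-- As Ext¹(R/I, R/r) = 0, the map extends from I to R, where it is multiplication by its value at
1. -/
theorem extendsHom_of_extVanishes [IsDomain R] {I : Ideal R} (h1 : ExtVanishes R (R ⧸ I) R 1)
    (h2 : ExtVanishes R (R ⧸ I) R 2) : ExtendsHom I := by
  intro r hr φ
  obtain ⟨ψ, hψ⟩ := (h1.quotient_span hr h2).exists_extension I.injective_subtype
    (Submodule.mkQ_surjective I) (exact_subtype_mkQ I) φ
  refine ⟨ψ 1, fun i => ?_⟩
  rw [← hψ, ← map_smul, smul_eq_mul, mul_one]
  rfl

theorem exists_retraction_of_forall_dual [Module.Projective R A] [Module.Finite R A]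
    (h : ∀ φ : A →ₗ[R] R, ∃ ψ : B →ₗ[R] R, ψ ∘ₗ f = φ) : ∃ ρ : B →ₗ[R] A, ρ ∘ₗ f = LinearMap.id := by
  obtain ⟨k, p, hp⟩ := Module.Finite.exists_fin' R A
  obtain ⟨σ, hσ⟩ := Module.projective_lifting_property p LinearMap.id hp
  choose ψ hψ using fun i => h (LinearMap.proj i ∘ₗ σ)
  refine ⟨p ∘ₗ LinearMap.pi ψ, ?_⟩
  rw [← hσ, LinearMap.comp_assoc]
  congr 1
  refine LinearMap.ext fun x => funext fun i => ?_
  exact congrArg (fun F => F x) (hψ i)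

/-- The module A is a summand of some Rᵏ, so extending functionals from A to B suffices to split the
sequence. -/
theorem projective_of_exact [Module.Projective R A] [Module.Finite R A] [Module.Projective R B]
    (hf : Function.Injective f) (hg : Function.Surjective g) (hfg : Function.Exact f g)
    (hC : ExtVanishes R C R 1) : Module.Projective R C := by
  have h : Function.Surjective g ∧ ∃ l, l ∘ₗ f = LinearMap.id :=
    ⟨hg, exists_retraction_of_forall_dual fun φ => hC.exists_extension hf hg hfg φ⟩
  obtain ⟨-, s, hs⟩ := (hfg.split_tfae'.out 1 0).mp h
  exact Module.Projective.of_split s g hs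

theorem exact_subtype_rangeRestrict {M₁ M₂ M₃ : Type*} [AddCommGroup M₁] [Module R M₁]
    [AddCommGroup M₂] [Module R M₂] [AddCommGroup M₃] [Module R M₃] {d : M₁ →ₗ[R] M₂}
    {d' : M₂ →ₗ[R] M₃} (h : Function.Exact d d') :
    Function.Exact (LinearMap.range d).subtype d'.rangeRestrict := by
  rw [LinearMap.exact_iff, LinearMap.ker_rangeRestrict, Submodule.range_subtype,
    h.linearMap_ker_eq]

theorem exact_rangeRestrict {M₁ M₂ M₃ : Type*} [AddCommGroup M₁] [Module R M₁]
    [AddCommGroup M₂] [Module R M₂] [AddCommGroup M₃] [Module R M₃] {d : M₁ →ₗ[R] M₂}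
    {d' : M₂ →ₗ[R] M₃} (h : Function.Exact d d') : Function.Exact d d'.rangeRestrict := by
  rw [LinearMap.exact_iff, LinearMap.ker_rangeRestrict, h.linearMap_ker_eq]

/-- If `R/I` has a resolution of length three by finite free modules and `Ext^i(R/I, R)` vanishes
for `i ≤ 3`, then `I` is the unit ideal. -/
theorem eq_top_of_pi_resolution [IsDomain R] {k₁ k₂ k₃ : ℕ} {d₃ : (Fin k₃ → R) →ₗ[R] Fin k₂ → R}
    {d₂ : (Fin k₂ → R) →ₗ[R] Fin k₁ → R} {d₁ : (Fin k₁ → R) →ₗ[R] R}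
    (h₃ : Function.Injective d₃) (h₂ : Function.Exact d₃ d₂) (h₁ : Function.Exact d₂ d₁)
    (hExt : ∀ i ≤ 3, ExtVanishes R (R ⧸ (LinearMap.range d₁ : Ideal R)) R i) :
    (LinearMap.range d₁ : Ideal R) = ⊤ := by
  set I : Ideal R := LinearMap.range d₁ with hI
  have hIQ := exact_subtype_mkQ I
  have e2 : ExtVanishes R I R 2 := (hExt 3 le_rfl).left I.injective_subtype I.mkQ_surjective hIQ
  have e1 : ExtVanishes R I R 1 :=
    (hExt 2 (by norm_num)).left I.injective_subtype I.mkQ_surjective hIQ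
  have e1' : ExtVanishes R (LinearMap.range d₂) R 1 :=
    ExtVanishes.left (C := I) (LinearMap.range d₂).injective_subtype d₁.surjective_rangeRestrict
      (exact_subtype_rangeRestrict h₁) e2
  have p2 : Module.Projective R (LinearMap.range d₂) :=
    projective_of_exact h₃ d₂.surjective_rangeRestrict (exact_rangeRestrict h₂) e1'
  have p1 : Module.Projective R I :=
    projective_of_exact (C := I) (LinearMap.range d₂).injective_subtype
      d₁.surjective_rangeRestrict (exact_subtype_rangeRestrict h₁) e1
  have f1 : Module.Finite R I := inferInstanceAs (Module.Finite R (LinearMap.range d₁))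
  -- Now I is finite projective with Ext¹(R/I, R) = 0, so it is a retract of R. For i ≠ 0 in I,
  -- iρ(1) = ρ(i) = i, whence ρ(1) = 1 lies in I.
  obtain ⟨ρ, hρ⟩ := exists_retraction_of_forall_dual (f := I.subtype) fun φ =>
    (hExt 1 (by norm_num)).exists_extension I.injective_subtype I.mkQ_surjective hIQ φ
  obtain ⟨i, hi, hi0⟩ := Submodule.exists_mem_ne_zero_of_ne_bot
    (ne_bot_of_extVanishes (hExt 0 (by norm_num)))
  have h := congrArg (fun F => (F ⟨i, hi⟩ : R)) hρ
  have h' : i * (ρ 1 : R) = i * 1 := by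
    rw [mul_one]
    refine Eq.trans ?_ h
    change _ = ((ρ i : I) : R)
    conv_rhs => rw [← mul_one i, ← smul_eq_mul, map_smul]
    rfl
  rw [Ideal.eq_top_iff_one, ← mul_left_cancel₀ hi0 h']
  exact (ρ 1).2

/-- Choosing bases moves the free modules into the universe of R, in which the Ext groups are
formed. -/
theorem eq_top_of_resolution [IsDomain R] {F₁ F₂ F₃ : Type*} [AddCommGroup F₁] [Module R F₁] [Module.Free R F₁]
    [Module.Finite R F₁] [AddCommGroup F₂] [Module R F₂] [Module.Free R F₂] [Module.Finite R F₂]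
    [AddCommGroup F₃] [Module R F₃] [Module.Free R F₃] [Module.Finite R F₃] {d₃ : F₃ →ₗ[R] F₂}
    {d₂ : F₂ →ₗ[R] F₁} {d₁ : F₁ →ₗ[R] R} (h₃ : Function.Injective d₃)
    (h₂ : Function.Exact d₃ d₂) (h₁ : Function.Exact d₂ d₁)
    (hExt : ∀ i ≤ 3, ExtVanishes R (R ⧸ (LinearMap.range d₁ : Ideal R)) R i) :
    (LinearMap.range d₁ : Ideal R) = ⊤ := by
  let e₁ := (Module.finBasis R F₁).equivFun
  let e₂ := (Module.finBasis R F₂).equivFun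
  let e₃ := (Module.finBasis R F₃).equivFun
  have hrange : LinearMap.range (d₁ ∘ₗ e₁.symm.toLinearMap) = LinearMap.range d₁ :=
    LinearEquiv.range_comp e₁.symm d₁
  rw [← hrange] at hExt ⊢
  refine eq_top_of_pi_resolution (d₃ := e₂.toLinearMap ∘ₗ d₃ ∘ₗ e₃.symm.toLinearMap)
    (d₂ := e₁.toLinearMap ∘ₗ d₂ ∘ₗ e₂.symm.toLinearMap) ?_ ?_ ?_ hExt
  · exact e₂.injective.comp (h₃.comp e₃.symm.injective)
  · intro x
    simp only [LinearMap.comp_apply, LinearEquiv.coe_coe, EmbeddingLike.map_eq_zero_iff, h₂ _,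
      Set.mem_range]
    constructor
    · rintro ⟨y, hy⟩
      exact ⟨e₃ y, by simp [hy]⟩
    · rintro ⟨y, rfl⟩
      exact ⟨e₃.symm y, by simp⟩
  · intro x
    simp only [LinearMap.comp_apply, LinearEquiv.coe_coe, h₁ _, Set.mem_range]
    constructor
    · rintro ⟨y, hy⟩
      exact ⟨e₂ y, by simp [hy]⟩
    · rintro ⟨y, rfl⟩
      exact ⟨e₂.symm y, by simp⟩

end Ext

end SpinorRes

end

open SpinorRes in
theorem mainTheorem3 {R : Type*} [CommRing R] [IsDomain R] [UniqueFactorizationMonoid R]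
    [IsNoetherianRing R] [Invertible (2 : R)]
    (p q : ℕ) (hp : 1 ≤ p) (hq : 3 ≤ q)
    {B₀ B₁ H : Type*}
    [AddCommGroup B₀] [Module R B₀] [Module.Free R B₀] [Module.Finite R B₀]
    [AddCommGroup B₁] [Module R B₁] [Module.Free R B₁] [Module.Finite R B₁]
    [AddCommGroup H] [Module R H] [Module.Free R H] [Module.Finite R H]
    (hB₀ : Module.finrank R B₀ = q - 2) (hB₁ : Module.finrank R B₁ = p + q)
    (hH : Module.finrank R H = p + 2)
    (δ₁ : B₁ →ₗ[R] B₀) (δ₂ : Hyp R H →ₗ[R] B₁)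
    (hB : IsSelfDualResolution δ₁ δ₂)
    (hcomp : DualInOtherComponent (p + 2) δ₂) :
    (∃ a : VOdd R H, IsSpinorCoordinates (p + 2) (q - 2) δ₁ δ₂ a) ∧
    ∀ a : VOdd R H, IsSpinorCoordinates (p + 2) (q - 2) δ₁ δ₂ a →
      (∃ w : Module.Dual R (VEven R H) →ₗ[R] Module.Dual R B₁, IsSpinorLift δ₂ a w) ∧
      ∀ w : Module.Dual R (VEven R H) →ₗ[R] Module.Dual R B₁, IsSpinorLift δ₂ a w →
        (d₂ δ₂ ∘ₗ d₃ δ₁ w = 0 ∧ d₁ a ∘ₗ d₂ δ₂ = 0) ∧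
        (3 ≤ grade (idealI a) →
          (Function.Injective (d₃ δ₁ w) ∧ Function.Exact (d₃ δ₁ w) (d₂ δ₂) ∧
            Function.Exact (d₂ δ₂) (d₁ a)) ∧
          (grade (idealI a) = 3 ∨ idealI a = ⊤)) := by
  have hn : Module.finrank R B₁ = p + 2 + Module.finrank R B₀ := by omega
  have hn' : Module.finrank R B₁ = Module.finrank R H + Module.finrank R B₀ := by omega
  refine ⟨?_, fun a ha => ?_⟩
  · obtain ⟨a₃, ha₃⟩ := hB.exists_isMultiplier hH hB₀ (by omega)
    obtain ⟨s, hsodd, hs0, hsp, hs⟩ := exists_pure_spinor hB hn hcomp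
    obtain ⟨ε, hε⟩ := exists_spinorP_eq_smul hB hH hn.ge ha₃ (Module.finBasisOfFinrankEq R H hH)
      hs0 hsp hs
    exact ⟨⟨s, hsodd⟩, _, a₃, ε, ha₃, hε⟩
  · have hpure := (ha.pure hB hH hn hcomp).2
    refine ⟨exists_isSpinorLift hB hpure, fun w hw =>
      ⟨⟨d₂_comp_d₃ hB hw, d₁_comp_d₂ hpure⟩, fun hgrade => ?_⟩⟩
    have hExt : ∀ i : ℕ, i < 3 → ExtVanishes R (R ⧸ idealI a) R i := fun i hi =>
      extVanishes_of_lt_grade (lt_of_lt_of_le (by exact_mod_cast hi) hgrade)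
    have hI := ne_bot_of_extVanishes (hExt 0 (by norm_num))
    have hcancel := cancelsDvd_of_extVanishes (hExt 0 (by norm_num)) (hExt 1 (by norm_num))
    have hextend := extendsHom_of_extVanishes (hExt 1 (by norm_num)) (hExt 2 (by norm_num))
    have h₃ := d₃_injective hB hw hI
    have h₂ := exact_d₃_d₂ hB hw hpure hI hcancel
    have h₁ := exact_d₂_d₁ hB hw hpure hI hcancel hextend hn'
    refine ⟨⟨h₃, h₂, h₁⟩, hgrade.eq_or_lt.imp Eq.symm fun hlt => ?_⟩
    refine eq_top_of_resolution h₃ h₂ h₁ fun i hi => ?_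
    rcases hi.lt_or_eq with hi | rfl
    · exact hExt i hi
    · exact extVanishes_of_lt_grade hlt
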